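/- **Setting.** Let $\Omega\subset\mathbb R^2$ be a bounded polygonal domain with two nonoverlapping polygonal subdomains $\Omega_1,\Omega_2$, $\overline\Omega=\overline\Omega_1\cup\overline\Omega_2$ (each of the three connected and equal to the interior of its closure), and let $\Gamma=\partial\Omega_1\cap\partial\Omega_2$, with $\partial\Omega_i\setminus\Gamma\neq\emptyset$ for $i=1,2$. No symmetry is assumed. Let $W\subset H^1_0(\Omega)$ be the conforming P1 finite element space of a finite conforming triangulation of $\Omega$ no triangle of which is cut by $\Gamma$; let $W_i$ be the restrictions of $W$ to $\Omega_i$, $W_i^0=W\cap H_0^1(\Omega_i)$, $V_\Gamma=W|_\Gamma$ and $\langle u,v\rangle=\int_\Gamma uv$. For $\nu_1,\nu_2>0$ put $a_i(u,v)=\int_{\Omega_i}\nu_i\nabla u\cdot\nabla v$. Let $\mathcal H_i:V_\Gamma\to W_i$ be the discrete harmonic extension ($\mathcal H_ig=g$ on $\Gamma$, $\mathcal H_ig=0$ on $\partial\Omega_i\setminus\Gamma$, $a_i(\mathcal H_ig,v)=0$ for $v\in W_i^0$), and define $S_i:V_\Gamma\to V_\Gamma$ by $\langle S_ig,h\rangle=a_i(\mathcal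 H_ig,t)$ for every $t\in W_i$ with $t|_\Gamma=h$. For weights $\delta_1,\delta_2\ge0$, $\delta_1+\delta_2=1$, put $D_i=\delta_iI$ and $$P_{NN}=(D_1S_1^{-1}D_1+D_2S_2^{-1}D_2)(S_1+S_2),\qquad P_{DD}=(D_1S_1D_1+D_2S_2D_2)(S_1^{-1}+S_2^{-1}).$$ The *convergence rate* of an iteration is the spectral radius of its error operator, and the *condition number* of an operator with positive real spectrum is its largest divided by its smallest eigenvalue. *Norm-equivalence constants* are numbers $0<c_i\le C_i$ with $$c_i|\mathcal H_iv|_{1,\Omega_i}^2\le\|v\|^2_{H^{1/2}_{00}(\Gamma)}\le C_i|\mathcal H_iv|_{1,\Omega_i}^2\quad\text{for all }v\in V_\Gamma,\ i=1,2,$$ where $\|v\|^2_{H_{00}^{1/2}(\Gamma)}=\|v\|_{L^2(\Gamma)}^2+\int_\Gamma\int_\Gamma\frac{|v(x)-v(y)|^2}{|x-y|^2}\,ds_y\,ds_x+\int_\Gamma\frac{v(x)^2}{\operatorname{dist}(x,\Gamma\cap\partial\Omega)}\,ds_x$, the last term being absent if $\Gamma\cap\partial\Omega=\emptyset$. **Theorem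 (N-N and D-D, nonsymmetric two subdomains).** 0. $\mathcal H_i$ and $S_i$ are well defined, and $S_i$ is symmetric positive definite, hence invertible. For relaxation parameter $\theta$ the error operators of the Neumann-Neumann and Dirichlet-Dirichlet iterations with weights $\delta_1,\delta_2$ are $I-\theta P_{NN}$ and $I-\theta P_{DD}$; those of the two Dirichlet-Neumann iterations, with the Neumann problem in $\Omega_2$ or in $\Omega_1$, are $I-\theta S_2^{-1}(S_1+S_2)$ and $I-\theta S_1^{-1}(S_1+S_2)$. Norm-equivalence constants exist, and they do not involve $\nu_1,\nu_2$. Let $c_i,C_i$ be any norm-equivalence constants, and put $$M=\frac{\max\{C_1/c_2,\,C_2/c_1\}+1}{\min\{c_2/C_1,\,c_1/C_2\}+1},\qquad M'=\frac{C_1C_2}{c_1c_2}.$$ 1. For all $\nu_1,\nu_2>0$ and all weights, the spectrum of $P_{NN}$ is real and contained in $[\lambda_{\min},\lambda_{\max}]$ with $$\lambda_{\min}=\delta_1^2\Bigl(1+\tfrac{c_1}{C_2}\tfrac{\nu_2}{\nu_1}\Bigr)+\delta_2^2\Bigl(1+\tfrac{c_2}{C_1}\tfrac{\nu_1}{\nu_2}\Bigr)>0,\qquad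 \lambda_{\max}=\delta_1^2\Bigl(1+\tfrac{C_1}{c_2}\tfrac{\nu_2}{\nu_1}\Bigr)+\delta_2^2\Bigl(1+\tfrac{C_2}{c_1}\tfrac{\nu_1}{\nu_2}\Bigr).$$ Its condition number is at most $\kappa_{NN}=\lambda_{\max}/\lambda_{\min}$, and for $\theta=2/(\lambda_{\min}+\lambda_{\max})$ the N-N rate is at most $(\kappa_{NN}-1)/(\kappa_{NN}+1)$. The same holds for D-D, with $\delta_1$ and $\delta_2$ interchanged in the two formulas, which gives $\kappa_{DD}$. 2. For $\delta_i=\sqrt{\nu_i}/(\sqrt{\nu_1}+\sqrt{\nu_2})$ and all $\nu_1,\nu_2>0$, both $\kappa_{NN}$ and the condition number of $P_{NN}$ are at most $M$, and both $\kappa_{DD}$ and the condition number of $P_{DD}$ are at most $M'$; for D-D with these two weights interchanged the bound is $M$. Hence, for suitable $\theta>0$, the convergence rates are at most $(M-1)/(M+1)$ and $(M'-1)/(M'+1)$ respectively, and $(M-1)/(M+1)$ for D-D with interchanged weights; these bounds do not depend on $\nu_1,\nu_2$. 3. For fixed $\nu_1,\nu_2$, each of $\kappa_{NN},\kappa_{DD}$,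 as a function of $\delta_1\in[0,1]$ (with $\delta_2=1-\delta_1$), is either constant or strictly monotone. So its minimum is attained at $\delta_1\in\{0,1\}$, and only there unless it is constant. 4. Benefit from high contrast requires weights tending to $0$ or $1$: - For every $q<M'$ and $\eta>0$ there is $\rho$ such that, whenever $\max\{\nu_2/\nu_1,\nu_1/\nu_2\}\ge\rho$ and $\kappa_{NN}\le q$ or $\kappa_{DD}\le q$, then $\min\{\delta_1,\delta_2\}<\eta$. - The condition number $k$ of $S_1^{-1}S_2$ does not depend on $\nu_1,\nu_2$. For every $q\ge0$ with $q<\frac{k-1}{k+1}$ and every $\eta>0$ there is $\rho$ such that, whenever $\max\{\nu_2/\nu_1,\nu_1/\nu_2\}\ge\rho$ and for some $\theta\in\mathbb R$ the N-N rate or the D-D rate is at most $q$, then $\min\{\delta_1,\delta_2\}<\eta$. 5. At degenerate weights the methods are Dirichlet-Neumann. For $(\delta_1,\delta_2)=(0,1)$ and $(1,0)$ the N-N error operator equals $I-\theta S_2^{-1}(S_1+S_2)$ and $I-\theta S_1^{-1}(S_1+S_2)$ respectively. The D-D error operator equals $S_1\bigl(I-\theta S_1^{-1}(S_1+S_2)\bigr)S_1^{-1}$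 and $S_2\bigl(I-\theta S_2^{-1}(S_1+S_2)\bigr)S_2^{-1}$ respectively. -/

import Mathlib

open Set MeasureTheory
open scoped ENNReal

noncomputable section

namespace TwoDomain

/-- The Euclidean plane. -/
abbrev Plane : Type := EuclideanSpace ℝ (Fin 2)

/-! ### Geometry -/

/-- A planar domain `Ω` with two nonoverlapping subdomains `sub 0`, `sub 1` (the sets `Ω₁`, `Ω₂`).
All three are domains equal to the interior of their closure (in particular open), and each
subdomain has a boundary point off the interface, so that no subdomain floats.
Boundedness and polygonality follow from the existence of a finite triangulation, see below. -/
structure Decomposition where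
  Ω : Set Plane
  sub : Fin 2 → Set Plane
  connected : IsConnected Ω
  regular : interior (closure Ω) = Ω
  sub_connected : ∀ i, IsConnected (sub i)
  sub_regular : ∀ i, interior (closure (sub i)) = sub i
  disjoint : Disjoint (sub 0) (sub 1)
  cover : closure (sub 0) ∪ closure (sub 1) = closure Ω
  outer : ∀ i, (frontier (sub i) \ (frontier (sub 0) ∩ frontier (sub 1))).Nonempty

/-- The interface `Γ = ∂Ω₁ ∩ ∂Ω₂`. -/
def Decomposition.Γ (D : Decomposition) : Set Plane := frontier (D.sub 0) ∩ frontier (D.sub 1)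

/-- A conforming finite triangulation of `Ω` into closed nondegenerate triangles, none of which is
cut by the interface. -/
structure Triangulation (D : Decomposition) where
  K : Geometry.SimplicialComplex ℝ Plane
  finite : K.faces.Finite
  pure : ∀ s ∈ K.faces, ∃ t ∈ K.faces, s ⊆ t ∧ t.card = 3
  space_eq : K.space = closure D.Ω
  not_cut : ∀ t ∈ K.faces, ∃ i, convexHull ℝ (t : Set Plane) ⊆ closure (D.sub i)

/-! ### Finite element spaces

Functions on a subset of the plane are represented by their extension by zero. -/

/-- Restriction of a function to `A` (then extended by zero). -/
def restr (A : Set Plane) : (Plane → ℝ) →ₗ[ℝ] (Plane → ℝ) where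
  toFun v := A.indicator v
  map_add' u v := Set.indicator_add A u v
  map_smul' r v := Set.indicator_const_smul A r v

namespace Triangulation

variable {D : Decomposition} (M : Triangulation D)

/-- The conforming P1 space `W ⊂ H¹₀(Ω)`: continuous functions, affine on each simplex, vanishing
on `∂Ω` (and extended by zero outside `Ω`). -/
def W : Submodule ℝ (Plane → ℝ) where
  carrier := {v | Continuous v ∧ (∀ x ∉ D.Ω, v x = 0) ∧
    ∀ t ∈ M.K.faces, ∃ A : Plane →ᵃ[ℝ] ℝ, EqOn v A (convexHull ℝ (t : Set Plane))}
  zero_mem' := ⟨continuous_zero, fun _ _ => rfl, fun _ _ => ⟨0, fun _ _ => rfl⟩⟩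
  add_mem' := by
    rintro u v ⟨hu, hu0, huA⟩ ⟨hv, hv0, hvA⟩
    refine ⟨hu.add hv, fun x hx => by simp [hu0 x hx, hv0 x hx], fun t ht => ?_⟩
    obtain ⟨A, hA⟩ := huA t ht
    obtain ⟨B, hB⟩ := hvA t ht
    exact ⟨A + B, fun x hx => by simp [hA hx, hB hx]⟩
  smul_mem' := by
    rintro r u ⟨hu, hu0, huA⟩
    refine ⟨hu.const_smul r, fun x hx => by simp [hu0 x hx], fun t ht => ?_⟩
    obtain ⟨A, hA⟩ := huA t ht
    exact ⟨r • A, fun x hx => by simp [hA hx]⟩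

/-- `Wᵢ`: the restrictions of `W` to the closure of `Ωᵢ`. -/
def WSub (i : Fin 2) : Submodule ℝ (Plane → ℝ) := M.W.map (restr (closure (D.sub i)))

/-- `Wᵢ⁰`: the members of `W` supported in `Ωᵢ`. -/
def WZero (i : Fin 2) : Submodule ℝ (Plane → ℝ) where
  carrier := {v | v ∈ M.W ∧ ∀ x ∉ D.sub i, v x = 0}
  zero_mem' := ⟨M.W.zero_mem, fun _ _ => rfl⟩
  add_mem' := by
    rintro u v ⟨hu, hu0⟩ ⟨hv, hv0⟩
    exact ⟨M.W.add_mem hu hv, fun x hx => by simp [hu0 x hx, hv0 x hx]⟩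
  smul_mem' := by
    rintro r u ⟨hu, hu0⟩
    exact ⟨M.W.smul_mem r hu, fun x hx => by simp [hu0 x hx]⟩

/-- `V_Γ = W|_Γ`. -/
def V : Submodule ℝ (Plane → ℝ) := M.W.map (restr D.Γ)

/-- The trace `W → V_Γ`. -/
def trace (u : M.W) : M.V := ⟨restr D.Γ u.1, Submodule.mem_map_of_mem u.2⟩

end Triangulation

/-! ### Bilinear forms and norms -/

/-- `aᵢ(u,v) = ∫_{Ωᵢ} νᵢ ∇u·∇v`. -/
def form (D : Decomposition) (ν : Fin 2 → ℝ) (i : Fin 2) (u v : Plane → ℝ) : ℝ :=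
  ∫ x in D.sub i, ν i * inner ℝ (gradient u x) (gradient v x)

/-- `(f,v)ᵢ = ∫_{Ωᵢ} f v`. -/
def load (D : Decomposition) (f : Plane → ℝ) (i : Fin 2) (v : Plane → ℝ) : ℝ :=
  ∫ x in D.sub i, f x * v x

/-- `⟨u,v⟩ = ∫_Γ u v`, with respect to arc length. -/
def pairing (D : Decomposition) (u v : Plane → ℝ) : ℝ :=
  ∫ x in D.Γ, u x * v x ∂(Measure.hausdorffMeasure 1)

/-- `|u|²_{1,Ωᵢ}`. -/
def seminormSq (D : Decomposition) (i : Fin 2) (u : Plane → ℝ) : ℝ :=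
  ∫ x in D.sub i, ‖gradient u x‖ ^ 2

/-- `‖v‖²_{H₀₀^{1/2}(Γ)}`: the squared `L²(Γ)` norm, plus the Gagliardo seminorm of order `1/2`,
plus the integral of `v²` against the inverse distance to the end points `∂Γ = Γ ∩ ∂Ω`.
(If `Γ` has no end points, then `Metric.infDist x ∅ = 0`, the last term is `0`, and the norm is
that of `H^{1/2}(Γ)`.) -/
def hHalfSq (D : Decomposition) (v : Plane → ℝ) : ℝ :=
  (∫ x in D.Γ, v x ^ 2 ∂(Measure.hausdorffMeasure 1)) +
  (∫ x in D.Γ, ∫ y in D.Γ, (v x - v y) ^ 2 / dist x y ^ 2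
    ∂(Measure.hausdorffMeasure 1) ∂(Measure.hausdorffMeasure 1)) +
  ∫ x in D.Γ, v x ^ 2 / Metric.infDist x (D.Γ ∩ frontier D.Ω) ∂(Measure.hausdorffMeasure 1)

namespace Triangulation

variable {D : Decomposition} (M : Triangulation D)

/-! ### Local solves, harmonic extensions, Schur complements -/

/-- `u ∈ Wᵢ` solves `aᵢ(u,v) = (f,v)ᵢ` for all `v ∈ Wᵢ⁰`, with `u = 0` on `∂Ωᵢ \ Γ` and `u = g`
on `Γ`. -/
def SolvesDirichlet (ν : Fin 2 → ℝ) (f : Plane → ℝ) (i : Fin 2) (g u : Plane → ℝ) : Prop :=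
  u ∈ M.WSub i ∧ (∀ v ∈ M.WZero i, form D ν i u v = load D f i v) ∧
    (∀ x ∈ frontier (D.sub i) \ D.Γ, u x = 0) ∧ EqOn u g D.Γ

/-- `u ∈ W` is the finite element solution of the global problem. -/
def SolvesGlobal (ν : Fin 2 → ℝ) (f : Plane → ℝ) (u : M.W) : Prop :=
  ∀ v ∈ M.W, form D ν 0 u.1 v + form D ν 1 u.1 v = load D f 0 v + load D f 1 v

/-- `H` is the discrete harmonic extension into `Ωᵢ`. The constant coefficient `νᵢ` plays no role
because the source is zero, so it is taken to be `1`. -/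
def IsHarmonicExt (i : Fin 2) (H : M.V →ₗ[ℝ] M.WSub i) : Prop :=
  ∀ g : M.V, M.SolvesDirichlet 1 0 i g.1 (H g).1

/-- The discrete harmonic extension `𝓗ᵢ : V_Γ → Wᵢ`. -/
def harmonicExt (i : Fin 2) : M.V →ₗ[ℝ] M.WSub i := Classical.epsilon (M.IsHarmonicExt i)

/-- `⟨S g, h⟩ = aᵢ(𝓗ᵢ g, t)` for every extension `t ∈ Wᵢ` of `h`. -/
def IsSchur (ν : Fin 2 → ℝ) (i : Fin 2) (S : Module.End ℝ M.V) : Prop :=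
  ∀ g h : M.V, ∀ t ∈ M.WSub i, EqOn t h.1 D.Γ →
    pairing D (S g).1 h.1 = form D ν i (M.harmonicExt i g).1 t

/-- The operator `Sᵢ : V_Γ → V_Γ`. -/
def S (ν : Fin 2 → ℝ) (i : Fin 2) : Module.End ℝ M.V := Classical.epsilon (M.IsSchur ν i)

/-- `Sᵢ⁻¹`. -/
def SInv (ν : Fin 2 → ℝ) (i : Fin 2) : Module.End ℝ M.V := Ring.inverse (M.S ν i)

/-- `c`, `C` are constants in the norm equivalence
`cᵢ |𝓗ᵢ v|²_{1,Ωᵢ} ≤ ‖v‖²_{H₀₀^{1/2}(Γ)} ≤ Cᵢ |𝓗ᵢ v|²_{1,Ωᵢ}` on `V_Γ`. -/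
def NormEquiv (c C : Fin 2 → ℝ) : Prop :=
  ∀ i, 0 < c i ∧ c i ≤ C i ∧ ∀ v : M.V,
    c i * seminormSq D i (M.harmonicExt i v).1 ≤ hHalfSq D v.1 ∧
    hHalfSq D v.1 ≤ C i * seminormSq D i (M.harmonicExt i v).1

/-! ### The iterations -/

/-- One step `g ↦ g'` of the Dirichlet-Neumann iteration, with the Dirichlet problem in subdomain
`d` and the Neumann problem in subdomain `n`. -/
def DNStep (ν : Fin 2 → ℝ) (f : Plane → ℝ) (θ : ℝ) (d n : Fin 2) (g g' : M.V) : Prop :=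
  ∃ ud un : Plane → ℝ, M.SolvesDirichlet ν f d g.1 ud ∧
    (un ∈ M.WSub n ∧ ∀ v ∈ M.WSub n, ∀ t ∈ M.WSub d, EqOn t v D.Γ →
      form D ν n un v = load D f n v + load D f d t - form D ν d ud t) ∧
    ∀ x ∈ D.Γ, g'.1 x = θ * un x + (1 - θ) * g.1 x

/-- One step `g ↦ g'` of the Neumann-Neumann iteration with weights `δ`. -/
def NNStep (ν : Fin 2 → ℝ) (f : Plane → ℝ) (δ : Fin 2 → ℝ) (θ : ℝ) (g g' : M.V) : Prop :=
  ∃ u w : Fin 2 → Plane → ℝ, (∀ i, M.SolvesDirichlet ν f i g.1 (u i)) ∧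
    (∀ i, w i ∈ M.WSub i ∧ ∀ v ∈ M.WSub i,
      ∀ t : Fin 2 → Plane → ℝ, (∀ j, t j ∈ M.WSub j ∧ EqOn (t j) v D.Γ) →
        form D ν i (w i) v = δ i * ∑ j, (form D ν j (u j) (t j) - load D f j (t j))) ∧
    ∀ x ∈ D.Γ, g'.1 x = g.1 x - θ * (δ 0 * w 0 x + δ 1 * w 1 x)

/-- One step `l ↦ l'` of the Dirichlet-Dirichlet iteration with weights `δ`. The function `q i` is
the discrete conormal derivative `νᵢ ∂wᵢ/∂nᵢ` on `Γ`. -/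
def DDStep (ν : Fin 2 → ℝ) (f : Plane → ℝ) (δ : Fin 2 → ℝ) (θ : ℝ) (l l' : M.V) : Prop :=
  ∃ u w : Fin 2 → Plane → ℝ, ∃ q : Fin 2 → M.V,
    (u 0 ∈ M.WSub 0 ∧ ∀ v ∈ M.WSub 0, form D ν 0 (u 0) v = load D f 0 v + pairing D l.1 v) ∧
    (u 1 ∈ M.WSub 1 ∧ ∀ v ∈ M.WSub 1, form D ν 1 (u 1) v = load D f 1 v + pairing D (-l).1 v) ∧
    (∀ i, M.SolvesDirichlet ν 0 i (fun x => δ i * (u 0 x - u 1 x)) (w i)) ∧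
    (∀ i, ∀ v ∈ M.WSub i, pairing D (q i).1 v = form D ν i (w i) v) ∧
    l' = l - θ • (δ 0 • q 0 + δ 1 • q 1)

/-! ### Error operators -/

/-- Multiplication by the weight, `Dᵢ = δᵢ I`. -/
def scaling (δ : Fin 2 → ℝ) (i : Fin 2) : Module.End ℝ M.V := δ i • 1

/-- `(D₁S₁⁻¹D₁ + D₂S₂⁻¹D₂)(S₁ + S₂)`. -/
def nnOperator (ν δ : Fin 2 → ℝ) : Module.End ℝ M.V :=
  (M.scaling δ 0 * M.SInv ν 0 * M.scaling δ 0 + M.scaling δ 1 * M.SInv ν 1 * M.scaling δ 1) *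
    (M.S ν 0 + M.S ν 1)

/-- `(D₁S₁D₁ + D₂S₂D₂)(S₁⁻¹ + S₂⁻¹)`. -/
def ddOperator (ν δ : Fin 2 → ℝ) : Module.End ℝ M.V :=
  (M.scaling δ 0 * M.S ν 0 * M.scaling δ 0 + M.scaling δ 1 * M.S ν 1 * M.scaling δ 1) *
    (M.SInv ν 0 + M.SInv ν 1)

/-- The N-N error operator. -/
def nnError (ν δ : Fin 2 → ℝ) (θ : ℝ) : Module.End ℝ M.V := 1 - θ • M.nnOperator ν δ

/-- The D-D error operator. -/
def ddError (ν δ : Fin 2 → ℝ) (θ : ℝ) : Module.End ℝ M.V := 1 - θ • M.ddOperator ν δ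

/-- The D-N error operator `I - θ Sₙ⁻¹(S₁ + S₂)`, with the Neumann problem in subdomain `n`. -/
def dnError (ν : Fin 2 → ℝ) (n : Fin 2) (θ : ℝ) : Module.End ℝ M.V :=
  1 - θ • (M.SInv ν n * (M.S ν 0 + M.S ν 1))

end Triangulation

/-! ### Spectra -/

section Spectra

variable {E : Type*} [AddCommGroup E] [Module ℝ E]

/-- The complex spectrum of a real operator. -/
def complexSpectrum (T : Module.End ℝ E) : Set ℂ := spectrum ℂ (LinearMap.baseChange ℂ T)

/-- The convergence rate of an iteration with error operator `R`: its spectral radius. -/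
def convergenceRate (R : Module.End ℝ E) : ℝ≥0∞ := spectralRadius ℂ (LinearMap.baseChange ℂ R)

/-- The condition number: largest eigenvalue divided by smallest eigenvalue (for operators with
positive real spectrum). -/
def condNumber (T : Module.End ℝ E) : ℝ := sSup (spectrum ℝ T) / sInf (spectrum ℝ T)

end Spectra

/-! ### Weights and explicit bounds -/

/-- Nonnegative weights with sum one (the values `0`, `1` are the degenerate cases). -/
def IsWeight (δ : Fin 2 → ℝ) : Prop := (∀ i, 0 ≤ δ i) ∧ δ 0 + δ 1 = 1

/-- The weights `δᵢ = √νᵢ / (√ν₁ + √ν₂)`. -/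
def sqrtWeight (ν : Fin 2 → ℝ) (i : Fin 2) : ℝ := √(ν i) / (√(ν 0) + √(ν 1))

/-- `λ_min` for N-N. -/
def nnMin (c C ν δ : Fin 2 → ℝ) : ℝ :=
  δ 0 ^ 2 * (1 + c 0 / C 1 * (ν 1 / ν 0)) + δ 1 ^ 2 * (1 + c 1 / C 0 * (ν 0 / ν 1))

/-- `λ_max` for N-N. -/
def nnMax (c C ν δ : Fin 2 → ℝ) : ℝ :=
  δ 0 ^ 2 * (1 + C 0 / c 1 * (ν 1 / ν 0)) + δ 1 ^ 2 * (1 + C 1 / c 0 * (ν 0 / ν 1))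

/-- `λ_min` for D-D. -/
def ddMin (c C ν δ : Fin 2 → ℝ) : ℝ :=
  δ 0 ^ 2 * (1 + c 1 / C 0 * (ν 0 / ν 1)) + δ 1 ^ 2 * (1 + c 0 / C 1 * (ν 1 / ν 0))

/-- `λ_max` for D-D. -/
def ddMax (c C ν δ : Fin 2 → ℝ) : ℝ :=
  δ 0 ^ 2 * (1 + C 1 / c 0 * (ν 0 / ν 1)) + δ 1 ^ 2 * (1 + C 0 / c 1 * (ν 1 / ν 0))

/-- `κ = λ_max / λ_min` for N-N. -/
def nnKappa (c C ν δ : Fin 2 → ℝ) : ℝ := nnMax c C ν δ / nnMin c C ν δ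

/-- `κ = λ_max / λ_min` for D-D. -/
def ddKappa (c C ν δ : Fin 2 → ℝ) : ℝ := ddMax c C ν δ / ddMin c C ν δ

/-- The coefficient-free bound `(max{C₁/c₂, C₂/c₁} + 1) / (min{c₂/C₁, c₁/C₂} + 1)`. -/
def kappaBound (c C : Fin 2 → ℝ) : ℝ :=
  (max (C 0 / c 1) (C 1 / c 0) + 1) / (min (c 1 / C 0) (c 0 / C 1) + 1)

/-- The spectrum of `P` lies in `[lo, hi]` with `0 < lo`, hence `P` has condition number at most
`hi / lo = κ`; with `θ = 2 / (lo + hi)` the iteration with error operator `I - θ P` has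
convergence rate at most `(κ - 1) / (κ + 1)`. -/
def GovernedBy {E : Type*} [AddCommGroup E] [Module ℝ E] (P : Module.End ℝ E) (lo hi : ℝ) : Prop :=
  0 < lo ∧ complexSpectrum P ⊆ (fun r : ℝ => (r : ℂ)) '' Icc lo hi ∧
    condNumber P ≤ hi / lo ∧
    convergenceRate (1 - (2 / (lo + hi)) • P) ≤ ENNReal.ofReal ((hi / lo - 1) / (hi / lo + 1))

/-- On `[0,1]` the function `k` is constant or strictly monotone. So its minimum is attained at an
end point, and only there unless `k` is constant. -/
def ConstOrStrict (k : ℝ → ℝ) : Prop :=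
  (∀ t ∈ Icc (0 : ℝ) 1, k t = k 0) ∨ StrictMonoOn k (Icc 0 1) ∨ StrictAntiOn k (Icc 0 1)

/-- In the limit of high contrast (in either direction), the property `good ν δ` forces the weights
to tend to `0` or `1`: for every `η > 0` there is a contrast beyond which one of the weights is
below `η`. -/
def ForcesDegenerate (good : (Fin 2 → ℝ) → (Fin 2 → ℝ) → Prop) : Prop :=
  ∀ η : ℝ, 0 < η → ∃ ρ : ℝ, ∀ ν : Fin 2 → ℝ, (∀ i, 0 < ν i) →
    (ρ ≤ ν 1 / ν 0 ∨ ρ ≤ ν 0 / ν 1) → ∀ δ : Fin 2 → ℝ, IsWeight δ → good ν δ → ∃ i, δ i < η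

end TwoDomain

end

open TwoDomain

/-! Everything reduces to one pair of quadratic forms on the finite-dimensional space `M.V`.
(Subscripts 1, 2 here are the indices 0, 1 below.) The energies of discrete harmonic extensions,
`M.schurForm 0` and `M.schurForm 1`, are positive definite and free of the coefficients; Sᵢ
represents νᵢ times such a form in the interface pairing. Diagonalizing the second form relative to
the first (`exists_schur_eigenbasis`) gives a single basis for all coefficients, with eigenvalues μ
> 0, on which S₁⁻¹S₂ acts as τ = (ν₂/ν₁)μ. There P_NN is diagonal with entries δ₁²(1 + τ) + δ₂²(1 +
1/τ). On the image of the basis under S₁, P_DD is diagonal with the same entries and the weights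
interchanged, so each D-D estimate is an N-N estimate for reversed weights.

Norm equivalence confines μ to [c₁/C₂, C₁/c₂]; bounding τ and 1/τ separately gives λ_min and λ_max.
If δᵢ² is proportional to νᵢ the contrast cancels and the bound M remains; for arbitrary weights a
termwise comparison gives M'. As a function of (δ₁/δ₂)², κ is a Möbius function, hence constant or
strictly monotone. If the contrast grows while both weights stay above η, one summand dominates, so
κ approaches M' and the ratio of extreme eigenvalues approaches k (`exists_contrast`). A rate at
most q < 1, for any θ, limits that ratio to (1 + q)/(1 - q) (`quotient_le_of_rate`).

The remaining work connects functions with this algebra. The energy is definite because no subdomain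
floats, and the pairing because Γ has positive length near each of its points in Ω. Since no
triangle is cut, functions on the two sides with equal traces glue to a member of `M.W`; this yields
the interface flux of the discrete solution (`exists_isReference`), and subtracting that solution
turns every iteration step into its error operator. Norm-equivalence constants exist by finite
dimensionality, once P1 functions are known to be Lipschitz and so to have a finite interface norm.
-/

namespace TwoDomain

/-! ### Definite bilinear forms on finite-dimensional spaces -/

section LinearAlgebra

variable {E F : Type*} [AddCommGroup E] [Module ℝ E] [FiniteDimensional ℝ E]
  [AddCommGroup F] [Module ℝ F]

/-- A definite bilinear form on a finite-dimensional space represents every functional, uniquely. -/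
theorem bijective_of_definite (B : E →ₗ[ℝ] E →ₗ[ℝ] ℝ) (hB : ∀ x, B x x = 0 → x = 0) :
    Function.Bijective B := by
  have hinj : Function.Injective B := by
    rw [injective_iff_map_eq_zero]
    exact fun x hx => hB x (by rw [hx]; rfl)
  exact ⟨hinj, (LinearMap.injective_iff_surjective_of_finrank_eq_finrank
    Subspace.dual_finrank_eq.symm).1 hinj⟩

/-- The vector that represents `A x` through `B` depends linearly on `x`. This serves for the Schur
complements, with `B` the interface pairing, and for diagonalizing one form relative to another. -/
theorem existsUnique_operator (B : E →ₗ[ℝ] E →ₗ[ℝ] ℝ) (hB : ∀ x, B x x = 0 → x = 0)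
    (A : E →ₗ[ℝ] E →ₗ[ℝ] ℝ) : ∃! T : Module.End ℝ E, ∀ x y, B (T x) y = A x y := by
  let e := LinearEquiv.ofBijective B (bijective_of_definite B hB)
  refine ⟨e.symm.toLinearMap ∘ₗ A, fun x y => ?_, fun T hT => ?_⟩
  · exact LinearMap.congr_fun (e.apply_symm_apply (A x)) y
  · refine LinearMap.ext fun x => ?_
    apply e.injective
    refine LinearMap.ext fun y => ?_
    have h := LinearMap.congr_fun (e.apply_symm_apply (A x)) y
    exact (hT x y).trans h.symm

/-- The energy-orthogonal right inverse of a surjective trace. -/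
theorem existsUnique_orthogonal_rightInverse (B : E →ₗ[ℝ] E →ₗ[ℝ] ℝ)
    (hB : ∀ x, B x x = 0 → x = 0) (τ : E →ₗ[ℝ] F) (hτ : Function.Surjective τ) :
    ∃! H : F →ₗ[ℝ] E, ∀ g, τ (H g) = g ∧ ∀ z, τ z = 0 → B (H g) z = 0 := by
  obtain ⟨R, hR⟩ := τ.exists_rightInverse_of_surjective (LinearMap.range_eq_top.2 hτ)
  let Z := LinearMap.ker τ
  let BZ : Z →ₗ[ℝ] Z →ₗ[ℝ] ℝ := B.compl₁₂ Z.subtype Z.subtype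
  have hBZ : ∀ z, BZ z z = 0 → z = 0 := fun z hz => Subtype.ext (hB z.1 hz)
  let e := LinearEquiv.ofBijective BZ (bijective_of_definite BZ hBZ)
  -- For symmetric `B` this is the orthogonal projection onto the kernel of `τ`. Subtracting it from
  -- an arbitrary right inverse keeps the trace and makes the result orthogonal to the kernel.
  let P : E →ₗ[ℝ] Z := e.symm.toLinearMap ∘ₗ B.compl₂ Z.subtype
  have hP : ∀ x, ∀ z : Z, B (P x).1 z.1 = B x z.1 := fun x z =>
    LinearMap.congr_fun (e.apply_symm_apply (B.compl₂ Z.subtype x)) z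
  have key : ∀ g, τ ((R - Z.subtype ∘ₗ P ∘ₗ R) g) = g ∧
      ∀ z, τ z = 0 → B ((R - Z.subtype ∘ₗ P ∘ₗ R) g) z = 0 := fun g => by
    refine ⟨?_, fun z hz => ?_⟩
    · have h1 : τ (R g) = g := LinearMap.congr_fun hR g
      have h2 : τ (P (R g)).1 = 0 := (P (R g)).2
      simp [h1, h2]
    · have := hP (R g) ⟨z, hz⟩
      simp only [LinearMap.sub_apply, LinearMap.comp_apply, Submodule.subtype_apply, map_sub]
      rw [this, sub_self]
  refine ⟨_, key, fun H' hH' => ?_⟩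
  refine LinearMap.ext fun g => ?_
  -- The difference of two candidates lies in the kernel of `τ` and is orthogonal to that kernel, in
  -- particular to itself.
  rw [← sub_eq_zero]
  apply hB
  have hτ0 : τ (H' g - (R - Z.subtype ∘ₗ P ∘ₗ R) g) = 0 := by
    rw [map_sub, (hH' g).1, (key g).1, sub_self]
  have h1 := (hH' g).2 _ hτ0
  have h2 := (key g).2 _ hτ0
  simp only [LinearMap.sub_apply] at h1 h2 ⊢
  rw [map_sub B, LinearMap.sub_apply, h1, h2, sub_self]

/-- Simultaneous diagonalization of two symmetric forms, the first positive definite. -/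
theorem exists_simultaneous_eigenbasis (A B : E →ₗ[ℝ] E →ₗ[ℝ] ℝ)
    (hA : ∀ x y, A x y = A y x) (hpos : ∀ x, x ≠ 0 → 0 < A x x) (hB : ∀ x y, B x y = B y x) :
    ∃ (b : Module.Basis (Fin (Module.finrank ℝ E)) ℝ E) (μ : Fin (Module.finrank ℝ E) → ℝ),
      ∀ i y, B (b i) y = μ i * A (b i) y := by
  have hdef : ∀ x, A x x = 0 → x = 0 := fun x hx => by
    by_contra h
    exact (hpos x h).ne' hx
  obtain ⟨T, hT, -⟩ := existsUnique_operator A hdef B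
  -- With `A` as inner product, the operator `T` representing `B` is self-adjoint, and the spectral
  -- theorem provides the basis.
  let core : InnerProductSpace.Core ℝ E :=
    { inner := fun x y => A x y
      conj_inner_symm := fun x y => by simp [hA y x]
      re_inner_nonneg := fun x => by
        by_cases h : x = 0
        · simp [h]
        · exact (hpos x h).le
      add_left := fun x y z => by simp
      smul_left := fun x y r => by simp
      definite := fun x hx => hdef x hx }
  let : NormedAddCommGroup E := core.toNormedAddCommGroup
  let : InnerProductSpace ℝ E := InnerProductSpace.ofCore core.toCore
  have hsymm : LinearMap.IsSymmetric T := fun x y => by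
    change A (T x) y = A x (T y)
    rw [hT, hA x, hT, hB]
  refine ⟨(hsymm.eigenvectorBasis rfl).toBasis, hsymm.eigenvalues rfl, fun i y => ?_⟩
  have h := hsymm.apply_eigenvectorBasis rfl i
  rw [← hT]
  simp only [OrthonormalBasis.coe_toBasis]
  rw [h]
  simp

end LinearAlgebra

/-! ### Spectrum, condition number and rate read off from an eigenbasis -/

section Eigenbasis

variable {E : Type*} [AddCommGroup E] [Module ℝ E] {n : ℕ} (b : Module.Basis (Fin n) ℝ E)
  {P : Module.End ℝ E} {d : Fin n → ℝ}

theorem toMatrix_of_eigenbasis (h : ∀ i, P (b i) = d i • b i) :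
    LinearMap.toMatrix b b P = Matrix.diagonal d := by
  ext i j
  rw [LinearMap.toMatrix_apply, h]
  by_cases hij : i = j
  · subst hij; simp
  · simp [hij, Matrix.diagonal_apply_ne]

theorem spectrum_of_eigenbasis (h : ∀ i, P (b i) = d i • b i) : spectrum ℝ P = range d := by
  rw [← LinearMap.spectrum_toMatrix P b, toMatrix_of_eigenbasis b h, spectrum_diagonal]

/-- In the extended basis the complexified operator has the same diagonal matrix, so no nonreal
eigenvalue can appear. -/
theorem complexSpectrum_of_eigenbasis (h : ∀ i, P (b i) = d i • b i) :
    complexSpectrum P = range (fun i => (d i : ℂ)) := by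
  rw [complexSpectrum, ← LinearMap.spectrum_toMatrix _ (Algebra.TensorProduct.basis ℂ b),
    LinearMap.toMatrix_baseChange, toMatrix_of_eigenbasis b h, Matrix.diagonal_map (map_zero _),
    spectrum_diagonal]
  rfl

/-- The spectral radius is the supremum of the `|d i|`; `0 ≤ q` prevents `ENNReal.ofReal` from
truncating. -/
theorem convergenceRate_le_iff (h : ∀ i, P (b i) = d i • b i) {q : ℝ} (hq : 0 ≤ q) :
    convergenceRate P ≤ ENNReal.ofReal q ↔ ∀ i, |d i| ≤ q := by
  have hs := complexSpectrum_of_eigenbasis b h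
  rw [complexSpectrum] at hs
  rw [convergenceRate, spectralRadius, hs]
  simp only [iSup_range, iSup_le_iff]
  refine forall_congr' fun i => ?_
  rw [ENNReal.ofReal, ENNReal.coe_le_coe, ← NNReal.coe_le_coe, coe_nnnorm,
    Real.coe_toNNReal _ hq, Complex.norm_real, Real.norm_eq_abs]

theorem one_sub_smul_eigenbasis (h : ∀ i, P (b i) = d i • b i) (θ : ℝ) (i : Fin n) :
    (1 - θ • P) (b i) = (1 - θ * d i) • b i := by
  simp [h, sub_smul, mul_smul]

/-- With `θ = 2 / (lo + hi)` the map x ↦ 1 - θx sends `[lo, hi]` onto the interval about 0 of radius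
`(hi - lo) / (lo + hi)`. On the zero space `lo ≤ hi` would not follow from `hd`. -/
theorem governedBy_of_eigenbasis (h : ∀ i, P (b i) = d i • b i) {lo hi : ℝ} (hlo : 0 < lo)
    (hle : lo ≤ hi) (hd : ∀ i, d i ∈ Icc lo hi) : GovernedBy P lo hi := by
  have hhi : 0 < hi := hlo.trans_le hle
  refine ⟨hlo, ?_, ?_, ?_⟩
  · rw [complexSpectrum_of_eigenbasis b h]
    rintro _ ⟨i, rfl⟩
    exact ⟨d i, hd i, rfl⟩
  · rw [condNumber, spectrum_of_eigenbasis b h]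
    -- On the zero space the spectrum is empty and the condition number is 0, because `sSup ∅ = 0`.
    rcases isEmpty_or_nonempty (Fin n) with hn | hn
    · simp only [range_eq_empty, Real.sSup_empty, zero_div]
      positivity
    · refine div_le_div₀ hhi.le (csSup_le (range_nonempty d) ?_) hlo
        (le_csInf (range_nonempty d) ?_)
      · rintro _ ⟨i, rfl⟩; exact (hd i).2
      · rintro _ ⟨i, rfl⟩; exact (hd i).1
  · have hk : (hi / lo - 1) / (hi / lo + 1) = (hi - lo) / (lo + hi) := by
      field_simp
      ring
    rw [hk, convergenceRate_le_iff b (one_sub_smul_eigenbasis b h _)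
      (div_nonneg (by linarith) (by linarith))]
    intro i
    have e : 1 - 2 / (lo + hi) * d i = (lo + hi - 2 * d i) / (lo + hi) := by
      field_simp
    rw [e, abs_div, abs_of_pos (by linarith : 0 < lo + hi)]
    refine div_le_div_of_nonneg_right (abs_le.2 ?_) (by linarith)
    constructor <;> linarith [(hd i).1, (hd i).2]

end Eigenbasis

open scoped Pointwise in
theorem condNumber_smul {E : Type*} [AddCommGroup E] [Module ℝ E] (T : Module.End ℝ E) {r : ℝ}
    (hr : 0 < r) : condNumber (r • T) = condNumber T := by
  have : spectrum ℝ (r • T) = r • spectrum ℝ T := by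
    have := spectrum.unit_smul_eq_smul T (Units.mk0 r hr.ne')
    exact this
  rw [condNumber, condNumber, this, Real.sSup_smul_of_nonneg hr.le, Real.sInf_smul_of_nonneg hr.le,
    smul_eq_mul, smul_eq_mul, mul_div_mul_left _ _ hr.ne']

open Topology

/-! ### Topology of the subdomains and the interface -/

namespace Decomposition

variable (D : Decomposition)

theorem isOpen_sub (i : Fin 2) : IsOpen (D.sub i) := D.sub_regular i ▸ isOpen_interior

theorem isOpen_Ω : IsOpen D.Ω := D.regular ▸ isOpen_interior

theorem closure_sub_subset (i : Fin 2) : closure (D.sub i) ⊆ closure D.Ω := by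
  rw [← D.cover]
  fin_cases i
  · exact subset_union_left
  · exact subset_union_right

theorem sub_subset (i : Fin 2) : D.sub i ⊆ D.Ω := by
  rw [← D.regular]
  exact interior_maximal (subset_closure.trans (D.closure_sub_subset i)) (D.isOpen_sub i)

theorem disjoint_sub {i j : Fin 2} (h : i ≠ j) : Disjoint (D.sub i) (D.sub j) := by
  fin_cases i <;> fin_cases j <;> first | exact absurd rfl h | exact D.disjoint |
    exact D.disjoint.symm

theorem notMem_sub_of_mem_closure {i j : Fin 2} (h : i ≠ j) {x : Plane}
    (hx : x ∈ closure (D.sub i)) : x ∉ D.sub j :=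
  disjoint_left.1 ((D.disjoint_sub h).closure_left (D.isOpen_sub j)) hx

theorem mem_Γ_of_mem_closure {i j : Fin 2} (h : i ≠ j) {x : Plane}
    (hi : x ∈ closure (D.sub i)) (hj : x ∈ closure (D.sub j)) : x ∈ D.Γ := by
  have fi : x ∈ frontier (D.sub i) := by
    rw [(D.isOpen_sub i).frontier_eq]
    exact ⟨hi, D.notMem_sub_of_mem_closure h.symm hj⟩
  have fj : x ∈ frontier (D.sub j) := by
    rw [(D.isOpen_sub j).frontier_eq]
    exact ⟨hj, D.notMem_sub_of_mem_closure h hi⟩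
  fin_cases i <;> fin_cases j <;> first | exact absurd rfl h | exact ⟨fi, fj⟩ | exact ⟨fj, fi⟩

theorem Γ_subset_frontier (i : Fin 2) : D.Γ ⊆ frontier (D.sub i) := by
  fin_cases i
  · exact inter_subset_left
  · exact inter_subset_right

theorem Γ_subset_closure (i : Fin 2) : D.Γ ⊆ closure (D.sub i) :=
  (D.Γ_subset_frontier i).trans frontier_subset_closure

theorem isClosed_Γ : IsClosed D.Γ := isClosed_frontier.inter isClosed_frontier

theorem mem_closure_sub {x : Plane} (hx : x ∈ closure D.Ω) : ∃ i, x ∈ closure (D.sub i) := by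
  rw [← D.cover] at hx
  exact hx.elim (fun h => ⟨0, h⟩) fun h => ⟨1, h⟩

/-- Off `Γ` the closure of the other subdomain stays away from `x`. If `x` were in `Ω`, a
neighbourhood of it would lie in `closure (D.sub i)`, so `x` would be in the interior of that
closure. This interior is `D.sub i`, which misses its own frontier. -/
theorem notMem_Ω_of_mem_frontier {i : Fin 2} {x : Plane}
    (hx : x ∈ frontier (D.sub i)) (hΓ : x ∉ D.Γ) : x ∉ D.Ω := by
  intro hΩ
  have hrev : ∀ j : Fin 2, j ≠ i → x ∉ closure (D.sub j) := fun j hj h =>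
    hΓ (D.mem_Γ_of_mem_closure hj h (frontier_subset_closure hx))
  obtain ⟨j, hj⟩ : ∃ j : Fin 2, j ≠ i := exists_ne i
  have hU : D.Ω ∩ (closure (D.sub j))ᶜ ⊆ closure (D.sub i) := by
    rintro y ⟨hy, hyj⟩
    obtain ⟨k, hk⟩ := D.mem_closure_sub (subset_closure hy)
    obtain rfl | hkj : k = i ∨ k = j := by omega
    · exact hk
    · exact absurd (hkj ▸ hk) hyj
  have hxi : x ∈ interior (closure (D.sub i)) :=
    interior_maximal hU (D.isOpen_Ω.inter isClosed_closure.isOpen_compl) ⟨hΩ, hrev j hj⟩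
  rw [D.sub_regular] at hxi
  rw [(D.isOpen_sub i).frontier_eq] at hx
  exact hx.2 hxi

theorem mem_sub_or_mem_Γ {x : Plane} (hx : x ∈ D.Ω) : (∃ i, x ∈ D.sub i) ∨ x ∈ D.Γ := by
  obtain ⟨i, hi⟩ := D.mem_closure_sub (subset_closure hx)
  by_cases h : x ∈ D.sub i
  · exact Or.inl ⟨i, h⟩
  · right
    by_contra hΓ
    refine D.notMem_Ω_of_mem_frontier (i := i) ?_ hΓ hx
    rw [(D.isOpen_sub i).frontier_eq]
    exact ⟨hi, h⟩

/-- Inside `Ω` a connected set meeting both subdomains meets the interface. -/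
theorem inter_Γ_nonempty {s : Set Plane} (hs : IsPreconnected s) (hsΩ : s ⊆ D.Ω)
    (h0 : (s ∩ D.sub 0).Nonempty) (h1 : (s ∩ D.sub 1).Nonempty) : (s ∩ D.Γ).Nonempty := by
  by_contra hne
  rw [not_nonempty_iff_eq_empty] at hne
  have hcov : s ⊆ D.sub 0 ∪ D.sub 1 := fun x hx => by
    rcases D.mem_sub_or_mem_Γ (hsΩ hx) with ⟨i, hi⟩ | hΓ
    · fin_cases i
      · exact Or.inl hi
      · exact Or.inr hi
    · exact absurd (show x ∈ s ∩ D.Γ from ⟨hx, hΓ⟩) (hne ▸ notMem_empty x)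
  obtain ⟨x, -, hx0, hx1⟩ := hs _ _ (D.isOpen_sub 0) (D.isOpen_sub 1) hcov h0 h1
  exact disjoint_left.1 D.disjoint hx0 hx1

theorem exists_unit_normal (e : Plane) (he : e ≠ 0) : ∃ n : Plane, ‖n‖ = 1 ∧ inner ℝ n e = 0 := by
  let n : Plane := !₂[-e 1, e 0]
  have hn : n ≠ 0 := fun h => he <| by
    have h0 : n 0 = 0 := by rw [h]; rfl
    have h1 : n 1 = 0 := by rw [h]; rfl
    ext i
    fin_cases i
    · simpa [n] using h1
    · simpa [n] using h0
  refine ⟨‖n‖⁻¹ • n, norm_smul_inv_norm hn, ?_⟩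
  rw [inner_smul_left]
  simp [n, PiLp.inner_apply, Fin.sum_univ_two]
  right
  ring

/-- The interface has positive length near each of its points inside `Ω`. -/
theorem measure_Γ_inter_pos {p : Plane} (hp : p ∈ D.Γ) (hΩ : p ∈ D.Ω) {U : Set Plane}
    (hU : U ∈ 𝓝 p) : 0 < Measure.hausdorffMeasure 1 (D.Γ ∩ U) := by
  obtain ⟨r, hr, hrU⟩ := Metric.mem_nhds_iff.1 (Filter.inter_mem hU (D.isOpen_Ω.mem_nhds hΩ))
  have hpick : ∀ i, ∃ a ε, 0 < ε ∧ Metric.ball a ε ⊆ D.sub i ∩ Metric.ball p r := fun i => by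
    obtain ⟨a, ha, ha'⟩ := mem_closure_iff.1 (D.Γ_subset_closure i hp) _ Metric.isOpen_ball
      (Metric.mem_ball_self hr)
    obtain ⟨ε, hε, h⟩ := Metric.isOpen_iff.1 ((D.isOpen_sub i).inter Metric.isOpen_ball) a ⟨ha', ha⟩
    exact ⟨a, ε, hε, h⟩
  obtain ⟨a, ε, hε, ha⟩ := hpick 0
  obtain ⟨b, ε', hε', hb⟩ := hpick 1
  have hab : b - a ≠ 0 := fun h => by
    rw [sub_eq_zero] at h
    exact disjoint_left.1 D.disjoint (ha (Metric.mem_ball_self hε)).1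
      (h ▸ (hb (Metric.mem_ball_self hε')).1)
  obtain ⟨n, hn1, hn⟩ := exists_unit_normal _ hab
  -- `f` is the coordinate orthogonal to `b - a`. It is constant on translates of the segment from
  -- `a` to `b`, and each small translate joins the two subdomains inside `Ω`, hence meets `Γ`. So
  -- the image of `D.Γ ∩ U` contains an interval, and a 1-Lipschitz map does not increase Hausdorff
  -- measure.
  let f : Plane → ℝ := fun x => inner ℝ n (x - a)
  have hf : LipschitzWith 1 f := LipschitzWith.of_dist_le_mul fun x y => by
    have : f x - f y = inner ℝ n (x - y) := by
      rw [← inner_sub_right]; congr 1; abel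
    rw [Real.dist_eq, this, dist_eq_norm]
    simpa [hn1] using abs_real_inner_le_norm n (x - y)
  have himg : Ioo 0 (min ε ε') ⊆ f '' (D.Γ ∩ U) := by
    rintro s ⟨hs0, hs⟩
    have hsn : ‖s • n‖ = s := by rw [norm_smul, hn1, mul_one, Real.norm_of_nonneg hs0.le]
    have hmem : ∀ c δ, s < δ → c + s • n ∈ Metric.ball c δ := fun c δ h => by
      rw [Metric.mem_ball, dist_eq_norm, add_sub_cancel_left, hsn]
      exact h
    have h0 := ha (hmem a ε (hs.trans_le (min_le_left _ _)))
    have h1 := hb (hmem b ε' (hs.trans_le (min_le_right _ _)))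
    have hseg : segment ℝ (a + s • n) (b + s • n) ⊆ Metric.ball p r :=
      (convex_ball p r).segment_subset h0.2 h1.2
    obtain ⟨x, hx, hxΓ⟩ := D.inter_Γ_nonempty (convex_segment _ _).isPreconnected
      (fun x hx => (hrU (hseg hx)).2) ⟨_, left_mem_segment _ _ _, h0.1⟩
      ⟨_, right_mem_segment _ _ _, h1.1⟩
    refine ⟨x, ⟨hxΓ, (hrU (hseg hx)).1⟩, ?_⟩
    rw [segment_eq_image'] at hx
    obtain ⟨t, -, rfl⟩ := hx
    have : a + s • n + t • (b + s • n - (a + s • n)) - a = s • n + t • (b - a) := by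
      rw [add_sub_add_right_eq_sub]; abel
    simp only [f, this, inner_add_right, inner_smul_right, hn, real_inner_self_eq_norm_sq, hn1]
    ring
  have h1 := hf.hausdorffMeasure_image_le zero_le_one (D.Γ ∩ U)
  rw [ENNReal.coe_one, ENNReal.one_rpow, one_mul, hausdorffMeasure_real] at h1
  refine lt_of_lt_of_le ?_ ((measure_mono himg).trans h1)
  rw [Real.volume_Ioo, sub_zero, ENNReal.ofReal_pos]
  exact lt_min hε hε'

end Decomposition

/-! ### Triangles, edges and the length of the interface -/

namespace Triangulation

variable {D : Decomposition} (M : Triangulation D)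

/-- The triangles. -/
def triangles : Set (Finset Plane) := {t | t ∈ M.K.faces ∧ t.card = 3}

theorem finite_triangles : M.triangles.Finite := M.finite.subset fun _ h => h.1

theorem exists_triangle {x : Plane} (hx : x ∈ closure D.Ω) :
    ∃ t ∈ M.triangles, x ∈ convexHull ℝ (t : Set Plane) := by
  rw [← M.space_eq, Geometry.SimplicialComplex.mem_space_iff] at hx
  obtain ⟨s, hs, hxs⟩ := hx
  obtain ⟨t, ht, hst, hc⟩ := M.pure s hs
  exact ⟨t, ⟨ht, hc⟩, convexHull_mono (Finset.coe_subset.2 hst) hxs⟩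

theorem isCompact_hull (t : Finset Plane) : IsCompact (convexHull ℝ (t : Set Plane)) :=
  t.finite_toSet.isCompact_convexHull ℝ

theorem interior_hull_subset {t : Finset Plane} {i : Fin 2}
    (h : convexHull ℝ (t : Set Plane) ⊆ closure (D.sub i)) :
    interior (convexHull ℝ (t : Set Plane)) ⊆ D.sub i :=
  D.sub_regular i ▸ interior_mono h

theorem isCompact_closure_Ω (M : Triangulation D) : IsCompact (closure D.Ω) := by
  rw [← M.space_eq, Geometry.SimplicialComplex.space]
  exact M.finite.isCompact_biUnion fun t _ => isCompact_hull t

theorem isCompact_Γ (M : Triangulation D) : IsCompact D.Γ :=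
  M.isCompact_closure_Ω.of_isClosed_subset D.isClosed_Γ
    ((D.Γ_subset_closure 0).trans (D.closure_sub_subset 0))

/-- A point of the triangle that is not interior has a vanishing barycentric coordinate, so it is a
convex combination of the other two vertices. -/
theorem hull_diff_interior_subset {t : Finset Plane} (ht : t ∈ M.triangles) :
    convexHull ℝ (t : Set Plane) \ interior (convexHull ℝ (t : Set Plane)) ⊆
      ⋃ p ∈ t, convexHull ℝ ((t.erase p : Finset Plane) : Set Plane) := by
  have hind := M.K.indep ht.1
  let b : AffineBasis t ℝ Plane :=
    ⟨((↑) : t → Plane), hind, (hind.affineSpan_eq_top_iff_card_eq_finrank_add_one).2 (by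
      simp [ht.2])⟩
  have hb : range b = (t : Set Plane) := Subtype.range_coe
  rw [← hb, b.interior_convexHull, b.convexHull_eq_nonneg_coord]
  rintro x ⟨hx, hx'⟩
  simp only [mem_ofPred_eq, not_forall, not_lt] at hx hx'
  obtain ⟨i, hi⟩ := hx'
  have hi0 : b.coord i x = 0 := le_antisymm hi (hx i)
  refine mem_biUnion i.2 ?_
  have hsum := b.linear_combination_coord_eq_self x
  have hone := b.sum_coord_apply_eq_one x
  rw [← Finset.add_sum_erase _ _ (Finset.mem_univ i), hi0] at hsum hone
  rw [zero_smul, zero_add] at hsum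
  rw [zero_add] at hone
  rw [← hsum]
  refine (convex_convexHull ℝ _).sum_mem (fun j _ => hx j) hone fun j hj => ?_
  refine subset_convexHull ℝ _ ?_
  simp only [Finset.coe_erase, Set.mem_sdiff, Finset.mem_coe, mem_singleton_iff]
  exact ⟨j.2, fun h => (Finset.mem_erase.1 hj).1 (Subtype.ext h)⟩

/-- The interior of an uncut triangle lies in one open subdomain and misses its frontier. Hence `Γ`
is covered by finitely many segments, which makes its length finite. -/
theorem Γ_subset_edges (M : Triangulation D) : D.Γ ⊆
    ⋃ t ∈ M.triangles, ⋃ p ∈ t, convexHull ℝ ((t.erase p : Finset Plane) : Set Plane) := by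
  intro x hx
  obtain ⟨t, ht, hxt⟩ := M.exists_triangle (D.closure_sub_subset 0 (D.Γ_subset_closure 0 hx))
  obtain ⟨i, hi⟩ := M.not_cut t ht.1
  refine mem_biUnion ht (M.hull_diff_interior_subset ht ⟨hxt, fun h => ?_⟩)
  have := D.Γ_subset_frontier i hx
  rw [(D.isOpen_sub i).frontier_eq] at this
  exact this.2 (interior_hull_subset hi h)

theorem measure_Γ_lt_top (M : Triangulation D) : Measure.hausdorffMeasure 1 D.Γ < ∞ := by
  refine (measure_mono M.Γ_subset_edges).trans_lt
    (measure_biUnion_lt_top M.finite_triangles fun t ht =>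
      measure_biUnion_lt_top t.finite_toSet fun p hp => ?_)
  have hc : (t.erase p).card = 2 := by rw [Finset.card_erase_of_mem hp, ht.2]
  obtain ⟨a, b, -, hab⟩ := Finset.card_eq_two.1 hc
  rw [hab, Finset.coe_pair, convexHull_pair, hausdorffMeasure_segment]
  exact edist_lt_top _ _

/-- Almost every point of a subdomain is interior to a triangle. -/
theorem ae_mem_interior_triangle (M : Triangulation D) : ∀ᵐ x ∂(volume : Measure Plane), x ∈ closure D.Ω →
    ∃ t ∈ M.triangles, x ∈ interior (convexHull ℝ (t : Set Plane)) := by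
  have h : ∀ᵐ x ∂(volume : Measure Plane), ∀ t ∈ M.triangles,
      x ∉ frontier (convexHull ℝ (t : Set Plane)) :=
    (ae_ball_iff M.finite_triangles.countable).2 fun t _ =>
      measure_eq_zero_iff_ae_notMem.1 ((convex_convexHull ℝ _).addHaar_frontier volume)
  filter_upwards [h] with x hx hxΩ
  obtain ⟨t, ht, hxt⟩ := M.exists_triangle hxΩ
  refine ⟨t, ht, ?_⟩
  have := hx t ht
  rw [(isCompact_hull t).isClosed.frontier_eq] at this
  by_contra h'
  exact this ⟨hxt, h'⟩

end Triangulation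

/-! ### Restrictions -/

theorem restr_of_mem {A : Set Plane} {x : Plane} (hx : x ∈ A) (v : Plane → ℝ) :
    restr A v x = v x := indicator_of_mem hx v

theorem restr_of_notMem {A : Set Plane} {x : Plane} (hx : x ∉ A) (v : Plane → ℝ) :
    restr A v x = 0 := indicator_of_notMem hx v

theorem restr_restr_of_subset {A B : Set Plane} (h : A ⊆ B) (v : Plane → ℝ) :
    restr A (restr B v) = restr A v := by
  funext x
  by_cases hx : x ∈ A
  · rw [restr_of_mem hx, restr_of_mem hx, restr_of_mem (h hx)]
  · rw [restr_of_notMem hx, restr_of_notMem hx]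

theorem restr_eq_iff {A : Set Plane} {u v : Plane → ℝ} : restr A u = restr A v ↔ EqOn u v A := by
  refine ⟨fun h x hx => ?_, fun h => indicator_congr h⟩
  rw [← restr_of_mem hx u, h, restr_of_mem hx]

theorem exists_gradient_of_affine (A : Plane →ᵃ[ℝ] ℝ) :
    ∃ G : Plane, (∀ x y, A y - A x = inner ℝ G (y - x)) ∧ ∀ x, HasGradientAt A G x := by
  let L : Plane →L[ℝ] ℝ := A.linear.toContinuousLinearMap
  have hL : ∀ x y, A y - A x = L (y - x) := fun x y => by
    have := A.linearMap_vsub y x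
    simpa [L] using this.symm
  refine ⟨(InnerProductSpace.toDual ℝ Plane).symm L, fun x y => ?_, fun x => ?_⟩
  · rw [hL, InnerProductSpace.toDual_symm_apply]
  · rw [hasGradientAt_iff_hasFDerivAt, LinearIsometryEquiv.apply_symm_apply]
    have : (A : Plane → ℝ) = fun y => L y + (A x - L x) := funext fun y => by
      have := hL x y
      rw [map_sub] at this
      linarith
    rw [this]
    exact L.hasFDerivAt.add_const _

/-! ### The forms depend only on values in the subdomains -/

theorem form_eq_mul (D : Decomposition) (ν : Fin 2 → ℝ) (i : Fin 2) (u v : Plane → ℝ) :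
    form D ν i u v = ν i * form D 1 i u v := by
  simp only [form, Pi.one_apply, one_mul]
  exact integral_const_mul _ _

theorem form_congr (D : Decomposition) (ν : Fin 2 → ℝ) (i : Fin 2) {u u' v v' : Plane → ℝ}
    (hu : EqOn u u' (D.sub i)) (hv : EqOn v v' (D.sub i)) :
    form D ν i u v = form D ν i u' v' := by
  refine setIntegral_congr_fun (D.isOpen_sub i).measurableSet fun x hx => ?_
  have e : ∀ {w w' : Plane → ℝ}, EqOn w w' (D.sub i) → gradient w x = gradient w' x := fun h =>
    Filter.EventuallyEq.gradient_eq (h.eventuallyEq_of_mem ((D.isOpen_sub i).mem_nhds hx))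
  simp only [e hu, e hv]

theorem load_congr (D : Decomposition) (f : Plane → ℝ) (i : Fin 2) {v v' : Plane → ℝ}
    (hv : EqOn v v' (D.sub i)) : load D f i v = load D f i v' :=
  setIntegral_congr_fun (D.isOpen_sub i).measurableSet fun x hx => by simp only [hv hx]

theorem pairing_congr (D : Decomposition) {u u' v v' : Plane → ℝ}
    (hu : EqOn u u' D.Γ) (hv : EqOn v v' D.Γ) : pairing D u v = pairing D u' v' :=
  setIntegral_congr_fun D.isClosed_Γ.measurableSet fun x hx => by simp only [hu hx, hv hx]

theorem eqOn_restr_sub (D : Decomposition) (i : Fin 2) (w : Plane → ℝ) :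
    EqOn (restr (closure (D.sub i)) w) w (D.sub i) := fun _ hx => restr_of_mem (subset_closure hx) w

theorem form_comm (D : Decomposition) (ν : Fin 2 → ℝ) (i : Fin 2) (u v : Plane → ℝ) :
    form D ν i u v = form D ν i v u := by
  simp only [form, real_inner_comm]

theorem load_zero (D : Decomposition) (i : Fin 2) (v : Plane → ℝ) : load D 0 i v = 0 := by
  simp [load]

theorem pairing_comm (D : Decomposition) (u v : Plane → ℝ) : pairing D u v = pairing D v u := by
  simp only [pairing, mul_comm]

/-! ### Piecewise constant gradients and the Dirichlet energy -/

namespace Triangulation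

variable {D : Decomposition} (M : Triangulation D)

/-- `u` has constant gradient on the part of each open triangle inside `Ωᵢ`. -/
def HasPiecewiseConstGradient (i : Fin 2) (u : Plane → ℝ) : Prop :=
  ∀ t ∈ M.triangles, ∃ G : Plane, ∀ x ∈ interior (convexHull ℝ (t : Set Plane)) ∩ D.sub i,
    HasGradientAt u G x

variable {M}

theorem hasGradientAt_of_eqOn {t : Finset Plane} {w : Plane → ℝ} {A : Plane →ᵃ[ℝ] ℝ}
    (hA : EqOn w A (convexHull ℝ (t : Set Plane))) {G : Plane} (hG : ∀ x, HasGradientAt A G x)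
    {x : Plane} (hx : x ∈ interior (convexHull ℝ (t : Set Plane))) : HasGradientAt w G x :=
  (hG x).congr_of_eventuallyEq (hA.eventuallyEq_of_mem (mem_interior_iff_mem_nhds.1 hx))

theorem hasPiecewiseConstGradient_of_mem_W {w : Plane → ℝ} (hw : w ∈ M.W) (i : Fin 2) :
    M.HasPiecewiseConstGradient i w := fun t ht => by
  obtain ⟨A, hA⟩ := hw.2.2 t ht.1
  obtain ⟨G, -, hG⟩ := exists_gradient_of_affine A
  exact ⟨G, fun x hx => hasGradientAt_of_eqOn hA hG hx.1⟩

/-- Restriction may create a jump across the frontier of `D.sub i`, so the gradient is controlled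
only in the open subdomain, where the restriction agrees locally with a member of `M.W`. -/
theorem hasPiecewiseConstGradient_of_mem_WSub {i : Fin 2} {u : Plane → ℝ} (hu : u ∈ M.WSub i) :
    M.HasPiecewiseConstGradient i u := fun t ht => by
  obtain ⟨w, hw, rfl⟩ := hu
  obtain ⟨G, hG⟩ := hasPiecewiseConstGradient_of_mem_W hw i t ht
  exact ⟨G, fun x hx => (hG x hx).congr_of_eventuallyEq
    ((eqOn_restr_sub D i w).eventuallyEq_of_mem ((D.isOpen_sub i).mem_nhds hx.2))⟩

theorem sub_ae_subset (M : Triangulation D) (i : Fin 2) :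
    ∀ᵐ x ∂(volume : Measure Plane).restrict (D.sub i), ∃ t ∈ M.triangles,
      x ∈ interior (convexHull ℝ (t : Set Plane)) ∩ D.sub i := by
  rw [ae_restrict_iff' (D.isOpen_sub i).measurableSet]
  filter_upwards [M.ae_mem_interior_triangle] with x hx hxi
  obtain ⟨t, ht, hxt⟩ := hx (subset_closure (D.sub_subset i hxi))
  exact ⟨t, ht, hxt, hxi⟩

variable {i : Fin 2} {u u' v : Plane → ℝ}

theorem HasPiecewiseConstGradient.ae_differentiableAt (hu : M.HasPiecewiseConstGradient i u) :
    ∀ᵐ x ∂(volume : Measure Plane).restrict (D.sub i), DifferentiableAt ℝ u x := by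
  filter_upwards [M.sub_ae_subset i] with x hx
  obtain ⟨t, ht, hxt⟩ := hx
  obtain ⟨G, hG⟩ := hu t ht
  exact (hG x hxt).differentiableAt

theorem HasPiecewiseConstGradient.ae_gradient_add (hu : M.HasPiecewiseConstGradient i u)
    (hu' : M.HasPiecewiseConstGradient i u') :
    ∀ᵐ x ∂(volume : Measure Plane).restrict (D.sub i),
      gradient (u + u') x = gradient u x + gradient u' x := by
  filter_upwards [hu.ae_differentiableAt, hu'.ae_differentiableAt] with x h1 h2
  apply HasGradientAt.gradient
  rw [hasGradientAt_iff_hasFDerivAt, map_add]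
  exact h1.hasGradientAt.hasFDerivAt.add h2.hasGradientAt.hasFDerivAt

theorem HasPiecewiseConstGradient.ae_gradient_smul (hu : M.HasPiecewiseConstGradient i u) (r : ℝ) :
    ∀ᵐ x ∂(volume : Measure Plane).restrict (D.sub i),
      gradient (r • u) x = r • gradient u x := by
  filter_upwards [hu.ae_differentiableAt] with x h1
  apply HasGradientAt.gradient
  rw [hasGradientAt_iff_hasFDerivAt, map_smul]
  exact h1.hasGradientAt.hasFDerivAt.const_smul r

/-- The integrand is constant on each of finitely many sets of finite measure that cover the
subdomain up to a null set. Integrability is what makes `form` additive. -/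
theorem HasPiecewiseConstGradient.integrableOn (hu : M.HasPiecewiseConstGradient i u)
    (hv : M.HasPiecewiseConstGradient i v) :
    IntegrableOn (fun x => inner ℝ (gradient u x) (gradient v x)) (D.sub i) := by
  have h : IntegrableOn (fun x => inner ℝ (gradient u x) (gradient v x))
      (⋃ t ∈ M.triangles, interior (convexHull ℝ (t : Set Plane)) ∩ D.sub i) := by
    rw [integrableOn_finite_biUnion M.finite_triangles]
    intro t ht
    obtain ⟨G, hG⟩ := hu t ht
    obtain ⟨G', hG'⟩ := hv t ht
    refine (integrableOn_congr_fun (f := fun _ => inner ℝ G G') (fun x hx => ?_)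
      (isOpen_interior.inter (D.isOpen_sub i)).measurableSet).1 (integrableOn_const ?_)
    · simp only [(hG x hx).gradient, (hG' x hx).gradient]
    · exact ((measure_mono (inter_subset_left.trans interior_subset)).trans_lt
        (isCompact_hull t).measure_lt_top).ne
  refine h.mono_set_ae ?_
  have := (ae_restrict_iff' (D.isOpen_sub i).measurableSet).1 (M.sub_ae_subset i)
  filter_upwards [this] with x hx hxi
  obtain ⟨t, ht, hxt⟩ := hx hxi
  exact mem_biUnion ht hxt

theorem form_one (D : Decomposition) (i : Fin 2) (u v : Plane → ℝ) :
    form D 1 i u v = ∫ x in D.sub i, inner ℝ (gradient u x) (gradient v x) := by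
  simp [form]

theorem form_add_left (hu : M.HasPiecewiseConstGradient i u)
    (hu' : M.HasPiecewiseConstGradient i u') (hv : M.HasPiecewiseConstGradient i v) :
    form D 1 i (u + u') v = form D 1 i u v + form D 1 i u' v := by
  rw [form_one, form_one, form_one, ← integral_add (hu.integrableOn hv) (hu'.integrableOn hv)]
  refine integral_congr_ae ?_
  filter_upwards [hu.ae_gradient_add hu'] with x hx
  simp only [hx, inner_add_left]

theorem form_smul_left (hu : M.HasPiecewiseConstGradient i u) (r : ℝ) :
    form D 1 i (r • u) v = r * form D 1 i u v := by
  rw [form_one, form_one, ← integral_const_mul]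
  refine integral_congr_ae ?_
  filter_upwards [hu.ae_gradient_smul r] with x hx
  simp only [hx, real_inner_smul_left]

variable (M)

/-- The Dirichlet form on `Wᵢ` as a bilinear map. -/
noncomputable def energy (i : Fin 2) : M.WSub i →ₗ[ℝ] M.WSub i →ₗ[ℝ] ℝ :=
  LinearMap.mk₂ ℝ (fun u v => form D 1 i u.1 v.1)
    (fun u u' v => form_add_left (hasPiecewiseConstGradient_of_mem_WSub u.2)
      (hasPiecewiseConstGradient_of_mem_WSub u'.2) (hasPiecewiseConstGradient_of_mem_WSub v.2))
    (fun r u v => form_smul_left (hasPiecewiseConstGradient_of_mem_WSub u.2) r)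
    (fun u v v' => by
      rw [form_comm, form_comm _ _ _ u.1 v.1, form_comm _ _ _ u.1 v'.1]
      exact form_add_left (hasPiecewiseConstGradient_of_mem_WSub v.2)
        (hasPiecewiseConstGradient_of_mem_WSub v'.2) (hasPiecewiseConstGradient_of_mem_WSub u.2))
    (fun r u v => by
      rw [form_comm, form_comm _ _ _ u.1 v.1]
      exact form_smul_left (hasPiecewiseConstGradient_of_mem_WSub v.2) r)

theorem energy_apply (i : Fin 2) (u v : M.WSub i) : M.energy i u v = form D 1 i u.1 v.1 := rfl

theorem form_eq_energy (ν : Fin 2 → ℝ) (i : Fin 2) (u v : M.WSub i) :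
    form D ν i u.1 v.1 = ν i * M.energy i u v := form_eq_mul _ _ _ _ _

theorem energy_comm (i : Fin 2) (u v : M.WSub i) : M.energy i u v = M.energy i v u :=
  form_comm _ _ _ _ _

theorem energy_self_eq (i : Fin 2) (u : M.WSub i) : M.energy i u u = seminormSq D i u.1 := by
  rw [energy_apply, form_one, seminormSq]
  simp only [real_inner_self_eq_norm_sq]

theorem energy_self_nonneg (i : Fin 2) (u : M.WSub i) : 0 ≤ M.energy i u u := by
  rw [energy_self_eq]
  exact integral_nonneg fun x => sq_nonneg _

theorem interior_hull_nonempty {t : Finset Plane} (ht : t ∈ M.triangles) :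
    (interior (convexHull ℝ (t : Set Plane))).Nonempty := by
  rw [interior_convexHull_nonempty_iff_affineSpan_eq_top]
  have := ((M.K.indep ht.1).affineSpan_eq_top_iff_card_eq_finrank_add_one).2 (by simp [ht.2])
  rwa [Subtype.range_coe] at this

theorem hull_subset_of_mem {t : Finset Plane} (ht : t ∈ M.K.faces) {i : Fin 2} {x : Plane}
    (hxt : x ∈ convexHull ℝ (t : Set Plane)) (hx : x ∈ D.sub i) :
    convexHull ℝ (t : Set Plane) ⊆ closure (D.sub i) := by
  obtain ⟨j, hj⟩ := M.not_cut t ht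
  obtain rfl | hji := eq_or_ne j i
  · exact hj
  · exact absurd hx (D.notMem_sub_of_mem_closure hji (hj hxt))

/-- A member of `W` with vanishing Dirichlet integral over `Ωᵢ` vanishes there, because `Ωᵢ` does
not float. -/
theorem eqOn_zero_of_form_eq_zero {w : Plane → ℝ} (hw : w ∈ M.W) {i : Fin 2}
    (h : form D 1 i w w = 0) : EqOn w 0 (closure (D.sub i)) := by
  have hpc := hasPiecewiseConstGradient_of_mem_W hw i
  rw [form_one, integral_eq_zero_iff_of_nonneg (fun x => real_inner_self_nonneg)
    (hpc.integrableOn hpc)] at h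
  have hae := (ae_restrict_iff' (D.isOpen_sub i).measurableSet).1 h
  -- A vanishing integral forces the gradient to vanish almost everywhere, hence somewhere in the
  -- interior of each triangle that meets the subdomain; the affine piece there is constant.
  have hconst : ∀ t ∈ M.triangles, (w '' (convexHull ℝ (t : Set Plane) ∩ D.sub i)).Subsingleton := by
    rintro t ht _ ⟨x, hx, rfl⟩ _ ⟨y, hy, rfl⟩
    have hsub := M.hull_subset_of_mem ht.1 hx.1 hx.2
    obtain ⟨A, hA⟩ := hw.2.2 t ht.1
    obtain ⟨G, hAG, hG⟩ := exists_gradient_of_affine A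
    have hpos : 0 < (volume : Measure Plane) (interior (convexHull ℝ (t : Set Plane))) :=
      isOpen_interior.measure_pos _ (M.interior_hull_nonempty ht)
    obtain ⟨z, hzt, hz⟩ : ∃ z ∈ interior (convexHull ℝ (t : Set Plane)),
        inner ℝ (gradient w z) (gradient w z) = 0 := by
      by_contra! hne
      refine hpos.ne' (measure_mono_null (fun z hz => ?_) hae)
      exact fun hz' => hne z hz (hz' (interior_hull_subset hsub hz))
    have hG0 : G = 0 := by
      rw [(hasGradientAt_of_eqOn hA hG hzt).gradient] at hz
      exact inner_self_eq_zero.1 hz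
    have := hAG x y
    rw [hG0, inner_zero_left] at this
    rw [hA hx.1, hA hy.1]
    linarith
  -- Finitely many triangles give finitely many values, and a connected subset of ℝ with finitely
  -- many points is a single point.
  have hfin : (w '' D.sub i).Finite := by
    refine (M.finite_triangles.biUnion fun t ht => (hconst t ht).finite).subset ?_
    rintro _ ⟨x, hx, rfl⟩
    obtain ⟨t, ht, hxt⟩ := M.exists_triangle (subset_closure (D.sub_subset i hx))
    exact mem_biUnion ht ⟨x, ⟨hxt, hx⟩, rfl⟩
  have hss : (w '' D.sub i).Subsingleton := by
    by_contra hns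
    exact ((D.sub_connected i).isPreconnected.image w hw.1.continuousOn).infinite_of_nontrivial
      (not_subsingleton_iff.1 hns) hfin
  -- By continuity the constant is the value at a frontier point off `Γ`; such a point is outside
  -- `Ω`, so the value is 0.
  obtain ⟨p, hpf, hpΓ⟩ := D.outer i
  have hp0 : w p = 0 := hw.2.1 p (D.notMem_Ω_of_mem_frontier hpf hpΓ)
  obtain ⟨y, hy⟩ := (D.sub_connected i).nonempty
  have heq : EqOn w (fun _ => w y) (closure (D.sub i)) :=
    EqOn.closure (fun x hx => hss ⟨x, hx, rfl⟩ ⟨y, hy, rfl⟩) hw.1 continuous_const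
  intro x hx
  rw [heq hx, ← heq (frontier_subset_closure hpf), hp0]
  rfl

theorem energy_definite (i : Fin 2) (u : M.WSub i) (h : M.energy i u u = 0) : u = 0 := by
  obtain ⟨_, w, hw, rfl⟩ := u
  rw [energy_apply, form_congr D 1 i (eqOn_restr_sub D i w) (eqOn_restr_sub D i w)] at h
  refine Subtype.ext ?_
  have := restr_eq_iff.2 (M.eqOn_zero_of_form_eq_zero hw h)
  rwa [map_zero] at this

/-! ### Finite dimensionality -/

/-- The vertices. -/
def nodes : Set Plane := ⋃ t ∈ M.K.faces, (t : Set Plane)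

theorem finite_nodes : M.nodes.Finite := M.finite.biUnion fun t _ => t.finite_toSet

/-- Affine pieces are determined by their vertex values. Evaluation at the finitely many nodes
therefore embeds `M.W` in a finite-dimensional space. -/
theorem eq_zero_of_nodes {w : Plane → ℝ} (hw : w ∈ M.W) (h : ∀ p ∈ M.nodes, w p = 0) : w = 0 := by
  funext x
  by_cases hx : x ∈ D.Ω
  · obtain ⟨t, ht, hxt⟩ := M.exists_triangle (subset_closure hx)
    obtain ⟨A, hA⟩ := hw.2.2 t ht.1
    have h1 : A x ∈ A '' convexHull ℝ (t : Set Plane) := ⟨x, hxt, rfl⟩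
    rw [AffineMap.image_convexHull] at h1
    have h2 : A '' (t : Set Plane) ⊆ {0} := by
      rintro _ ⟨p, hp, rfl⟩
      rw [← hA (subset_convexHull ℝ _ hp)]
      exact h p (mem_biUnion ht.1 hp)
    have := convexHull_mono h2 h1
    rw [convexHull_singleton] at this
    rw [hA hxt]
    exact this
  · exact hw.2.1 x hx

instance finiteDimensional_W : FiniteDimensional ℝ M.W := by
  have : Finite M.nodes := M.finite_nodes
  let φ : M.W →ₗ[ℝ] (M.nodes → ℝ) :=
    { toFun := fun w p => w.1 p
      map_add' := fun _ _ => rfl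
      map_smul' := fun _ _ => rfl }
  refine FiniteDimensional.of_injective φ ?_
  rw [injective_iff_map_eq_zero]
  exact fun w hw => Subtype.ext (M.eq_zero_of_nodes w.2 fun p hp => congrFun hw ⟨p, hp⟩)

/-! ### Traces and gluing -/

theorem restr_Γ_restr_sub (i : Fin 2) (w : Plane → ℝ) :
    restr D.Γ (restr (closure (D.sub i)) w) = restr D.Γ w :=
  restr_restr_of_subset (D.Γ_subset_closure i) w

/-- The trace `Wᵢ → V_Γ`. -/
noncomputable def subTrace (i : Fin 2) : M.WSub i →ₗ[ℝ] M.V :=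
  (restr D.Γ).restrict (by
    rintro _ ⟨w, hw, rfl⟩
    rw [restr_Γ_restr_sub]
    exact Submodule.mem_map_of_mem hw)

/-- The restriction `W → Wᵢ`. -/
noncomputable def toSub (i : Fin 2) : M.W →ₗ[ℝ] M.WSub i :=
  (restr (closure (D.sub i))).restrict fun _ hw => Submodule.mem_map_of_mem hw

/-- The trace `W → V_Γ` as a linear map. -/
noncomputable def traceL : M.W →ₗ[ℝ] M.V := (restr D.Γ).restrict fun _ hw => Submodule.mem_map_of_mem hw

theorem coe_toSub (i : Fin 2) (w : M.W) : (M.toSub i w).1 = restr (closure (D.sub i)) w.1 := rfl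

theorem coe_subTrace (i : Fin 2) (u : M.WSub i) : (M.subTrace i u).1 = restr D.Γ u.1 := rfl

theorem toSub_surjective (i : Fin 2) : Function.Surjective (M.toSub i) := by
  rintro ⟨_, w, hw, rfl⟩
  exact ⟨⟨w, hw⟩, rfl⟩

theorem subTrace_toSub (i : Fin 2) (w : M.W) : M.subTrace i (M.toSub i w) = M.trace w :=
  Subtype.ext (restr_Γ_restr_sub i w.1)

theorem trace_surjective : Function.Surjective M.trace := by
  rintro ⟨_, w, hw, rfl⟩
  exact ⟨⟨w, hw⟩, rfl⟩

theorem subTrace_surjective (i : Fin 2) : Function.Surjective (M.subTrace i) := fun g => by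
  obtain ⟨w, rfl⟩ := M.trace_surjective g
  exact ⟨M.toSub i w, M.subTrace_toSub i w⟩

instance finiteDimensional_WSub (i : Fin 2) : FiniteDimensional ℝ (M.WSub i) :=
  Module.Finite.of_surjective (M.toSub i) (M.toSub_surjective i)

instance finiteDimensional_V : FiniteDimensional ℝ M.V :=
  Module.Finite.of_surjective M.traceL M.trace_surjective

theorem subTrace_eq_iff {i : Fin 2} {u : M.WSub i} {g : M.V} :
    M.subTrace i u = g ↔ EqOn u.1 g.1 D.Γ := by
  have hg : restr D.Γ g.1 = g.1 := by
    obtain ⟨_, w, hw, rfl⟩ := g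
    exact restr_restr_of_subset Subset.rfl w
  rw [← restr_eq_iff, hg, Subtype.ext_iff, coe_subTrace]

theorem subTrace_eq_subTrace_iff {i j : Fin 2} {u : M.WSub i} {v : M.WSub j} :
    M.subTrace i u = M.subTrace j v ↔ EqOn u.1 v.1 D.Γ := by
  rw [← restr_eq_iff, Subtype.ext_iff, coe_subTrace, coe_subTrace]

theorem WSub_eq_zero {i : Fin 2} (u : M.WSub i) {x : Plane}
    (hx : x ∈ frontier (D.sub i) \ D.Γ) : u.1 x = 0 := by
  obtain ⟨⟨w, hw⟩, rfl⟩ := M.toSub_surjective i u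
  rw [coe_toSub, restr_of_mem (frontier_subset_closure hx.1)]
  exact hw.2.1 x (D.notMem_Ω_of_mem_frontier hx.1 hx.2)

/-- Zero trace makes `u` vanish on the whole frontier of `D.sub i`, so its extension by zero is
continuous. It stays affine on every simplex because none is cut: one in the other closure meets
`closure (D.sub i)` only in `Γ`, where `u` is zero. -/
theorem mem_WZero_of_trace_eq_zero {i : Fin 2} {u : M.WSub i} (h : M.subTrace i u = 0) :
    u.1 ∈ M.WZero i := by
  have h0 := M.subTrace_eq_iff.1 h
  have hfr : ∀ x ∈ frontier (D.sub i), u.1 x = 0 := fun x hx => by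
    by_cases hΓ : x ∈ D.Γ
    · exact h0 hΓ
    · exact M.WSub_eq_zero u ⟨hx, hΓ⟩
  obtain ⟨⟨w, hw⟩, rfl⟩ := M.toSub_surjective i u
  rw [coe_toSub] at h0 hfr ⊢
  have hwfr : ∀ x ∈ frontier (D.sub i), w x = 0 := fun x hx => by
    rw [← hfr x hx, restr_of_mem (frontier_subset_closure hx)]
  refine ⟨⟨?_, fun x hx => ?_, fun t ht => ?_⟩, fun x hx => ?_⟩
  · refine continuous_indicator (fun x hx => hwfr x (frontier_closure_subset hx))
      hw.1.continuousOn
  · by_cases hx' : x ∈ closure (D.sub i)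
    · exact (restr_of_mem hx' w).trans (hw.2.1 x hx)
    · exact restr_of_notMem hx' w
  · obtain ⟨j, hj⟩ := M.not_cut t ht
    obtain rfl | hji := eq_or_ne j i
    · obtain ⟨A, hA⟩ := hw.2.2 t ht
      exact ⟨A, fun x hx => (restr_of_mem (hj hx) w).trans (hA hx)⟩
    · refine ⟨0, fun x hx => ?_⟩
      by_cases hx' : x ∈ closure (D.sub i)
      · exact h0 (D.mem_Γ_of_mem_closure hji (hj hx) hx')
      · exact restr_of_notMem hx' w
  · by_cases hx' : x ∈ closure (D.sub i)
    · refine hfr x ?_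
      rw [(D.isOpen_sub i).frontier_eq]
      exact ⟨hx', hx⟩
    · exact restr_of_notMem hx' w

theorem exists_of_mem_WZero {i : Fin 2} {v : Plane → ℝ} (hv : v ∈ M.WZero i) :
    ∃ z : M.WSub i, z.1 = v ∧ M.subTrace i z = 0 := by
  have hr : restr (closure (D.sub i)) v = v := by
    refine indicator_eq_self.2 fun x hx => subset_closure ?_
    by_contra h
    exact hx (hv.2 x h)
  refine ⟨⟨v, v, hv.1, hr⟩, rfl, M.subTrace_eq_iff.2 fun x hx => hv.2 x fun hxi => ?_⟩
  have := D.Γ_subset_frontier i hx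
  rw [(D.isOpen_sub i).frontier_eq] at this
  exact this.2 hxi

/-- Members of `W₁` and `W₂` with the same trace are restrictions of one member of `W`. -/
theorem exists_glue (u : ∀ i, M.WSub i) (g : M.V) (h : ∀ i, M.subTrace i (u i) = g) :
    ∃ w : M.W, (∀ i, M.toSub i w = u i) ∧ M.trace w = g := by
  -- An extension of `u 1` is corrected in `D.sub 0` by a function of zero trace, which leaves the
  -- other side unchanged.
  obtain ⟨w, hw⟩ := M.toSub_surjective 1 (u 1)
  have hwg : M.trace w = g := by rw [← M.subTrace_toSub 1, hw, h]
  have hz : M.subTrace 0 (u 0 - M.toSub 0 w) = 0 := by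
    rw [map_sub, h, subTrace_toSub, hwg, sub_self]
  have hmem := M.mem_WZero_of_trace_eq_zero hz
  let z : M.W := ⟨_, hmem.1⟩
  have hz0 : M.toSub 0 z = u 0 - M.toSub 0 w := by
    refine Subtype.ext ?_
    rw [coe_toSub]
    refine indicator_eq_self.2 fun x hx => subset_closure ?_
    by_contra h
    exact hx (hmem.2 x h)
  have hz1 : M.toSub 1 z = 0 := by
    refine Subtype.ext ?_
    rw [coe_toSub]
    refine (restr_eq_iff (v := 0)).2 (fun x hx => hmem.2 x ?_) |>.trans (map_zero _)
    exact D.notMem_sub_of_mem_closure (by decide) hx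
  have hw' : ∀ i, M.toSub i (w + z) = u i := fun i => by
    fin_cases i
    · change M.toSub 0 (w + z) = u 0
      rw [map_add, hz0, add_sub_cancel]
    · change M.toSub 1 (w + z) = u 1
      rw [map_add, hz1, hw, add_zero]
  exact ⟨w + z, hw', by rw [← M.subTrace_toSub 0, hw', h]⟩

end Triangulation

namespace Triangulation

variable {D : Decomposition} (M : Triangulation D)

/-! ### The pairing on the interface -/

variable {M} in
theorem continuousOn_Γ (v : M.V) : ContinuousOn v.1 D.Γ := by
  obtain ⟨w, rfl⟩ := M.trace_surjective v
  exact w.2.1.continuousOn.congr fun x hx => restr_of_mem hx w.1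

theorem integrableOn_Γ (M : Triangulation D) {φ : Plane → ℝ} (hφ : ContinuousOn φ D.Γ) :
    IntegrableOn φ D.Γ (Measure.hausdorffMeasure 1) := by
  obtain ⟨C, hC⟩ := M.isCompact_Γ.exists_bound_of_continuousOn hφ
  exact IntegrableOn.of_bound M.measure_Γ_lt_top
    (hφ.aestronglyMeasurable D.isClosed_Γ.measurableSet) C
    (ae_restrict_of_forall_mem D.isClosed_Γ.measurableSet hC)

theorem integrableOn_mul_Γ (u v : M.V) :
    IntegrableOn (fun x => u.1 x * v.1 x) D.Γ (Measure.hausdorffMeasure 1) :=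
  M.integrableOn_Γ ((continuousOn_Γ u).mul (continuousOn_Γ v))

theorem pairing_add_left (u u' v : M.V) :
    pairing D (u + u').1 v.1 = pairing D u.1 v.1 + pairing D u'.1 v.1 := by
  rw [pairing, pairing, pairing, ← integral_add (M.integrableOn_mul_Γ u v)
    (M.integrableOn_mul_Γ u' v)]
  simp [add_mul]

theorem pairing_smul_left (r : ℝ) (u v : M.V) :
    pairing D (r • u).1 v.1 = r * pairing D u.1 v.1 := by
  rw [pairing, pairing, ← integral_const_mul]
  simp [mul_assoc]

/-- The pairing as a bilinear map on `V_Γ`. -/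
noncomputable def pair : M.V →ₗ[ℝ] M.V →ₗ[ℝ] ℝ :=
  LinearMap.mk₂ ℝ (fun u v => pairing D u.1 v.1) M.pairing_add_left M.pairing_smul_left
    (fun u v v' => by
      rw [pairing_comm, pairing_comm _ u.1 v.1, pairing_comm _ u.1 v'.1]
      exact M.pairing_add_left v v' u)
    (fun r u v => by
      rw [pairing_comm, pairing_comm _ u.1 v.1]
      exact M.pairing_smul_left r v u)

theorem pair_apply (u v : M.V) : M.pair u v = pairing D u.1 v.1 := rfl

theorem pair_comm (u v : M.V) : M.pair u v = M.pair v u := pairing_comm _ _ _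

theorem pairing_subTrace {i : Fin 2} (g : M.V) (u : M.WSub i) :
    pairing D g.1 u.1 = M.pair g (M.subTrace i u) :=
  pairing_congr D (fun _ _ => rfl) (M.subTrace_eq_iff.1 rfl)

theorem pair_self_eq (v : M.V) :
    M.pair v v = ∫ x in D.Γ, v.1 x ^ 2 ∂(Measure.hausdorffMeasure 1) := by
  simp only [pair_apply, pairing, sq]

theorem pair_self_nonneg (v : M.V) : 0 ≤ M.pair v v := by
  rw [pair_self_eq]
  exact integral_nonneg fun x => sq_nonneg _

/-- A continuous function that is nonzero at a point of `Γ` is nonzero near it. The point lies in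
`Ω`, since members of `M.W` vanish elsewhere, and there every neighbourhood contains a positive
length of `Γ`. -/
theorem pair_definite (v : M.V) (h : M.pair v v = 0) : v = 0 := by
  rw [pair_self_eq, integral_eq_zero_iff_of_nonneg (fun x => sq_nonneg _)
    (M.integrableOn_Γ ((continuousOn_Γ v).pow 2))] at h
  have hae := (ae_restrict_iff' D.isClosed_Γ.measurableSet).1 h
  obtain ⟨w, rfl⟩ := M.trace_surjective v
  have hw : EqOn w.1 0 D.Γ := fun p hp => by
    by_contra hne
    have hΩ : p ∈ D.Ω := by
      by_contra hΩ
      exact hne (w.2.2.1 p hΩ)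
    have hU : {x | w.1 x ≠ 0} ∈ 𝓝 p := (isOpen_ne_fun w.2.1 continuous_const).mem_nhds hne
    refine (D.measure_Γ_inter_pos hp hΩ hU).ne' (measure_mono_null ?_ hae)
    rintro x ⟨hx, hwx⟩ hx'
    have h2 : restr D.Γ w.1 x ^ 2 = 0 := hx' hx
    rw [restr_of_mem hx] at h2
    exact hwx (pow_eq_zero_iff two_ne_zero |>.1 h2)
  exact Subtype.ext ((restr_eq_iff.2 hw).trans (map_zero _))

/-! ### Loads -/

variable {M} in
theorem exists_bound_W {w : Plane → ℝ} (hw : w ∈ M.W) : ∃ C, ∀ x, ‖w x‖ ≤ C := by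
  obtain ⟨C, hC⟩ := M.isCompact_closure_Ω.exists_bound_of_continuousOn hw.1.continuousOn
  refine ⟨max C 0, fun x => ?_⟩
  by_cases hx : x ∈ D.Ω
  · exact (hC x (subset_closure hx)).trans (le_max_left _ _)
  · rw [hw.2.1 x hx, norm_zero]
    exact le_max_right _ _

variable {M} in
theorem integrableOn_load {f : Plane → ℝ} (hf : IntegrableOn f D.Ω) {i : Fin 2} (u : M.WSub i) :
    IntegrableOn (fun x => f x * u.1 x) (D.sub i) := by
  obtain ⟨w, rfl⟩ := M.toSub_surjective i u
  obtain ⟨C, hC⟩ := exists_bound_W w.2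
  have h : IntegrableOn (fun x => f x * w.1 x) (D.sub i) :=
    (hf.mono_set (D.sub_subset i)).mul_bdd w.2.1.aestronglyMeasurable (ae_of_all _ hC)
  refine (integrableOn_congr_fun (fun x hx => ?_) (D.isOpen_sub i).measurableSet).1 h
  rw [coe_toSub]
  simp only [eqOn_restr_sub D i w.1 hx]

/-- The load as a functional on `Wᵢ`. -/
noncomputable def loadL {f : Plane → ℝ} (hf : IntegrableOn f D.Ω) (i : Fin 2) :
    M.WSub i →ₗ[ℝ] ℝ where
  toFun u := load D f i u.1
  map_add' u u' := by
    rw [load, load, load, ← integral_add (integrableOn_load hf u) (integrableOn_load hf u')]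
    simp [mul_add]
  map_smul' r u := by
    rw [load, load, RingHom.id_apply, smul_eq_mul, ← integral_const_mul]
    simp [mul_left_comm]

/-! ### Lipschitz continuity -/

/-- A local bound with one constant, the sum of the gradient norms, is integrated along segments. A
segment may leave `Ω`, which is harmless because `w` is extended by zero. -/
theorem exists_lipschitz {w : Plane → ℝ} (hw : w ∈ M.W) :
    ∃ L, 0 ≤ L ∧ ∀ x y, |w x - w y| ≤ L * dist x y := by
  have hex : ∀ t : M.triangles, ∃ G : Plane, ∀ x ∈ convexHull ℝ (t.1 : Set Plane),
      ∀ y ∈ convexHull ℝ (t.1 : Set Plane), w y - w x = inner ℝ G (y - x) := fun t => by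
    obtain ⟨A, hA⟩ := hw.2.2 t.1 t.2.1
    obtain ⟨G, hG, -⟩ := exists_gradient_of_affine A
    exact ⟨G, fun x hx y hy => by rw [hA hx, hA hy, hG]⟩
  choose G hG using hex
  have : Fintype M.triangles := M.finite_triangles.fintype
  let L := ∑ t, ‖G t‖
  have hL : ∀ t, ‖G t‖ ≤ L := fun t =>
    Finset.single_le_sum (f := fun t => ‖G t‖) (fun _ _ => norm_nonneg _) (Finset.mem_univ t)
  have hL0 : 0 ≤ L := Finset.sum_nonneg fun _ _ => norm_nonneg _
  -- Near `p` only the triangles containing `p` matter, and in each of them the affine formula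
  -- applies. For `y` outside `Ω` and close to `p`, the point `p` is outside as well and both values
  -- are 0.
  have hlocal : ∀ p, ∀ᶠ y in 𝓝 p, |w y - w p| ≤ L * dist y p := fun p => by
    have hfar : ∀ᶠ y in 𝓝 p, ∀ t ∈ M.triangles, p ∉ convexHull ℝ (t : Set Plane) →
        y ∉ convexHull ℝ (t : Set Plane) := by
      rw [M.finite_triangles.eventually_all]
      intro t _
      by_cases hp : p ∈ convexHull ℝ (t : Set Plane)
      · exact Filter.Eventually.of_forall fun y h => absurd hp h
      · filter_upwards [(isCompact_hull t).isClosed.isOpen_compl.mem_nhds hp] with y hy _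
        exact hy
    have hout : ∀ᶠ y in 𝓝 p, y ∉ D.Ω → p ∉ D.Ω := by
      by_cases hp : p ∈ D.Ω
      · filter_upwards [D.isOpen_Ω.mem_nhds hp] with y hy h
        exact absurd hy h
      · exact Filter.Eventually.of_forall fun y _ => hp
    filter_upwards [hfar, hout] with y hy1 hy2
    by_cases hyΩ : y ∈ D.Ω
    · obtain ⟨t, ht, hyt⟩ := M.exists_triangle (subset_closure hyΩ)
      have hpt : p ∈ convexHull ℝ (t : Set Plane) := by
        by_contra h
        exact hy1 t ht h hyt
      rw [hG ⟨t, ht⟩ p hpt y hyt, dist_eq_norm]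
      exact (abs_real_inner_le_norm _ _).trans
        (mul_le_mul_of_nonneg_right (hL _) (norm_nonneg _))
    · rw [hw.2.1 y hyΩ, hw.2.1 p (hy2 hyΩ), sub_zero, abs_zero]
      positivity
  have hone : ∀ x y, w y - w x ≤ L * dist x y := fun x y => by
    let γ : ℝ → Plane := fun t => x + t • (y - x)
    have hγ : Continuous γ := by fun_prop
    have hdist : ∀ s t, dist (γ s) (γ t) = |s - t| * dist x y := fun s t => by
      rw [dist_eq_norm, dist_comm, dist_eq_norm, ← Real.norm_eq_abs, ← norm_smul]
      congr 1
      simp only [γ, sub_smul]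
      abel
    -- The local bound controls the right difference quotients of `w` along the segment; this mean
    -- value inequality needs no differentiability.
    have key := image_le_of_liminf_slope_right_le_deriv_boundary (f := fun t => w (γ t))
      (a := 0) (b := 1) (B := fun t => w x + L * dist x y * t) (B' := fun _ => L * dist x y)
      (hw.1.comp hγ).continuousOn (by simp [γ]) (by fun_prop)
      (fun t _ => by
        simpa using (((hasDerivAt_id t).const_mul (L * dist x y)).const_add
          (w x)).hasDerivWithinAt)
      (fun t _ r hr => by
        refine Filter.Eventually.frequently ?_
        have h1 : ∀ᶠ z in 𝓝[>] t, |w (γ z) - w (γ t)| ≤ L * dist (γ z) (γ t) :=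
          (hγ.continuousAt.eventually (hlocal (γ t))).filter_mono nhdsWithin_le_nhds
        filter_upwards [h1, self_mem_nhdsWithin] with z hz hzt
        have hzt' : 0 < z - t := sub_pos.2 hzt
        rw [slope_def_field]
        refine lt_of_le_of_lt ?_ hr
        rw [div_le_iff₀ hzt']
        rw [hdist, abs_of_pos hzt'] at hz
        linarith [(abs_le.1 hz).2])
      (right_mem_Icc.2 zero_le_one)
    have h1 : γ 1 = y := by simp [γ]
    simp only [h1, mul_one] at key
    linarith
  refine ⟨L, hL0, fun x y => abs_le.2 ⟨?_, ?_⟩⟩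
  · linarith [hone x y]
  · have := hone y x
    rwa [dist_comm] at this

/-! ### Harmonic extensions and Schur complements -/

/-- The condition on the frontier off `Γ` is automatic in `M.WSub i`, and the test space `M.WZero i`
consists of the members of `M.WSub i` with zero trace. -/
theorem solvesDirichlet_iff (ν : Fin 2 → ℝ) (f : Plane → ℝ) (i : Fin 2) (g : M.V)
    (u : M.WSub i) : M.SolvesDirichlet ν f i g.1 u.1 ↔
      M.subTrace i u = g ∧ ∀ z : M.WSub i, M.subTrace i z = 0 →
        ν i * M.energy i u z = load D f i z.1 := by
  constructor
  · rintro ⟨-, h, -, hg⟩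
    refine ⟨M.subTrace_eq_iff.2 hg, fun z hz => ?_⟩
    rw [← form_eq_energy]
    exact h _ (M.mem_WZero_of_trace_eq_zero hz)
  · rintro ⟨hg, h⟩
    refine ⟨u.2, fun v hv => ?_, fun x hx => M.WSub_eq_zero u hx, M.subTrace_eq_iff.1 hg⟩
    obtain ⟨z, rfl, hz⟩ := M.exists_of_mem_WZero hv
    rw [form_eq_energy]
    exact h z hz

theorem isHarmonicExt_iff (i : Fin 2) (H : M.V →ₗ[ℝ] M.WSub i) :
    M.IsHarmonicExt i H ↔ ∀ g, M.subTrace i (H g) = g ∧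
      ∀ z, M.subTrace i z = 0 → M.energy i (H g) z = 0 := by
  refine forall_congr' fun g => ?_
  simp only [solvesDirichlet_iff, load_zero, Pi.one_apply, one_mul]

theorem existsUnique_isHarmonicExt (i : Fin 2) :
    ∃! H : M.V →ₗ[ℝ] M.WSub i, M.IsHarmonicExt i H := by
  simp only [isHarmonicExt_iff]
  exact existsUnique_orthogonal_rightInverse _ (M.energy_definite i) _ (M.subTrace_surjective i)

theorem isHarmonicExt_harmonicExt (i : Fin 2) : M.IsHarmonicExt i (M.harmonicExt i) :=
  Classical.epsilon_spec (M.existsUnique_isHarmonicExt i).exists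

theorem subTrace_harmonicExt (i : Fin 2) (g : M.V) : M.subTrace i (M.harmonicExt i g) = g :=
  ((M.isHarmonicExt_iff i _).1 (M.isHarmonicExt_harmonicExt i) g).1

theorem energy_harmonicExt {i : Fin 2} (g : M.V) {z : M.WSub i} (hz : M.subTrace i z = 0) :
    M.energy i (M.harmonicExt i g) z = 0 :=
  ((M.isHarmonicExt_iff i _).1 (M.isHarmonicExt_harmonicExt i) g).2 z hz

/-- Two extensions of the same trace differ by a function of zero trace, which is orthogonal to
harmonic extensions. Hence the Schur complement does not depend on the chosen extension. -/
theorem energy_harmonicExt_left {i : Fin 2} (g : M.V) (t : M.WSub i) :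
    M.energy i (M.harmonicExt i g) t =
      M.energy i (M.harmonicExt i g) (M.harmonicExt i (M.subTrace i t)) := by
  rw [← sub_eq_zero, ← map_sub]
  exact M.energy_harmonicExt g (by rw [map_sub, subTrace_harmonicExt, sub_self])

theorem eq_harmonicExt {i : Fin 2} {u : M.WSub i}
    (h : ∀ z, M.subTrace i z = 0 → M.energy i u z = 0) : u = M.harmonicExt i (M.subTrace i u) := by
  have hz : M.subTrace i (u - M.harmonicExt i (M.subTrace i u)) = 0 := by
    rw [map_sub, subTrace_harmonicExt, sub_self]
  rw [← sub_eq_zero]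
  apply M.energy_definite
  have h1 := h _ hz
  have h2 := M.energy_harmonicExt (M.subTrace i u) hz
  rw [map_sub (M.energy i), LinearMap.sub_apply, h1, h2, sub_zero]

/-- The energy of harmonic extensions, as a form on `V_Γ`. -/
noncomputable def schurForm (i : Fin 2) : M.V →ₗ[ℝ] M.V →ₗ[ℝ] ℝ :=
  (M.energy i).compl₁₂ (M.harmonicExt i) (M.harmonicExt i)

theorem schurForm_apply (i : Fin 2) (g h : M.V) :
    M.schurForm i g h = M.energy i (M.harmonicExt i g) (M.harmonicExt i h) := rfl

theorem schurForm_comm (i : Fin 2) (g h : M.V) : M.schurForm i g h = M.schurForm i h g :=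
  M.energy_comm i _ _

theorem schurForm_pos (i : Fin 2) (g : M.V) (hg : g ≠ 0) : 0 < M.schurForm i g g := by
  refine lt_of_le_of_ne (M.energy_self_nonneg i _) fun h => hg ?_
  rw [← M.subTrace_harmonicExt i g, M.energy_definite i _ h.symm, map_zero]

theorem schurForm_self_eq (i : Fin 2) (g : M.V) :
    M.schurForm i g g = seminormSq D i (M.harmonicExt i g).1 := M.energy_self_eq i _

theorem isSchur_iff (ν : Fin 2 → ℝ) (i : Fin 2) (T : Module.End ℝ M.V) :
    M.IsSchur ν i T ↔ ∀ g h, M.pair (T g) h = (ν i • M.schurForm i) g h := by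
  refine forall_congr' fun g => forall_congr' fun h => ?_
  simp only [LinearMap.smul_apply, smul_eq_mul]
  constructor
  · intro H
    have := H (M.harmonicExt i h).1 (M.harmonicExt i h).2
      (M.subTrace_eq_iff.1 (M.subTrace_harmonicExt i h))
    rwa [form_eq_energy] at this
  · intro H t ht hth
    have htr : M.subTrace i ⟨t, ht⟩ = h := M.subTrace_eq_iff.2 hth
    have : form D ν i (M.harmonicExt i g).1 t = _ := M.form_eq_energy ν i _ ⟨t, ht⟩
    rw [this, energy_harmonicExt_left, htr]
    exact H

theorem existsUnique_isSchur (ν : Fin 2 → ℝ) (i : Fin 2) :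
    ∃! T : Module.End ℝ M.V, M.IsSchur ν i T := by
  simp only [isSchur_iff]
  exact existsUnique_operator _ M.pair_definite _

theorem pair_S (ν : Fin 2 → ℝ) (i : Fin 2) (g h : M.V) :
    M.pair (M.S ν i g) h = ν i * M.schurForm i g h :=
  (M.isSchur_iff ν i _).1 (Classical.epsilon_spec (M.existsUnique_isSchur ν i).exists) g h

theorem pair_ext {g g' : M.V} (h : ∀ v, M.pair g v = M.pair g' v) : g = g' :=
  (bijective_of_definite M.pair M.pair_definite).1 (LinearMap.ext h)

theorem isUnit_S {ν : Fin 2 → ℝ} (hν : ∀ i, 0 < ν i) (i : Fin 2) : IsUnit (M.S ν i) := by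
  rw [Module.End.isUnit_iff]
  have hinj : Function.Injective (M.S ν i) := by
    rw [injective_iff_map_eq_zero]
    intro g hg
    by_contra hne
    have h := M.pair_S ν i g g
    rw [hg, map_zero, LinearMap.zero_apply] at h
    exact (mul_pos (hν i) (M.schurForm_pos i g hne)).ne h
  exact ⟨hinj, LinearMap.injective_iff_surjective.1 hinj⟩

theorem S_SInv {ν : Fin 2 → ℝ} (hν : ∀ i, 0 < ν i) (i : Fin 2) (g : M.V) : M.S ν i (M.SInv ν i g) = g :=
  LinearMap.congr_fun (Ring.mul_inverse_cancel _ (M.isUnit_S hν i)) g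

theorem SInv_S {ν : Fin 2 → ℝ} (hν : ∀ i, 0 < ν i) (i : Fin 2) (g : M.V) : M.SInv ν i (M.S ν i g) = g :=
  LinearMap.congr_fun (Ring.inverse_mul_cancel _ (M.isUnit_S hν i)) g

end Triangulation

/-! ### Comparison of forms -/

section Comparison

variable {E : Type*} [AddCommGroup E] [Module ℝ E] (P : E →ₗ[ℝ] E →ₗ[ℝ] ℝ)

theorem sq_apply_le (hP : ∀ x y, P x y = P y x) (hpos : ∀ x, x ≠ 0 → 0 < P x x) (x y : E) :
    P x y ^ 2 ≤ P x x * P y y := by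
  by_cases hx : x = 0
  · simp [hx]
  have hxx := hpos x hx
  -- The vector is `P x x` times the component of `y` orthogonal to `x`.
  have hnn : 0 ≤ P (P x x • y - P x y • x) (P x x • y - P x y • x) := by
    by_cases h : P x x • y - P x y • x = 0
    · simp [h]
    · exact (hpos _ h).le
  have he : P (P x x • y - P x y • x) (P x x • y - P x y • x) =
      P x x * (P x x * P y y - P x y ^ 2) := by
    simp only [map_sub, map_smul, LinearMap.sub_apply, LinearMap.smul_apply, smul_eq_mul, hP y x]
    ring
  rw [he] at hnn
  linarith [nonneg_of_mul_nonneg_right hnn hxx]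

/-- Each coordinate functional is represented through `P` by a vector, to which Cauchy-Schwarz
applies. -/
theorem exists_sq_coord_le [FiniteDimensional ℝ E] {n : ℕ} (b : Module.Basis (Fin n) ℝ E)
    (hP : ∀ x y, P x y = P y x) (hpos : ∀ x, x ≠ 0 → 0 < P x x) :
    ∃ K, 0 ≤ K ∧ ∀ v i, b.repr v i ^ 2 ≤ K * P v v := by
  have hdef : ∀ x, P x x = 0 → x = 0 := fun x hx => by
    by_contra h
    exact (hpos x h).ne' hx
  have hnn : ∀ x, 0 ≤ P x x := fun x => by
    by_cases h : x = 0
    · simp [h]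
    · exact (hpos x h).le
  choose r hr using fun i => (bijective_of_definite P hdef).2 (b.coord i)
  refine ⟨∑ i, P (r i) (r i), Finset.sum_nonneg fun i _ => hnn _, fun v i => ?_⟩
  have h1 : b.repr v i = P (r i) v := by rw [hr]; rfl
  rw [h1]
  refine (sq_apply_le P hP hpos _ _).trans (mul_le_mul_of_nonneg_right ?_ (hnn v))
  exact Finset.single_le_sum (f := fun i => P (r i) (r i)) (fun _ _ => hnn _) (Finset.mem_univ i)

/-- Expansion in a basis leaves products of two coordinates, each bounded by the mean of their
squares. -/
theorem exists_form_le [FiniteDimensional ℝ E] (hP : ∀ x y, P x y = P y x) (hpos : ∀ x, x ≠ 0 → 0 < P x x)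
    (A : E →ₗ[ℝ] E →ₗ[ℝ] ℝ) : ∃ K, 0 ≤ K ∧ ∀ v, A v v ≤ K * P v v := by
  let b := Module.finBasis ℝ E
  obtain ⟨K, hK, hb⟩ := exists_sq_coord_le P b hP hpos
  refine ⟨K * ∑ i, ∑ j, |A (b i) (b j)|, by positivity, fun v => ?_⟩
  have hv : A v v = ∑ i, ∑ j, b.repr v i * b.repr v j * A (b i) (b j) := by
    conv_lhs => rw [← b.sum_repr v]
    simp only [map_sum, LinearMap.sum_apply, map_smul, LinearMap.smul_apply, smul_eq_mul]
    rw [Finset.sum_comm]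
    simp only [Finset.mul_sum, mul_assoc]
    refine Finset.sum_congr rfl fun i _ => Finset.sum_congr rfl fun j _ => by ring
  rw [hv, mul_right_comm, Finset.mul_sum]
  refine Finset.sum_le_sum fun i _ => ?_
  rw [Finset.mul_sum]
  refine Finset.sum_le_sum fun j _ => (le_abs_self _).trans ?_
  rw [abs_mul]
  refine mul_le_mul_of_nonneg_right ?_ (abs_nonneg _)
  have h1 := hb v i
  have h2 := hb v j
  rw [abs_le]
  constructor
  · linarith [sq_nonneg (b.repr v i + b.repr v j), add_sq (b.repr v i) (b.repr v j)]
  · linarith [sq_nonneg (b.repr v i - b.repr v j), sub_sq (b.repr v i) (b.repr v j)]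

end Comparison

/-! ### Existence of norm-equivalence constants -/

namespace Triangulation

variable {D : Decomposition} (M : Triangulation D)

theorem pair_pos (v : M.V) (hv : v ≠ 0) : 0 < M.pair v v :=
  lt_of_le_of_ne (M.pair_self_nonneg v) fun h => hv (M.pair_definite v h.symm)

/-- Simultaneous bound and Lipschitz constant for a member of `V_Γ`, controlled by the norm. -/
theorem exists_lipschitz_V : ∃ K, 0 ≤ K ∧ ∀ v : M.V, ∃ L, 0 ≤ L ∧ L ^ 2 ≤ K * M.pair v v ∧
    (∀ x ∈ D.Γ, |v.1 x| ≤ L) ∧ (∀ x ∈ D.Γ, ∀ y ∈ D.Γ, |v.1 x - v.1 y| ≤ L * dist x y) := by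
  let b := Module.finBasis ℝ M.V
  obtain ⟨K, hK, hb⟩ := exists_sq_coord_le M.pair b M.pair_comm M.pair_pos
  have hbas : ∀ i, ∃ L, 0 ≤ L ∧ (∀ x ∈ D.Γ, |(b i).1 x| ≤ L) ∧
      (∀ x ∈ D.Γ, ∀ y ∈ D.Γ, |(b i).1 x - (b i).1 y| ≤ L * dist x y) := fun i => by
    obtain ⟨w, hw⟩ := M.trace_surjective (b i)
    have hwx : ∀ x ∈ D.Γ, (b i).1 x = w.1 x := fun x hx => by
      rw [← hw]
      exact restr_of_mem hx w.1
    obtain ⟨L, hL, hlip⟩ := M.exists_lipschitz w.2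
    obtain ⟨C, hC⟩ := exists_bound_W w.2
    refine ⟨max L C, hL.trans (le_max_left _ _), fun x hx => ?_, fun x hx y hy => ?_⟩
    · rw [hwx x hx]
      exact (hC x).trans (le_max_right _ _)
    · rw [hwx x hx, hwx y hy]
      exact (hlip x y).trans (mul_le_mul_of_nonneg_right (le_max_left _ _) dist_nonneg)
  choose L hL hbd hlip using hbas
  refine ⟨(∑ i, L i ^ 2) * (Module.finrank ℝ M.V * K), by positivity, fun v =>
    ⟨∑ i, |b.repr v i| * L i, Finset.sum_nonneg fun i _ => mul_nonneg (abs_nonneg _) (hL i),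
      ?_, ?_, ?_⟩⟩
  · refine (Finset.sum_mul_sq_le_sq_mul_sq _ _ _).trans ?_
    rw [mul_comm, mul_assoc]
    refine mul_le_mul_of_nonneg_left ?_ (Finset.sum_nonneg fun i _ => sq_nonneg _)
    refine (Finset.sum_le_card_nsmul _ _ (K * M.pair v v) fun i _ => ?_).trans ?_
    · rw [sq_abs]; exact hb v i
    · simp [mul_assoc]
  all_goals
    have hv : ∀ x, v.1 x = ∑ i, b.repr v i * (b i).1 x := fun x => by
      refine (congrArg (fun g : M.V => g.1 x) (b.sum_repr v).symm).trans ?_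
      simp only [Submodule.coe_sum, Finset.sum_apply, Submodule.coe_smul, Pi.smul_apply,
        smul_eq_mul]
  · intro x hx
    rw [hv]
    refine (Finset.abs_sum_le_sum_abs _ _).trans (Finset.sum_le_sum fun i _ => ?_)
    rw [abs_mul]
    exact mul_le_mul_of_nonneg_left (hbd i x hx) (abs_nonneg _)
  · intro x hx y hy
    rw [hv, hv, ← Finset.sum_sub_distrib, Finset.sum_mul]
    refine (Finset.abs_sum_le_sum_abs _ _).trans (Finset.sum_le_sum fun i _ => ?_)
    rw [← mul_sub, abs_mul, mul_assoc]
    exact mul_le_mul_of_nonneg_left (hlip i x hx y hy) (abs_nonneg _)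

theorem pair_le_hHalfSq (v : M.V) : M.pair v v ≤ hHalfSq D v.1 := by
  rw [pair_self_eq, hHalfSq, add_assoc]
  refine le_add_of_nonneg_right (add_nonneg ?_ ?_)
  · exact integral_nonneg fun x => integral_nonneg fun y => by positivity
  · exact integral_nonneg fun x => div_nonneg (sq_nonneg _) Metric.infDist_nonneg

/-- A Lipschitz constant bounds the Gagliardo quotient pointwise, and because `v` vanishes at the
end points of `Γ` it bounds the weighted term as well. All integrands are thus bounded on a set of
finite length. -/
theorem exists_hHalfSq_le : ∃ K, 0 ≤ K ∧ ∀ v : M.V, hHalfSq D v.1 ≤ K * M.pair v v := by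
  obtain ⟨K, hK, hKv⟩ := M.exists_lipschitz_V
  let μ : Measure Plane := Measure.hausdorffMeasure 1
  let m := μ.real D.Γ
  have hm : 0 ≤ m := measureReal_nonneg
  have hfin : μ D.Γ < ∞ := M.measure_Γ_lt_top
  have hint : ∀ {φ : Plane → ℝ} {C : ℝ}, (∀ x ∈ D.Γ, ‖φ x‖ ≤ C) → ∫ x in D.Γ, φ x ∂μ ≤ C * m :=
    fun h => (le_abs_self _).trans (norm_setIntegral_le_of_norm_le_const hfin h)
  let R := Metric.diam D.Γ
  have hR : 0 ≤ R := Metric.diam_nonneg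
  refine ⟨(m + m * m + R * m) * K, by positivity, fun v => ?_⟩
  obtain ⟨L, hL, hLK, hbd, hlip⟩ := hKv v
  have h1 : ∫ x in D.Γ, v.1 x ^ 2 ∂μ ≤ L ^ 2 * m := hint fun x hx => by
    rw [Real.norm_eq_abs, abs_pow]
    exact pow_le_pow_left₀ (abs_nonneg _) (hbd x hx) 2
  have h2 : ∫ x in D.Γ, ∫ y in D.Γ, (v.1 x - v.1 y) ^ 2 / dist x y ^ 2 ∂μ ∂μ ≤ L ^ 2 * m * m :=
    hint fun x hx => by
      rw [Real.norm_of_nonneg (integral_nonneg fun y => by positivity)]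
      refine hint fun y hy => ?_
      rw [Real.norm_of_nonneg (by positivity)]
      -- This covers the diagonal too, where the quotient is 0/0 = 0.
      refine div_le_of_le_mul₀ (sq_nonneg _) (sq_nonneg _) ?_
      rw [← mul_pow, ← sq_abs]
      exact pow_le_pow_left₀ (abs_nonneg _) (hlip x hx y hy) 2
  have h3 : ∫ x in D.Γ, v.1 x ^ 2 / Metric.infDist x (D.Γ ∩ frontier D.Ω) ∂μ ≤ L ^ 2 * R * m :=
    hint fun x hx => by
      rcases (D.Γ ∩ frontier D.Ω).eq_empty_or_nonempty with he | hne
      · rw [he, Metric.infDist_empty, div_zero, norm_zero]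
        positivity
      have hv0 : ∀ p ∈ D.Γ ∩ frontier D.Ω, v.1 p = 0 := fun p hp => by
        obtain ⟨w, rfl⟩ := M.trace_surjective v
        refine (restr_of_mem hp.1 w.1).trans (w.2.2.1 p ?_)
        have := hp.2
        rw [D.isOpen_Ω.frontier_eq] at this
        exact this.2
      have hle : |v.1 x| ≤ L * Metric.infDist x (D.Γ ∩ frontier D.Ω) := by
        rcases hL.eq_or_lt with hL0 | hL0
        · rw [← hL0, zero_mul, hL0]
          exact hbd x hx
        · rw [← div_le_iff₀' hL0, Metric.le_infDist hne]
          intro p hp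
          rw [div_le_iff₀' hL0]
          have := hlip x hx p hp.1
          rwa [hv0 p hp, sub_zero] at this
      have hdR : Metric.infDist x (D.Γ ∩ frontier D.Ω) ≤ R := by
        obtain ⟨p, hp⟩ := hne
        exact (Metric.infDist_le_dist_of_mem hp).trans
          (Metric.dist_le_diam_of_mem M.isCompact_Γ.isBounded hx hp.1)
      have hd0 : 0 ≤ Metric.infDist x (D.Γ ∩ frontier D.Ω) := Metric.infDist_nonneg
      rw [Real.norm_of_nonneg (div_nonneg (sq_nonneg _) hd0)]
      refine div_le_of_le_mul₀ hd0 (by positivity) ?_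
      calc v.1 x ^ 2 = |v.1 x| ^ 2 := (sq_abs _).symm
        _ ≤ (L * Metric.infDist x (D.Γ ∩ frontier D.Ω)) ^ 2 :=
          pow_le_pow_left₀ (abs_nonneg _) hle 2
        _ = L ^ 2 * Metric.infDist x (D.Γ ∩ frontier D.Ω) *
            Metric.infDist x (D.Γ ∩ frontier D.Ω) := by ring
        _ ≤ L ^ 2 * R * Metric.infDist x (D.Γ ∩ frontier D.Ω) := by gcongr
  calc hHalfSq D v.1 ≤ L ^ 2 * m + L ^ 2 * m * m + L ^ 2 * R * m :=
        add_le_add (add_le_add h1 h2) h3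
    _ = (m + m * m + R * m) * L ^ 2 := by ring
    _ ≤ (m + m * m + R * m) * (K * M.pair v v) := mul_le_mul_of_nonneg_left hLK (by positivity)
    _ = (m + m * m + R * m) * K * M.pair v v := by ring

theorem exists_normEquiv : ∃ c C : Fin 2 → ℝ, M.NormEquiv c C := by
  obtain ⟨K, hK, hKv⟩ := M.exists_hHalfSq_le
  choose A hA hAv using fun i => exists_form_le M.pair M.pair_comm M.pair_pos (M.schurForm i)
  choose B hB hBv using fun i =>
    exists_form_le (M.schurForm i) (M.schurForm_comm i) (M.schurForm_pos i) M.pair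
  -- Adding 1 avoids division by zero. The maximum secures `c i ≤ C i`, which the inequalities alone
  -- would not give on the zero space.
  refine ⟨fun i => 1 / (A i + 1), fun i => max (K * B i) (1 / (A i + 1)), fun i =>
    ⟨div_pos one_pos (by linarith [hA i]), le_max_right _ _, fun v => ⟨?_, ?_⟩⟩⟩
  · rw [← schurForm_self_eq, one_div_mul_eq_div, div_le_iff₀ (by linarith [hA i])]
    have h0 := M.pair_self_nonneg v
    have h1 := mul_le_mul_of_nonneg_right (M.pair_le_hHalfSq v) (by linarith [hA i] : 0 ≤ A i + 1)
    linarith [hAv i v]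
  · have h0 : 0 ≤ M.schurForm i v v := M.energy_self_nonneg i _
    rw [← schurForm_self_eq]
    refine (hKv v).trans ((mul_le_mul_of_nonneg_left (hBv i v) hK).trans ?_)
    rw [← mul_assoc]
    exact mul_le_mul_of_nonneg_right (le_max_left _ _) h0

end Triangulation

namespace Triangulation

variable {D : Decomposition} (M : Triangulation D)

theorem V_ext {g g' : M.V} (h : EqOn g.1 g'.1 D.Γ) : g = g' := by
  have e : ∀ g : M.V, restr D.Γ g.1 = g.1 := fun g => by
    obtain ⟨w, rfl⟩ := M.trace_surjective g
    exact restr_restr_of_subset Subset.rfl w.1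
  refine Subtype.ext ?_
  rw [← e g, ← e g', restr_eq_iff.2 h]

/-! ### The global problem -/

/-- The bilinear form of the global problem. -/
noncomputable def globalForm (ν : Fin 2 → ℝ) : M.W →ₗ[ℝ] M.W →ₗ[ℝ] ℝ :=
  ν 0 • (M.energy 0).compl₁₂ (M.toSub 0) (M.toSub 0) +
    ν 1 • (M.energy 1).compl₁₂ (M.toSub 1) (M.toSub 1)

theorem globalForm_apply (ν : Fin 2 → ℝ) (u v : M.W) : M.globalForm ν u v =
    ν 0 * M.energy 0 (M.toSub 0 u) (M.toSub 0 v) + ν 1 * M.energy 1 (M.toSub 1 u) (M.toSub 1 v) :=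
  rfl

theorem form_eq_energy_toSub (ν : Fin 2 → ℝ) (i : Fin 2) (u v : M.W) :
    form D ν i u.1 v.1 = ν i * M.energy i (M.toSub i u) (M.toSub i v) := by
  rw [← form_eq_energy]
  exact (form_congr D ν i (eqOn_restr_sub D i u.1) (eqOn_restr_sub D i v.1)).symm

theorem load_toSub (f : Plane → ℝ) (i : Fin 2) (v : M.W) :
    load D f i (M.toSub i v).1 = load D f i v.1 := load_congr D f i (eqOn_restr_sub D i v.1)

theorem globalForm_definite {ν : Fin 2 → ℝ} (hν : ∀ i, 0 < ν i) (u : M.W)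
    (h : M.globalForm ν u u = 0) : u = 0 := by
  rw [globalForm_apply] at h
  have hn : ∀ i, 0 ≤ ν i * M.energy i (M.toSub i u) (M.toSub i u) := fun i =>
    mul_nonneg (hν i).le (M.energy_self_nonneg i _)
  have h0 : ∀ i, M.energy i (M.toSub i u) (M.toSub i u) = 0 := fun i => by
    have : ν i * M.energy i (M.toSub i u) (M.toSub i u) = 0 := by
      have h0 := hn 0
      have h1 := hn 1
      fin_cases i
      · change ν 0 * M.energy 0 (M.toSub 0 u) (M.toSub 0 u) = 0
        linarith
      · change ν 1 * M.energy 1 (M.toSub 1 u) (M.toSub 1 u) = 0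
        linarith
    exact (mul_eq_zero.1 this).resolve_left (hν i).ne'
  refine Subtype.ext (funext fun x => ?_)
  by_cases hx : x ∈ D.Ω
  · obtain ⟨i, hi⟩ := D.mem_closure_sub (subset_closure hx)
    have := congrArg (fun v : M.WSub i => v.1 x) (M.energy_definite i _ (h0 i))
    exact (restr_of_mem hi u.1).symm.trans this
  · exact u.2.2.1 x hx

theorem solvesGlobal_iff (ν : Fin 2 → ℝ) {f : Plane → ℝ} (hf : IntegrableOn f D.Ω) (u : M.W) :
    M.SolvesGlobal ν f u ↔
      M.globalForm ν u = M.loadL hf 0 ∘ₗ M.toSub 0 + M.loadL hf 1 ∘ₗ M.toSub 1 := by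
  rw [LinearMap.ext_iff]
  have e : ∀ v : M.W, (M.loadL hf 0 ∘ₗ M.toSub 0 + M.loadL hf 1 ∘ₗ M.toSub 1) v =
      load D f 0 v.1 + load D f 1 v.1 := fun v => by
    rw [← load_toSub, ← load_toSub]
    rfl
  simp only [e, globalForm_apply, ← form_eq_energy_toSub]
  exact ⟨fun h v => h v.1 v.2, fun h v hv => h ⟨v, hv⟩⟩

theorem existsUnique_solvesGlobal {ν : Fin 2 → ℝ} (hν : ∀ i, 0 < ν i) {f : Plane → ℝ}
    (hf : IntegrableOn f D.Ω) : ∃! u : M.W, M.SolvesGlobal ν f u := by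
  simp only [M.solvesGlobal_iff ν hf]
  exact (bijective_of_definite _ (M.globalForm_definite hν)).existsUnique _

/-- `U` are the restrictions of the solution to the subdomains, `l` is its discrete conormal
derivative on the interface with respect to `Ω₁`, and `g` is its trace. -/
structure IsReference (ν : Fin 2 → ℝ) (f : Plane → ℝ) (U : ∀ i, M.WSub i) (g l : M.V) : Prop where
  trace_eq : ∀ i, M.subTrace i (U i) = g
  flux_zero : ∀ v : M.WSub 0,
    ν 0 * M.energy 0 (U 0) v - load D f 0 v.1 = M.pair l (M.subTrace 0 v)
  flux_one : ∀ v : M.WSub 1,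
    ν 1 * M.energy 1 (U 1) v - load D f 1 v.1 = M.pair (-l) (M.subTrace 1 v)

/-- A pair of test functions with equal traces glues to a global one, so the residuals of the two
subdomains cancel on it. Fixing one member of the pair shows that each residual depends only on the
trace of its test function; one `l` then represents both, with opposite signs. -/
theorem exists_isReference {ν : Fin 2 → ℝ} {f : Plane → ℝ} (hf : IntegrableOn f D.Ω) {u : M.W}
    (hu : M.SolvesGlobal ν f u) :
    ∃ l, M.IsReference ν f (fun i => M.toSub i u) (M.trace u) l := by
  have hglob : ∀ v : M.W, (ν 0 * M.energy 0 (M.toSub 0 u) (M.toSub 0 v) - load D f 0 (M.toSub 0 v).1)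
      + (ν 1 * M.energy 1 (M.toSub 1 u) (M.toSub 1 v) - load D f 1 (M.toSub 1 v).1) = 0 := fun v => by
    have := hu v.1 v.2
    rw [form_eq_energy_toSub, form_eq_energy_toSub, ← load_toSub, ← load_toSub] at this
    linarith
  have hpair : ∀ (v₀ : M.WSub 0) (v₁ : M.WSub 1), M.subTrace 0 v₀ = M.subTrace 1 v₁ →
      (ν 0 * M.energy 0 (M.toSub 0 u) v₀ - load D f 0 v₀.1)
        + (ν 1 * M.energy 1 (M.toSub 1 u) v₁ - load D f 1 v₁.1) = 0 := fun v₀ v₁ h => by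
    obtain ⟨w, hw, -⟩ := M.exists_glue (Fin.cons v₀ (Fin.cons v₁ finZeroElim)) (M.subTrace 0 v₀)
      (fun i => by
        fin_cases i
        · rfl
        · exact h.symm)
    have h0 : M.toSub 0 w = v₀ := hw 0
    have h1 : M.toSub 1 w = v₁ := hw 1
    have := hglob w
    rwa [h0, h1] at this
  let φ : M.V →ₗ[ℝ] ℝ := (ν 0 • M.energy 0 (M.toSub 0 u) - M.loadL hf 0) ∘ₗ M.harmonicExt 0
  have hφ : ∀ h, φ h = ν 0 * M.energy 0 (M.toSub 0 u) (M.harmonicExt 0 h) -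
      load D f 0 (M.harmonicExt 0 h).1 := fun h => rfl
  obtain ⟨l, hl⟩ := (bijective_of_definite M.pair M.pair_definite).2 φ
  have hone : ∀ v : M.WSub 1,
      ν 1 * M.energy 1 (M.toSub 1 u) v - load D f 1 v.1 = M.pair (-l) (M.subTrace 1 v) :=
    fun v => by
      have := hpair (M.harmonicExt 0 (M.subTrace 1 v)) v (M.subTrace_harmonicExt 0 _)
      rw [map_neg, LinearMap.neg_apply, hl, hφ]
      linarith
  refine ⟨l, fun i => M.subTrace_toSub i u, fun v => ?_, hone⟩
  have h1 := hpair v (M.harmonicExt 1 (M.subTrace 0 v)) (M.subTrace_harmonicExt 1 _).symm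
  have h2 := hone (M.harmonicExt 1 (M.subTrace 0 v))
  rw [subTrace_harmonicExt, map_neg, LinearMap.neg_apply] at h2
  linarith

/-! ### Local solves -/

theorem solvesDirichlet_congr {ν : Fin 2 → ℝ} {f : Plane → ℝ} {i : Fin 2} {g g' u : Plane → ℝ}
    (h : EqOn g g' D.Γ) : M.SolvesDirichlet ν f i g u ↔ M.SolvesDirichlet ν f i g' u :=
  and_congr_right fun _ => and_congr_right fun _ => and_congr_right fun _ =>
    ⟨fun H => H.trans h, fun H => H.trans h.symm⟩

theorem solvesDirichlet_zero_iff {ν : Fin 2 → ℝ} (hν : ∀ i, 0 < ν i) {i : Fin 2} {g : M.V}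
    {u : M.WSub i} : M.SolvesDirichlet ν 0 i g.1 u.1 ↔ u = M.harmonicExt i g := by
  rw [solvesDirichlet_iff]
  simp only [load_zero, mul_eq_zero, (hν i).ne', false_or]
  constructor
  · rintro ⟨rfl, h⟩
    exact M.eq_harmonicExt h
  · rintro rfl
    exact ⟨M.subTrace_harmonicExt i g, fun z hz => M.energy_harmonicExt g hz⟩

theorem energy_harmonicExt_eq (ν : Fin 2 → ℝ) (i : Fin 2) (g : M.V) (t : M.WSub i) :
    ν i * M.energy i (M.harmonicExt i g) t = M.pair (M.S ν i g) (M.subTrace i t) := by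
  rw [pair_S, energy_harmonicExt_left, schurForm_apply]

/-- Tests of zero trace show that `w` is discrete harmonic; what remains is that `M.S ν i` maps its
trace to `r`. Invertibility of `M.S ν i` means that no compatibility condition arises. -/
theorem neumann_iff {ν : Fin 2 → ℝ} (hν : ∀ i, 0 < ν i) {i : Fin 2} {w : M.WSub i} {r : M.V} :
    (∀ v, ν i * M.energy i w v = M.pair r (M.subTrace i v)) ↔
      w = M.harmonicExt i (M.SInv ν i r) := by
  constructor
  · intro h
    have hw : w = M.harmonicExt i (M.subTrace i w) := M.eq_harmonicExt fun z hz => by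
      have := h z
      rw [hz, map_zero, mul_eq_zero] at this
      exact this.resolve_left (hν i).ne'
    have hS : M.S ν i (M.subTrace i w) = r := M.pair_ext fun v => by
      have := h (M.harmonicExt i v)
      rw [subTrace_harmonicExt] at this
      rw [← this]
      conv_rhs => rw [hw]
      rw [energy_harmonicExt_eq, subTrace_harmonicExt]
    rw [← hS, M.SInv_S hν]
    exact hw
  · rintro rfl v
    rw [energy_harmonicExt_eq, M.S_SInv hν]

variable {M} {ν : Fin 2 → ℝ} {f : Plane → ℝ} {U : ∀ i, M.WSub i} {g₀ l₀ : M.V}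

/-- The sign of the flux out of `Ωᵢ`. -/
def fluxSign (i : Fin 2) : ℝ := if i = 0 then 1 else -1

theorem IsReference.flux (h : M.IsReference ν f U g₀ l₀) (i : Fin 2) (v : M.WSub i) :
    ν i * M.energy i (U i) v - load D f i v.1 = M.pair (fluxSign i • l₀) (M.subTrace i v) := by
  fin_cases i
  · simpa [fluxSign] using h.flux_zero v
  · simpa [fluxSign] using h.flux_one v

/-- The solve and the reference satisfy the same equation against tests of zero trace, so the source
drops out and their difference is discrete harmonic. -/
theorem IsReference.solvesDirichlet_iff (hν : ∀ i, 0 < ν i) (h : M.IsReference ν f U g₀ l₀)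
    {i : Fin 2} {g : M.V} {u : M.WSub i} :
    M.SolvesDirichlet ν f i g.1 u.1 ↔ u = U i + M.harmonicExt i (g - g₀) := by
  have hz : ∀ z, M.subTrace i z = 0 → ν i * M.energy i (U i) z = load D f i z.1 := fun z hz => by
    have := h.flux i z
    rw [hz, map_zero] at this
    linarith
  rw [Triangulation.solvesDirichlet_iff]
  constructor
  · rintro ⟨rfl, H⟩
    rw [← h.trace_eq i, ← map_sub, ← sub_eq_iff_eq_add']
    refine M.eq_harmonicExt fun z hz' => ?_
    have : ν i * (M.energy i (u - U i) z) = 0 := by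
      rw [map_sub, LinearMap.sub_apply, mul_sub, H z hz', hz z hz', sub_self]
    exact (mul_eq_zero.1 this).resolve_left (hν i).ne'
  · rintro rfl
    refine ⟨by rw [map_add, h.trace_eq, subTrace_harmonicExt, add_sub_cancel], fun z hz' => ?_⟩
    rw [map_add, LinearMap.add_apply, M.energy_harmonicExt _ hz', add_zero, hz z hz']

theorem IsReference.neumann_iff (hν : ∀ i, 0 < ν i) (h : M.IsReference ν f U g₀ l₀)
    {i : Fin 2} {u : M.WSub i} {r : M.V} :
    (∀ v : M.WSub i, form D ν i u.1 v.1 = load D f i v.1 + M.pair r (M.subTrace i v)) ↔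
      u = U i + M.harmonicExt i (M.SInv ν i (r - fluxSign i • l₀)) := by
  rw [← sub_eq_iff_eq_add', ← Triangulation.neumann_iff M hν]
  refine forall_congr' fun v => ?_
  have := h.flux i v
  rw [form_eq_energy, map_sub, LinearMap.sub_apply, map_sub, LinearMap.sub_apply, mul_sub]
  constructor <;> intro <;> linarith

theorem IsReference.residual (h : M.IsReference ν f U g₀ l₀) (i : Fin 2) (e : M.V)
    (v : M.WSub i) :
    form D ν i (U i + M.harmonicExt i e).1 v.1 - load D f i v.1 =
      M.pair (fluxSign i • l₀ + M.S ν i e) (M.subTrace i v) := by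
  rw [form_eq_energy, map_add, LinearMap.add_apply, mul_add, energy_harmonicExt_eq,
    map_add M.pair, LinearMap.add_apply, ← h.flux]
  ring

theorem fluxSign_sum : fluxSign 0 + fluxSign 1 = 0 := by simp [fluxSign]

theorem fluxSign_add {d n : Fin 2} (h : d ≠ n) : fluxSign d + fluxSign n = 0 := by
  fin_cases d <;> fin_cases n <;> simp_all [fluxSign]

/-! ### The error operators of the iterations -/

/-- The reference fluxes cancel, so the flux residual of the Dirichlet solves is `r`, the sum of the
Schur complements applied to the error. The Neumann solves apply the inverses to the weighted `r`.
Unique solvability of each local problem gives both directions. -/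
theorem nnStep_iff (hν : ∀ i, 0 < ν i) (h : M.IsReference ν f U g₀ l₀) (δ : Fin 2 → ℝ) (θ : ℝ)
    (g g' : M.V) :
    M.NNStep ν f δ θ g g' ↔ g' - g₀ = M.nnError ν δ θ (g - g₀) := by
  let r : M.V := M.S ν 0 (g - g₀) + M.S ν 1 (g - g₀)
  have hr : ∀ t : ∀ j, M.WSub j, ∀ v : M.V, (∀ j, M.subTrace j (t j) = v) →
      ∑ j, (form D ν j (U j + M.harmonicExt j (g - g₀)).1 (t j).1 - load D f j (t j).1) =
        M.pair r v := fun t v ht => by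
    rw [Fin.sum_univ_two, h.residual, h.residual, ht, ht, ← LinearMap.add_apply, ← map_add]
    congr 2
    rw [add_add_add_comm, ← add_smul, fluxSign_sum, zero_smul, zero_add]
  have hw : ∀ i (w : M.WSub i), (∀ v : M.WSub i, ∀ t : ∀ j, M.WSub j,
      (∀ j, M.subTrace j (t j) = M.subTrace i v) → form D ν i w.1 v.1 = δ i *
        ∑ j, (form D ν j (U j + M.harmonicExt j (g - g₀)).1 (t j).1 - load D f j (t j).1)) ↔
      w = M.harmonicExt i (M.SInv ν i (δ i • r)) := fun i w => by
    rw [← neumann_iff M hν]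
    refine forall_congr' fun v => ?_
    simp only [map_smul, LinearMap.smul_apply, smul_eq_mul, form_eq_energy M ν i w v]
    constructor
    · intro H
      rw [H (fun j => M.harmonicExt j (M.subTrace i v)) fun j => M.subTrace_harmonicExt j _,
        hr _ _ fun j => M.subTrace_harmonicExt j _]
    · intro H t ht
      rw [H, hr t _ ht]
  have hop : M.nnError ν δ θ (g - g₀) = g - g₀ -
      θ • (δ 0 • M.SInv ν 0 (δ 0 • r) + δ 1 • M.SInv ν 1 (δ 1 • r)) := by
    simp [nnError, nnOperator, scaling, r]
  rw [hop, sub_right_comm, sub_left_inj]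
  constructor
  · rintro ⟨u, w, hu, hw', hg'⟩
    have hu' : ∀ i, u i = (U i + M.harmonicExt i (g - g₀)).1 := fun i =>
      congrArg Subtype.val ((h.solvesDirichlet_iff hν (u := ⟨u i, (hu i).1⟩)).1 (hu i))
    obtain rfl : u = fun i => (U i + M.harmonicExt i (g - g₀)).1 := funext hu'
    have hwi : ∀ i, w i = (M.harmonicExt i (M.SInv ν i (δ i • r))).1 := fun i =>
      congrArg Subtype.val ((hw i ⟨w i, (hw' i).1⟩).1 fun v t ht =>
        (hw' i).2 v.1 v.2 (fun j => (t j).1) fun j =>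
          ⟨(t j).2, M.subTrace_eq_subTrace_iff.1 (ht j)⟩)
    refine M.V_ext fun x hx => (hg' x hx).trans ?_
    have hx' : ∀ i, w i x = (M.SInv ν i (δ i • r)).1 x := fun i => by
      rw [hwi]
      exact M.subTrace_eq_iff.1 (M.subTrace_harmonicExt i _) hx
    rw [hx', hx']
    rfl
  · rintro rfl
    refine ⟨fun i => (U i + M.harmonicExt i (g - g₀)).1,
      fun i => (M.harmonicExt i (M.SInv ν i (δ i • r))).1,
      fun i => (h.solvesDirichlet_iff hν).2 rfl, fun i => ⟨(M.harmonicExt i _).2, ?_⟩, ?_⟩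
    · intro v hv t ht
      exact (hw i _).2 rfl ⟨v, hv⟩ (fun j => ⟨t j, (ht j).1⟩) fun j =>
        M.subTrace_eq_subTrace_iff.2 (ht j).2
    · intro x hx
      have hx' : ∀ i, (M.harmonicExt i (M.SInv ν i (δ i • r))).1 x =
          (M.SInv ν i (δ i • r)).1 x := fun i =>
        M.subTrace_eq_iff.1 (M.subTrace_harmonicExt i _) hx
      simp only [hx']
      rfl

/-- Dual to N-N: the Neumann solves with fluxes `l` and `-l` have trace errors S₀⁻¹(l - l₀) and
-S₁⁻¹(l - l₀). Their jump is `r`, which the Dirichlet solves turn back into fluxes. -/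
theorem ddStep_iff (hν : ∀ i, 0 < ν i) (h : M.IsReference ν f U g₀ l₀) (δ : Fin 2 → ℝ) (θ : ℝ)
    (l l' : M.V) :
    M.DDStep ν f δ θ l l' ↔ l' - l₀ = M.ddError ν δ θ (l - l₀) := by
  let r : M.V := M.SInv ν 0 (l - l₀) + M.SInv ν 1 (l - l₀)
  let u₀ : M.WSub 0 := U 0 + M.harmonicExt 0 (M.SInv ν 0 (l - l₀))
  let u₁ : M.WSub 1 := U 1 - M.harmonicExt 1 (M.SInv ν 1 (l - l₀))
  have h0 : ∀ u : M.WSub 0, (∀ v ∈ M.WSub 0, form D ν 0 u.1 v = load D f 0 v + pairing D l.1 v) ↔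
      u = u₀ := fun u => by
    have := h.neumann_iff hν (u := u) (r := l)
    simp only [fluxSign, if_true, one_smul] at this
    rw [← this]
    simp only [Subtype.forall', pairing_subTrace]
  have h1 : ∀ u : M.WSub 1, (∀ v ∈ M.WSub 1, form D ν 1 u.1 v =
      load D f 1 v + pairing D (-l).1 v) ↔ u = u₁ := fun u => by
    have := h.neumann_iff hν (u := u) (r := -l)
    have e : -l - fluxSign 1 • l₀ = -(l - l₀) := by
      simp only [fluxSign, one_ne_zero, if_false]
      module
    rw [e, map_neg (M.SInv ν 1), map_neg (M.harmonicExt 1), ← sub_eq_add_neg] at this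
    rw [← this]
    simp only [Subtype.forall', pairing_subTrace]
  have hg : ∀ i, EqOn (fun x => δ i * (u₀.1 x - u₁.1 x)) (δ i • r).1 D.Γ := fun i x hx => by
    have e : M.subTrace 0 u₀ - M.subTrace 1 u₁ = r := by
      simp only [u₀, u₁, r, map_add, map_sub, h.trace_eq, subTrace_harmonicExt]
      abel
    have e0 := M.subTrace_eq_iff.1 (rfl : M.subTrace 0 u₀ = _) hx
    have e1 := M.subTrace_eq_iff.1 (rfl : M.subTrace 1 u₁ = _) hx
    change δ i * (u₀.1 x - u₁.1 x) = δ i * r.1 x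
    rw [e0, e1, ← e]
    rfl
  have hw : ∀ i (w : M.WSub i), M.SolvesDirichlet ν 0 i (fun x => δ i * (u₀.1 x - u₁.1 x)) w.1 ↔
      w = M.harmonicExt i (δ i • r) := fun i w => by
    rw [M.solvesDirichlet_congr (hg i), M.solvesDirichlet_zero_iff hν]
  have hq : ∀ i (q : M.V), (∀ v ∈ M.WSub i, pairing D q.1 v =
      form D ν i (M.harmonicExt i (δ i • r)).1 v) ↔ q = M.S ν i (δ i • r) := fun i q => by
    simp only [Subtype.forall', pairing_subTrace, form_eq_energy, energy_harmonicExt_eq]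
    refine ⟨fun H => M.pair_ext fun v => ?_, fun H v => by rw [H]⟩
    obtain ⟨t, rfl⟩ := M.subTrace_surjective i v
    exact H t
  have hop : M.ddError ν δ θ (l - l₀) = l - l₀ -
      θ • (δ 0 • M.S ν 0 (δ 0 • r) + δ 1 • M.S ν 1 (δ 1 • r)) := by
    simp only [ddError, ddOperator, scaling, r, LinearMap.sub_apply, Module.End.one_apply,
      LinearMap.smul_apply, Module.End.mul_apply, LinearMap.add_apply]
  rw [hop, sub_right_comm, sub_left_inj]
  constructor
  · rintro ⟨u, w, q, hu0, hu1, hw', hq', rfl⟩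
    have hu0' : u 0 = u₀.1 := congrArg Subtype.val ((h0 ⟨u 0, hu0.1⟩).1 hu0.2)
    have hu1' : u 1 = u₁.1 := congrArg Subtype.val ((h1 ⟨u 1, hu1.1⟩).1 hu1.2)
    rw [hu0', hu1'] at hw'
    have hwi : ∀ i, w i = (M.harmonicExt i (δ i • r)).1 := fun i =>
      congrArg Subtype.val ((hw i ⟨w i, (hw' i).1⟩).1 (hw' i))
    have hqi : ∀ i, q i = M.S ν i (δ i • r) := fun i => (hq i _).1 fun v hv => by
      rw [← hwi]
      exact hq' i v hv
    rw [hqi, hqi]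
  · rintro rfl
    refine ⟨Fin.cons u₀.1 (Fin.cons u₁.1 finZeroElim), fun i => (M.harmonicExt i (δ i • r)).1,
      fun i => M.S ν i (δ i • r), ⟨u₀.2, (h0 u₀).2 rfl⟩, ⟨u₁.2, (h1 u₁).2 rfl⟩,
      fun i => (hw i _).2 rfl, fun i => (hq i _).2 rfl, rfl⟩

/-- The Neumann solve has trace error -Sₙ⁻¹S_d e, and Sₙ⁻¹(S₀ + S₁)e = Sₙ⁻¹S_d e + e converts the
relaxed step into the error operator. -/
theorem dnStep_iff (hν : ∀ i, 0 < ν i) (h : M.IsReference ν f U g₀ l₀) (θ : ℝ) {d n : Fin 2}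
    (hdn : d ≠ n) (g g' : M.V) :
    M.DNStep ν f θ d n g g' ↔ g' - g₀ = M.dnError ν n θ (g - g₀) := by
  let e : M.V := g - g₀
  let ud : M.WSub d := U d + M.harmonicExt d e
  let un : M.WSub n := U n - M.harmonicExt n (M.SInv ν n (M.S ν d e))
  have hn : ∀ u : M.WSub n, (∀ v ∈ M.WSub n, ∀ t ∈ M.WSub d, EqOn t v D.Γ →
      form D ν n u.1 v = load D f n v + load D f d t - form D ν d ud.1 t) ↔ u = un := fun u => by
    have key := h.neumann_iff hν (u := u) (r := -(fluxSign d • l₀ + M.S ν d e))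
    have e1 : -(fluxSign d • l₀ + M.S ν d e) - fluxSign n • l₀ = -M.S ν d e := by
      have : fluxSign d • l₀ + fluxSign n • l₀ = 0 := by
        rw [← add_smul, fluxSign_add hdn, zero_smul]
      rw [← sub_eq_zero, ← neg_eq_zero, ← this]
      abel
    rw [e1, map_neg (M.SInv ν n), map_neg (M.harmonicExt n), ← sub_eq_add_neg] at key
    rw [← key, Subtype.forall']
    refine forall_congr' fun v => ?_
    have hres : ∀ t : M.WSub d, M.subTrace d t = M.subTrace n v →
        load D f n v.1 + load D f d t.1 - form D ν d ud.1 t.1 = load D f n v.1 +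
          M.pair (-(fluxSign d • l₀ + M.S ν d e)) (M.subTrace n v) := fun t ht => by
      have := h.residual d e t
      rw [ht] at this
      rw [map_neg, LinearMap.neg_apply, ← this]
      ring
    constructor
    · intro H
      rw [← hres (M.harmonicExt d (M.subTrace n v)) (M.subTrace_harmonicExt d _)]
      exact H _ (M.harmonicExt d _).2
        (M.subTrace_eq_subTrace_iff.1 (M.subTrace_harmonicExt d _))
    · intro H t ht htv
      have htv' : M.subTrace d ⟨t, ht⟩ = M.subTrace n v := M.subTrace_eq_subTrace_iff.2 htv
      rw [H, ← hres _ htv']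
  have hx : ∀ x ∈ D.Γ, un.1 x = (g₀ - M.SInv ν n (M.S ν d e)).1 x := fun x hx =>
    M.subTrace_eq_iff.1 (by rw [map_sub, h.trace_eq, subTrace_harmonicExt]) hx
  have hop : M.dnError ν n θ e =
      θ • (g₀ - M.SInv ν n (M.S ν d e)) + (1 - θ) • g - g₀ := by
    have e2 : M.SInv ν n (M.S ν 0 e + M.S ν 1 e) = M.SInv ν n (M.S ν d e) + e := by
      have : M.S ν 0 e + M.S ν 1 e = M.S ν d e + M.S ν n e := by
        fin_cases d <;> fin_cases n <;> first | exact absurd rfl hdn | rfl | exact add_comm _ _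
      rw [this, map_add, M.SInv_S hν]
    simp only [dnError, LinearMap.sub_apply, Module.End.one_apply,
      LinearMap.smul_apply, Module.End.mul_apply, LinearMap.add_apply, e2]
    simp only [e]
    module
  change _ ↔ g' - g₀ = M.dnError ν n θ e
  rw [hop, sub_left_inj]
  constructor
  · rintro ⟨u, w, hu, ⟨hw, hw'⟩, hg'⟩
    obtain rfl : u = ud.1 :=
      congrArg Subtype.val ((h.solvesDirichlet_iff hν (u := ⟨u, hu.1⟩)).1 hu)
    obtain rfl : w = un.1 := congrArg Subtype.val ((hn ⟨w, hw⟩).1 hw')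
    refine M.V_ext fun x hxΓ => (hg' x hxΓ).trans ?_
    rw [hx x hxΓ]
    rfl
  · rintro rfl
    refine ⟨ud.1, un.1, (h.solvesDirichlet_iff hν).2 rfl, ⟨un.2, (hn un).2 rfl⟩, fun x hxΓ => ?_⟩
    rw [hx x hxΓ]
    rfl

end Triangulation

/-! ### Scalar estimates -/

theorem IsWeight.le_one {δ : Fin 2 → ℝ} (h : IsWeight δ) (i : Fin 2) : δ i ≤ 1 := by
  have h0 := h.1 0
  have h1 := h.1 1
  have h2 := h.2
  fin_cases i
  · change δ 0 ≤ 1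
    linarith
  · change δ 1 ≤ 1
    linarith

theorem IsWeight.sq_add_sq_pos {δ : Fin 2 → ℝ} (h : IsWeight δ) : 0 < δ 0 ^ 2 + δ 1 ^ 2 := by
  nlinarith [h.2, sq_nonneg (δ 0 - δ 1)]

theorem IsWeight.rev {δ : Fin 2 → ℝ} (h : IsWeight δ) : IsWeight (fun i => δ i.rev) :=
  ⟨fun i => h.1 _, by rw [add_comm]; exact h.2⟩

/-- The eigenvalue of the N-N operator belonging to the eigenvalue `τ` of `S₁⁻¹S₂`. -/
noncomputable def weightedEigenvalue (δ : Fin 2 → ℝ) (τ : ℝ) : ℝ :=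
  δ 0 ^ 2 * (1 + τ) + δ 1 ^ 2 * (1 + τ⁻¹)

theorem weightedEigenvalue_pos {δ : Fin 2 → ℝ} (hδ : IsWeight δ) {τ : ℝ} (hτ : 0 < τ) :
    0 < weightedEigenvalue δ τ := by
  have h1 : 0 ≤ δ 0 ^ 2 * τ := by positivity
  have h2 : 0 ≤ δ 1 ^ 2 * τ⁻¹ := by positivity
  rw [weightedEigenvalue]
  linarith [hδ.sq_add_sq_pos]

section Kappa

variable {c C ν δ : Fin 2 → ℝ}

/-- Interchanging the weights exchanges the two summands; through this every D-D estimate is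
inherited from N-N. -/
theorem ddMin_eq (c C ν δ : Fin 2 → ℝ) : ddMin c C ν δ = nnMin c C ν (fun i => δ i.rev) :=
  add_comm _ _

theorem ddMax_eq (c C ν δ : Fin 2 → ℝ) : ddMax c C ν δ = nnMax c C ν (fun i => δ i.rev) :=
  add_comm _ _

theorem ddKappa_eq (c C ν δ : Fin 2 → ℝ) : ddKappa c C ν δ = nnKappa c C ν (fun i => δ i.rev) := by
  rw [ddKappa, nnKappa, ddMin_eq, ddMax_eq]

theorem div_le_div_of_normEquiv (hc : ∀ i, 0 < c i ∧ c i ≤ C i) (i j : Fin 2) :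
    c i / C j ≤ C i / c j :=
  div_le_div₀ ((hc i).1.le.trans (hc i).2) (hc i).2 (hc j).1 (hc j).2

theorem nnMin_pos (hc : ∀ i, 0 < c i ∧ c i ≤ C i) (hν : ∀ i, 0 < ν i) (hδ : IsWeight δ) :
    0 < nnMin c C ν δ := by
  have hC : ∀ i, 0 < C i := fun i => (hc i).1.trans_le (hc i).2
  have h : ∀ i j : Fin 2, 0 ≤ δ i ^ 2 * (c i / C j * (ν j / ν i)) := fun i j =>
    mul_nonneg (sq_nonneg _) (mul_nonneg (div_nonneg (hc i).1.le (hC j).le)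
      (div_nonneg (hν j).le (hν i).le))
  rw [nnMin]
  linarith [h 0 1, h 1 0, hδ.sq_add_sq_pos]

theorem nnMin_le_nnMax (hc : ∀ i, 0 < c i ∧ c i ≤ C i) (hν : ∀ i, 0 < ν i) :
    nnMin c C ν δ ≤ nnMax c C ν δ := by
  have h : ∀ i j : Fin 2, δ i ^ 2 * (1 + c i / C j * (ν j / ν i)) ≤
      δ i ^ 2 * (1 + C i / c j * (ν j / ν i)) := fun i j =>
    mul_le_mul_of_nonneg_left (add_le_add_right (mul_le_mul_of_nonneg_right
      (div_le_div_of_normEquiv hc i j) (div_nonneg (hν j).le (hν i).le)) _) (sq_nonneg _)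
  exact add_le_add (h 0 1) (h 1 0)

/-- `μ` and `μ⁻¹` are bounded separately, so the two summands of each end point may belong to
different values of `μ`. -/
theorem weightedEigenvalue_mem (hc : ∀ i, 0 < c i ∧ c i ≤ C i) (hν : ∀ i, 0 < ν i) {μ : ℝ}
    (hlo : c 0 / C 1 ≤ μ) (hhi : μ ≤ C 0 / c 1) :
    weightedEigenvalue δ (ν 1 / ν 0 * μ) ∈ Icc (nnMin c C ν δ) (nnMax c C ν δ) := by
  have hC : ∀ i, 0 < C i := fun i => (hc i).1.trans_le (hc i).2
  have hμ : 0 < μ := (div_pos (hc 0).1 (hC 1)).trans_le hlo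
  have hr : 0 < ν 1 / ν 0 := div_pos (hν 1) (hν 0)
  have hs : 0 < ν 0 / ν 1 := div_pos (hν 0) (hν 1)
  have hinv : (ν 1 / ν 0 * μ)⁻¹ = μ⁻¹ * (ν 0 / ν 1) := by rw [mul_inv, inv_div, mul_comm]
  have h1 : c 1 / C 0 ≤ μ⁻¹ := by
    rw [← inv_div]
    exact inv_anti₀ hμ hhi
  have h2 : μ⁻¹ ≤ C 1 / c 0 := by
    rw [← inv_div]
    exact inv_anti₀ (div_pos (hc 0).1 (hC 1)) hlo
  rw [weightedEigenvalue, hinv, mul_comm (ν 1 / ν 0), nnMin, nnMax]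
  constructor <;> gcongr

theorem isWeight_sqrtWeight (hν : ∀ i, 0 < ν i) : IsWeight (sqrtWeight ν) := by
  have h : ∀ i, 0 < √(ν i) := fun i => Real.sqrt_pos.2 (hν i)
  have hs : 0 < √(ν 0) + √(ν 1) := add_pos (h 0) (h 1)
  exact ⟨fun i => div_nonneg (h i).le hs.le, by
    rw [sqrtWeight, sqrtWeight, ← add_div, div_self hs.ne']⟩

theorem sqrtWeight_sq (hν : ∀ i, 0 < ν i) (i : Fin 2) :
    sqrtWeight ν i ^ 2 = ν i / (√(ν 0) + √(ν 1)) ^ 2 := by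
  rw [sqrtWeight, div_pow, Real.sq_sqrt (hν i).le]

/-- The squared weights are proportional to `ν 0` and `ν 1`, which absorbs the ratios of
coefficients. Up to a common factor, numerator and denominator become averages of two constants with
weights `ν 0`, `ν 1`, and lie between the extreme constants. -/
theorem nnKappa_sqrtWeight_le (hc : ∀ i, 0 < c i ∧ c i ≤ C i) (hν : ∀ i, 0 < ν i) :
    nnKappa c C ν (sqrtWeight ν) ≤ kappaBound c C := by
  have hC : ∀ i, 0 < C i := fun i => (hc i).1.trans_le (hc i).2
  have hmin := nnMin_pos hc hν (isWeight_sqrtWeight hν)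
  have h0 := hν 0
  have h1 := hν 1
  have hs : 0 < 1 / (√(ν 0) + √(ν 1)) ^ 2 := by
    have := Real.sqrt_pos.2 h0
    positivity
  have hdist : ∀ a b : ℝ, ν 0 / (√(ν 0) + √(ν 1)) ^ 2 * (1 + a * (ν 1 / ν 0)) +
      ν 1 / (√(ν 0) + √(ν 1)) ^ 2 * (1 + b * (ν 0 / ν 1)) =
      1 / (√(ν 0) + √(ν 1)) ^ 2 * (ν 0 * (1 + b) + ν 1 * (1 + a)) := fun a b => by
    have := Real.sqrt_pos.2 h0
    have := Real.sqrt_pos.2 h1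
    field_simp
    ring
  have hm : 0 < min (c 1 / C 0) (c 0 / C 1) := lt_min (div_pos (hc 1).1 (hC 0))
    (div_pos (hc 0).1 (hC 1))
  have hM : 0 < max (C 0 / c 1) (C 1 / c 0) := lt_max_of_lt_left (div_pos (hC 0) (hc 1).1)
  rw [nnKappa, kappaBound, div_le_div_iff₀ hmin (by linarith), nnMin, nnMax, sqrtWeight_sq hν,
    sqrtWeight_sq hν, hdist, hdist, mul_assoc,
    mul_left_comm (max (C 0 / c 1) (C 1 / c 0) + 1)]
  refine mul_le_mul_of_nonneg_left ?_ hs.le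
  have e1 : ν 0 * (1 + C 1 / c 0) + ν 1 * (1 + C 0 / c 1) ≤
      (max (C 0 / c 1) (C 1 / c 0) + 1) * (ν 0 + ν 1) := by
    have := mul_le_mul_of_nonneg_left (le_max_left (C 0 / c 1) (C 1 / c 0)) h1.le
    have := mul_le_mul_of_nonneg_left (le_max_right (C 0 / c 1) (C 1 / c 0)) h0.le
    linarith
  have e2 : (min (c 1 / C 0) (c 0 / C 1) + 1) * (ν 0 + ν 1) ≤
      ν 0 * (1 + c 1 / C 0) + ν 1 * (1 + c 0 / C 1) := by
    have := mul_le_mul_of_nonneg_left (min_le_left (c 1 / C 0) (c 0 / C 1)) h0.le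
    have := mul_le_mul_of_nonneg_left (min_le_right (c 1 / C 0) (c 0 / C 1)) h1.le
    linarith
  calc _ ≤ (max (C 0 / c 1) (C 1 / c 0) + 1) * (ν 0 + ν 1) *
        (min (c 1 / C 0) (c 0 / C 1) + 1) := mul_le_mul_of_nonneg_right e1 (by linarith)
    _ = (max (C 0 / c 1) (C 1 / c 0) + 1) * ((min (c 1 / C 0) (c 0 / C 1) + 1) * (ν 0 + ν 1)) := by
      ring
    _ ≤ _ := mul_le_mul_of_nonneg_left e2 (by linarith)

/-- For arbitrary weights `κ` is at most the product of the quotients of the constants. -/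
theorem nnKappa_le (hc : ∀ i, 0 < c i ∧ c i ≤ C i) (hν : ∀ i, 0 < ν i) (hδ : IsWeight δ) :
    nnKappa c C ν δ ≤ C 0 * C 1 / (c 0 * c 1) := by
  have hC : ∀ i, 0 < C i := fun i => (hc i).1.trans_le (hc i).2
  have hmin := nnMin_pos hc hν hδ
  have hM : 1 ≤ C 0 * C 1 / (c 0 * c 1) := by
    rw [one_le_div (mul_pos (hc 0).1 (hc 1).1)]
    exact mul_le_mul (hc 0).2 (hc 1).2 (hc 1).1.le (hC 0).le
  rw [nnKappa, div_le_iff₀ hmin]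
  have h0 := (hc 0).1
  have h1 := (hc 1).1
  -- The upper coefficient is exactly the product of quotients times the lower one; the summand 1 is
  -- harmless because that product is at least 1.
  have e : ∀ x t : ℝ, ∀ i j : Fin 2, C i / c j = C 0 * C 1 / (c 0 * c 1) * (c i / C j) →
      x ^ 2 * (1 + C i / c j * t) ≤
        C 0 * C 1 / (c 0 * c 1) * (x ^ 2 * (1 + c i / C j * t)) := fun x t i j h => by
    rw [h]
    have := mul_le_mul_of_nonneg_right hM (sq_nonneg x)
    linarith
  rw [nnMin, nnMax, mul_add (C 0 * C 1 / (c 0 * c 1))]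
  have hC0 := hC 0
  have hC1 := hC 1
  exact add_le_add (e _ _ 0 1 (by field_simp)) (e _ _ 1 0 (by field_simp))

end Kappa

/-- In the variable (t/(1 - t))² the quotient is a Möbius function, whose monotonicity is decided by
the sign of the determinant `a * b' - a' * b`. -/
theorem constOrStrict_div {a b a' b' : ℝ} (ha' : 0 < a') (hb' : 0 < b') :
    ConstOrStrict (fun t => (t ^ 2 * a + (1 - t) ^ 2 * b) / (t ^ 2 * a' + (1 - t) ^ 2 * b')) := by
  have hden : ∀ t : ℝ, 0 < t ^ 2 * a' + (1 - t) ^ 2 * b' := fun t => by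
    rcases eq_or_ne t 0 with rfl | ht
    · simpa using hb'
    · have : 0 < t ^ 2 * a' := by positivity
      have : 0 ≤ (1 - t) ^ 2 * b' := by positivity
      linarith
  have hsq : ∀ t u : ℝ, t ∈ Icc (0 : ℝ) 1 → u ∈ Icc (0 : ℝ) 1 → t < u →
      0 < u ^ 2 * (1 - t) ^ 2 - t ^ 2 * (1 - u) ^ 2 := fun t u ht hu htu => by
    have h1 : 0 < u * (1 - t) - t * (1 - u) := by linarith
    have h2 : 0 < u * (1 - t) + t * (1 - u) := by
      have h3 : 0 < u * (1 - t) := mul_pos (by linarith [ht.1]) (by linarith [hu.2])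
      have h4 : 0 ≤ t * (1 - u) := mul_nonneg ht.1 (by linarith [hu.2])
      linarith
    have := mul_pos h1 h2
    linarith
  have hdet : ∀ t u : ℝ, (u ^ 2 * a + (1 - u) ^ 2 * b) * (t ^ 2 * a' + (1 - t) ^ 2 * b') -
      (t ^ 2 * a + (1 - t) ^ 2 * b) * (u ^ 2 * a' + (1 - u) ^ 2 * b') =
      (a * b' - a' * b) * (u ^ 2 * (1 - t) ^ 2 - t ^ 2 * (1 - u) ^ 2) := fun t u => by ring
  rcases lt_trichotomy (a * b' - a' * b) 0 with h | h | h
  · refine Or.inr (Or.inr fun t ht u hu htu => ?_)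
    rw [div_lt_div_iff₀ (hden u) (hden t)]
    linarith [hdet t u, mul_neg_of_neg_of_pos h (hsq t u ht hu htu)]
  · refine Or.inl fun t _ => ?_
    rw [div_eq_div_iff (hden t).ne' (hden 0).ne']
    have := hdet 0 t
    rw [h, zero_mul] at this
    linarith
  · refine Or.inr (Or.inl fun t ht u hu htu => ?_)
    rw [div_lt_div_iff₀ (hden t) (hden u)]
    linarith [hdet t u, mul_pos h (hsq t u ht hu htu)]

/-- At high contrast `r`, and weights bounded away from zero, the quotient of the two weighted
expressions approaches `A / A'`. -/
theorem exists_contrast {A A' B B' q η : ℝ} (hA' : 0 < A') (hB : 0 ≤ B) (hB' : 0 ≤ B')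
    (hq : q < A / A') (hη : 0 < η) : ∃ ρ, ∀ r s x y : ℝ, ρ ≤ r → 0 < r → r * s = 1 → η ≤ x →
      x ≤ 1 → 0 ≤ y → y ≤ 1 →
      q * (x ^ 2 * (1 + A' * r) + y ^ 2 * (1 + B' * s)) <
        x ^ 2 * (1 + A * r) + y ^ 2 * (1 + B * s) := by
  rw [lt_div_iff₀ hA'] at hq
  have hgap : 0 < A - q * A' := by linarith
  -- Beyond this value the surplus `x ^ 2 * (A - q * A') * r` exceeds the part of the left side that
  -- does not grow with `r`, which is at most `max q 0 * (2 + B')`. The bound `1 ≤ r` gives `s ≤ 1`.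
  refine ⟨max 1 (max q 0 * (2 + B') / (η ^ 2 * (A - q * A')) + 1), ?_⟩
  intro r s x y hr hr0 hrs hx hx1 hy hy1
  have hr1 : 1 ≤ r := (le_max_left _ _).trans hr
  have hs0 : 0 < s := by
    by_contra h
    have := mul_nonpos_of_nonneg_of_nonpos hr0.le (not_lt.1 h)
    linarith
  have hs1 : s ≤ 1 := by
    have := mul_le_mul_of_nonneg_right hr1 hs0.le
    linarith
  have hx0 : 0 < x := hη.trans_le hx
  have hρ : max q 0 * (2 + B') < η ^ 2 * (A - q * A') * r := by
    have h1 : max q 0 * (2 + B') / (η ^ 2 * (A - q * A')) < r := by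
      linarith [(le_max_right _ _).trans hr]
    rwa [div_lt_iff₀ (by positivity), mul_comm r] at h1
  have hηx : η ^ 2 * (A - q * A') * r ≤ x ^ 2 * (A - q * A') * r := by gcongr
  have hrest : q * (x ^ 2 + y ^ 2 * (1 + B' * s)) ≤ max q 0 * (2 + B') := by
    have hx2 : x ^ 2 ≤ 1 := pow_le_one₀ hx0.le hx1
    have hy2 : y ^ 2 ≤ 1 := pow_le_one₀ hy hy1
    have hbs : B' * s ≤ B' := mul_le_of_le_one_right hB' hs1
    have h1 : y ^ 2 * (1 + B' * s) ≤ 1 + B' :=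
      (mul_le_of_le_one_left (by positivity) hy2).trans (by linarith)
    have h2 : 0 ≤ y ^ 2 * (1 + B' * s) := by positivity
    exact mul_le_mul (le_max_left _ _) (by linarith) (by positivity) (le_max_right _ _)
  have h3 : 0 ≤ y ^ 2 * (1 + B * s) := by positivity
  have h4 : 0 ≤ x ^ 2 := sq_nonneg x
  linarith

/-! ### Spectra of the iteration operators -/

theorem GovernedBy.rate_bound {E : Type*} [AddCommGroup E] [Module ℝ E] {P : Module.End ℝ E}
    {lo hi κ : ℝ} (h : GovernedBy P lo hi) (hle : lo ≤ hi) (hκ : hi / lo ≤ κ) :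
    condNumber P ≤ κ ∧ ∃ θ : ℝ, 0 < θ ∧
      convergenceRate (1 - θ • P) ≤ ENNReal.ofReal ((κ - 1) / (κ + 1)) := by
  obtain ⟨hlo, -, hcond, hrate⟩ := h
  have h1 : 1 ≤ hi / lo := (one_le_div hlo).2 hle
  refine ⟨hcond.trans hκ, 2 / (lo + hi), by positivity [hlo.trans_le hle], hrate.trans
    (ENNReal.ofReal_le_ofReal ?_)⟩
  rw [div_le_div_iff₀ (by linarith) (by linarith)]
  linarith

namespace Triangulation

variable {D : Decomposition} (M : Triangulation D)

/-- These energies have unit coefficients, so the basis and the `μ i` serve all `ν` at once;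
coefficients enter later only through the factor `ν 1 / ν 0`. -/
theorem exists_schur_eigenbasis :
    ∃ (b : Module.Basis (Fin (Module.finrank ℝ M.V)) ℝ M.V) (μ : Fin (Module.finrank ℝ M.V) → ℝ),
      (∀ i, 0 < μ i) ∧ ∀ i y, M.schurForm 1 (b i) y = μ i * M.schurForm 0 (b i) y := by
  obtain ⟨b, μ, h⟩ := exists_simultaneous_eigenbasis (M.schurForm 0) (M.schurForm 1)
    (M.schurForm_comm 0) (M.schurForm_pos 0) (M.schurForm_comm 1)
  refine ⟨b, μ, fun i => ?_, h⟩
  have h1 := M.schurForm_pos 1 (b i) (b.ne_zero i)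
  rw [h] at h1
  exact pos_of_mul_pos_left h1 (M.schurForm_pos 0 (b i) (b.ne_zero i)).le

section Eigenbasis

variable {M} {n : ℕ} {b : Module.Basis (Fin n) ℝ M.V} {μ : Fin n → ℝ} {ν : Fin 2 → ℝ}

theorem S_one_apply_eigenbasis (hν : ∀ i, 0 < ν i)
    (hb : ∀ i y, M.schurForm 1 (b i) y = μ i * M.schurForm 0 (b i) y) (i : Fin n) :
    M.S ν 1 (b i) = (ν 1 / ν 0 * μ i) • M.S ν 0 (b i) := by
  refine M.pair_ext fun v => ?_
  have := (hν 0).ne'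
  rw [map_smul, LinearMap.smul_apply, smul_eq_mul, pair_S, pair_S, hb]
  field_simp

theorem SInv_zero_S_one_apply_eigenbasis (hν : ∀ i, 0 < ν i)
    (hb : ∀ i y, M.schurForm 1 (b i) y = μ i * M.schurForm 0 (b i) y) (i : Fin n) :
    M.SInv ν 0 (M.S ν 1 (b i)) = (ν 1 / ν 0 * μ i) • b i := by
  rw [S_one_apply_eigenbasis hν hb, map_smul, M.SInv_S hν]

theorem SInv_one_S_zero_apply_eigenbasis (hν : ∀ i, 0 < ν i) (hμ : ∀ i, 0 < μ i)
    (hb : ∀ i y, M.schurForm 1 (b i) y = μ i * M.schurForm 0 (b i) y) (i : Fin n) :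
    M.SInv ν 1 (M.S ν 0 (b i)) = (ν 1 / ν 0 * μ i)⁻¹ • b i := by
  have h : M.S ν 0 (b i) = (ν 1 / ν 0 * μ i)⁻¹ • M.S ν 1 (b i) := by
    rw [S_one_apply_eigenbasis hν hb, smul_smul, inv_mul_cancel₀, one_smul]
    exact (mul_pos (div_pos (hν 1) (hν 0)) (hμ i)).ne'
  rw [h, map_smul, M.SInv_S hν]

theorem nnOperator_apply_eigenbasis (hν : ∀ i, 0 < ν i) (hμ : ∀ i, 0 < μ i)
    (hb : ∀ i y, M.schurForm 1 (b i) y = μ i * M.schurForm 0 (b i) y) (δ : Fin 2 → ℝ) (i : Fin n) :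
    M.nnOperator ν δ (b i) = weightedEigenvalue δ (ν 1 / ν 0 * μ i) • b i := by
  simp only [nnOperator, scaling, Module.End.mul_apply, LinearMap.add_apply, LinearMap.smul_apply,
    Module.End.one_apply, map_add, map_smul, M.SInv_S hν,
    SInv_zero_S_one_apply_eigenbasis hν hb, SInv_one_S_zero_apply_eigenbasis hν hμ hb,
    weightedEigenvalue]
  module

/-- The images of the eigenbasis under `S₁` form an eigenbasis of the D-D operator. -/
noncomputable def fluxBasis (b : Module.Basis (Fin n) ℝ M.V) (hν : ∀ i, 0 < ν i) :
    Module.Basis (Fin n) ℝ M.V :=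
  b.map (LinearEquiv.ofBijective (M.S ν 0) ((Module.End.isUnit_iff _).1 (M.isUnit_S hν 0)))

/-- With τ the eigenvalue of S₀⁻¹S₁, the sum of inverses sends S₀b to (1 + 1/τ)b, and the weighted
Schur complements send b to (δ₀² + δ₁²τ)S₀b. Since (1 + 1/τ)τ = 1 + τ, the N-N eigenvalue appears
with the weights interchanged. -/
theorem ddOperator_apply_fluxBasis (hν : ∀ i, 0 < ν i) (hμ : ∀ i, 0 < μ i)
    (hb : ∀ i y, M.schurForm 1 (b i) y = μ i * M.schurForm 0 (b i) y) (δ : Fin 2 → ℝ) (i : Fin n) :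
    M.ddOperator ν δ (fluxBasis b hν i) =
      weightedEigenvalue (fun i => δ i.rev) (ν 1 / ν 0 * μ i) • fluxBasis b hν i := by
  have e : fluxBasis b hν i = M.S ν 0 (b i) := by simp [fluxBasis]
  have hτ : ν 1 / ν 0 * μ i ≠ 0 := (mul_pos (div_pos (hν 1) (hν 0)) (hμ i)).ne'
  have h0 : (0 : Fin 2).rev = 1 := rfl
  have h1 : (1 : Fin 2).rev = 0 := rfl
  rw [e]
  simp only [ddOperator, scaling, Module.End.mul_apply, LinearMap.add_apply, LinearMap.smul_apply,
    Module.End.one_apply, map_add, map_smul, smul_add, M.SInv_S hν,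
    SInv_one_S_zero_apply_eigenbasis hν hμ hb, S_one_apply_eigenbasis hν hb,
    weightedEigenvalue, h0, h1, smul_smul]
  generalize ν 1 / ν 0 * μ i = τ at hτ
  rw [← add_smul, ← add_smul, ← add_smul]
  congr 1
  field_simp
  ring

/-- On `b i` the two energies differ by the factor `μ i`, and both are compared with the same
interface norm. -/
theorem eigenvalue_mem_of_normEquiv {c C : Fin 2 → ℝ} (hcC : M.NormEquiv c C)
    (hb : ∀ i y, M.schurForm 1 (b i) y = μ i * M.schurForm 0 (b i) y) (i : Fin n) :
    c 0 / C 1 ≤ μ i ∧ μ i ≤ C 0 / c 1 := by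
  obtain ⟨hc0, hC0, h0⟩ := hcC 0
  obtain ⟨hc1, hC1, h1⟩ := hcC 1
  obtain ⟨l0, u0⟩ := h0 (b i)
  obtain ⟨l1, u1⟩ := h1 (b i)
  have hpos := M.schurForm_pos 0 (b i) (b.ne_zero i)
  rw [← schurForm_self_eq] at l0 u0 l1 u1
  rw [hb] at l1 u1
  constructor
  · rw [div_le_iff₀ (hc1.trans_le hC1)]
    refine le_of_mul_le_mul_right ?_ hpos
    linarith
  · rw [le_div_iff₀ hc1]
    refine le_of_mul_le_mul_right ?_ hpos
    linarith

end Eigenbasis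

theorem nnOperator_governedBy {c C ν δ : Fin 2 → ℝ} (hcC : M.NormEquiv c C) (hν : ∀ i, 0 < ν i)
    (hδ : IsWeight δ) : GovernedBy (M.nnOperator ν δ) (nnMin c C ν δ) (nnMax c C ν δ) := by
  have hc : ∀ i, 0 < c i ∧ c i ≤ C i := fun i => ⟨(hcC i).1, (hcC i).2.1⟩
  obtain ⟨b, μ, hμ, hb⟩ := M.exists_schur_eigenbasis
  refine governedBy_of_eigenbasis b (nnOperator_apply_eigenbasis hν hμ hb δ) (nnMin_pos hc hν hδ)
    (nnMin_le_nnMax hc hν) fun i => ?_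
  obtain ⟨h1, h2⟩ := eigenvalue_mem_of_normEquiv hcC hb i
  exact weightedEigenvalue_mem hc hν h1 h2

theorem ddOperator_governedBy {c C ν δ : Fin 2 → ℝ} (hcC : M.NormEquiv c C) (hν : ∀ i, 0 < ν i)
    (hδ : IsWeight δ) : GovernedBy (M.ddOperator ν δ) (ddMin c C ν δ) (ddMax c C ν δ) := by
  have hc : ∀ i, 0 < c i ∧ c i ≤ C i := fun i => ⟨(hcC i).1, (hcC i).2.1⟩
  obtain ⟨b, μ, hμ, hb⟩ := M.exists_schur_eigenbasis
  rw [ddMin_eq, ddMax_eq]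
  refine governedBy_of_eigenbasis (fluxBasis b hν) (ddOperator_apply_fluxBasis hν hμ hb δ)
    (nnMin_pos hc hν hδ.rev) (nnMin_le_nnMax hc hν) fun i => ?_
  obtain ⟨h1, h2⟩ := eigenvalue_mem_of_normEquiv hcC hb i
  exact weightedEigenvalue_mem hc hν h1 h2

/-- Changing `ν` only multiplies the operator by `ν 1 / ν 0`, and a positive factor cancels in the
quotient of eigenvalues. -/
theorem condNumber_SInv_mul_S {ν : Fin 2 → ℝ} (hν : ∀ i, 0 < ν i) :
    condNumber (M.SInv ν 0 * M.S ν 1) = condNumber (M.SInv 1 0 * M.S 1 1) := by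
  obtain ⟨b, μ, -, hb⟩ := M.exists_schur_eigenbasis
  rw [← condNumber_smul (M.SInv 1 0 * M.S 1 1) (div_pos (hν 1) (hν 0))]
  congr 1
  refine b.ext fun i => ?_
  rw [LinearMap.smul_apply, Module.End.mul_apply, Module.End.mul_apply,
    SInv_zero_S_one_apply_eigenbasis hν hb,
    SInv_zero_S_one_apply_eigenbasis (ν := 1) (fun _ => one_pos) hb, smul_smul]
  simp

/-! ### High contrast -/

/-- With both weights at least `η`, the summand carrying the large ratio dominates numerator and
denominator of `κ`. In either direction of contrast the quotient of its coefficients is the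
threshold for `q`. -/
theorem forcesDegenerate_kappa {c C : Fin 2 → ℝ} (hc : ∀ i, 0 < c i ∧ c i ≤ C i) {q : ℝ}
    (hq : q < C 0 * C 1 / (c 0 * c 1)) :
    ForcesDegenerate (fun ν δ => nnKappa c C ν δ ≤ q ∨ ddKappa c C ν δ ≤ q) := by
  have hC : ∀ i, 0 < C i := fun i => (hc i).1.trans_le (hc i).2
  intro η hη
  have p : ∀ i j, 0 < C i / c j := fun i j => div_pos (hC i) (hc j).1
  have p' : ∀ i j, 0 < c i / C j := fun i j => div_pos (hc i).1 (hC j)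
  have q1 : q < C 0 / c 1 / (c 0 / C 1) := hq.trans_eq (by rw [div_div_div_eq, mul_comm (c 1)])
  have q2 : q < C 1 / c 0 / (c 1 / C 0) := hq.trans_eq (by rw [div_div_div_eq, mul_comm (C 1)])
  obtain ⟨ρ₁, h₁⟩ := exists_contrast (p' 0 1) (p 1 0).le (p' 1 0).le q1 hη
  obtain ⟨ρ₂, h₂⟩ := exists_contrast (p' 1 0) (p 0 1).le (p' 0 1).le q2 hη
  have key : ∀ ν δ : Fin 2 → ℝ, (∀ i, 0 < ν i) →
      (max ρ₁ ρ₂ ≤ ν 1 / ν 0 ∨ max ρ₁ ρ₂ ≤ ν 0 / ν 1) → IsWeight δ → (∀ i, η ≤ δ i) →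
      q < nnKappa c C ν δ := fun ν δ hν hρ hδ hη' => by
    rw [nnKappa, lt_div_iff₀ (nnMin_pos hc hν hδ)]
    have h0 := (hν 0).ne'
    have h1 := (hν 1).ne'
    rcases hρ with hρ | hρ
    · exact h₁ _ _ _ _ ((le_max_left _ _).trans hρ) (div_pos (hν 1) (hν 0)) (by field_simp)
        (hη' 0) (hδ.le_one 0) (hδ.1 1) (hδ.le_one 1)
    · have := h₂ _ _ _ _ ((le_max_right _ _).trans hρ) (div_pos (hν 0) (hν 1))
        (by field_simp : ν 0 / ν 1 * (ν 1 / ν 0) = 1)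
        (hη' 1) (hδ.le_one 1) (hδ.1 0) (hδ.le_one 0)
      rw [nnMin, nnMax, add_comm, add_comm (δ 0 ^ 2 * _)]
      rw [add_comm] at this
      linarith
  refine ⟨max ρ₁ ρ₂, fun ν hν hρ δ hδ hgood => ?_⟩
  by_contra! hne
  rcases hgood with h | h
  · exact absurd h (not_le.2 (key ν δ hν hρ hδ hne))
  · rw [ddKappa_eq] at h
    exact absurd h (not_le.2 (key ν _ hν hρ hδ.rev fun i => hne _))

/-- Since `q < 1`, the parameter `θ` must be positive, and then `1 - q ≤ θ * x` and `θ * y ≤ 1 + q`.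
-/
theorem quotient_le_of_rate {q θ x y : ℝ} (hq : q < 1) (hx : 0 < x)
    (h1 : |1 - θ * x| ≤ q) (h2 : |1 - θ * y| ≤ q) : y ≤ (1 + q) / (1 - q) * x := by
  rw [abs_le] at h1 h2
  have hθ : 0 < θ := by
    by_contra h
    have := mul_nonpos_of_nonpos_of_nonneg (not_lt.1 h) hx.le
    linarith
  refine le_of_mul_le_mul_left ?_ hθ
  rw [mul_left_comm]
  have hQ : 0 ≤ (1 + q) / (1 - q) := div_nonneg (by linarith [h1.1, h1.2]) (by linarith)
  calc θ * y ≤ 1 + q := by linarith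
    _ = (1 + q) / (1 - q) * (1 - q) := (div_mul_cancel₀ _ (by linarith)).symm
    _ ≤ _ := mul_le_mul_of_nonneg_left (by linarith) hQ

/-- The hypothesis on `q` says that (1 + q)/(1 - q) is below the ratio of the extreme `μ`. At high
contrast and nondegenerate weights the iteration eigenvalues at these two `μ` have a ratio above
that bound, so no `θ` achieves the rate. -/
theorem forcesDegenerate_rate {q : ℝ} (hq0 : 0 ≤ q)
    (hq : q < (condNumber (M.SInv 1 0 * M.S 1 1) - 1) / (condNumber (M.SInv 1 0 * M.S 1 1) + 1)) :
    ForcesDegenerate (fun ν δ => ∃ θ : ℝ,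
      convergenceRate (M.nnError ν δ θ) ≤ ENNReal.ofReal q ∨
      convergenceRate (M.ddError ν δ θ) ≤ ENNReal.ofReal q) := by
  obtain ⟨b, μ, hμ, hb⟩ := M.exists_schur_eigenbasis
  have hspec : spectrum ℝ (M.SInv 1 0 * M.S 1 1) = range μ :=
    spectrum_of_eigenbasis b fun i => by
      rw [Module.End.mul_apply, SInv_zero_S_one_apply_eigenbasis (ν := 1) (fun _ => one_pos) hb]
      simp
  rw [condNumber, hspec] at hq
  -- On the zero space the condition number is 0 by convention, and the hypothesis would read `q <
  -- -1`.
  rcases isEmpty_or_nonempty (Fin (Module.finrank ℝ M.V)) with hn | hn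
  · simp only [range_eq_empty, Real.sSup_empty, zero_div] at hq
    norm_num at hq
    linarith
  obtain ⟨iM, hM⟩ := Finite.exists_max μ
  obtain ⟨im, hm⟩ := Finite.exists_min μ
  have hsup : sSup (range μ) = μ iM := IsGreatest.csSup_eq ⟨⟨iM, rfl⟩, by rintro _ ⟨i, rfl⟩; exact hM i⟩
  have hinf : sInf (range μ) = μ im := IsLeast.csInf_eq ⟨⟨im, rfl⟩, by rintro _ ⟨i, rfl⟩; exact hm i⟩
  rw [hsup, hinf] at hq
  have hk : 0 < μ iM / μ im := div_pos (hμ _) (hμ _)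
  have hq1 : q < 1 := hq.trans ((div_lt_one (by linarith)).2 (by linarith))
  have hQ : (1 + q) / (1 - q) < μ iM / μ im := by
    rw [lt_div_iff₀ (by linarith)] at hq
    rw [div_lt_iff₀ (by linarith)]
    linarith
  -- If `ν 0 / ν 1` is the large ratio, it is multiplied by the inverse eigenvalues, and the largest
  -- and smallest `μ` exchange roles.
  have hQ' : (1 + q) / (1 - q) < (μ im)⁻¹ / (μ iM)⁻¹ := hQ.trans_eq (by
    rw [div_inv_eq_mul, mul_comm, div_eq_mul_inv])
  intro η hη
  obtain ⟨ρ₁, h₁⟩ := exists_contrast (hμ im) (inv_pos.2 (hμ iM)).le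
    (inv_pos.2 (hμ im)).le hQ hη
  obtain ⟨ρ₂, h₂⟩ := exists_contrast (inv_pos.2 (hμ iM)) (hμ im).le
    (hμ iM).le hQ' hη
  have key : ∀ ν δ : Fin 2 → ℝ, (∀ i, 0 < ν i) →
      (max ρ₁ ρ₂ ≤ ν 1 / ν 0 ∨ max ρ₁ ρ₂ ≤ ν 0 / ν 1) → IsWeight δ → (∀ i, η ≤ δ i) →
      ∃ i j, (1 + q) / (1 - q) * weightedEigenvalue δ (ν 1 / ν 0 * μ i) <
        weightedEigenvalue δ (ν 1 / ν 0 * μ j) := fun ν δ hν hρ hδ hη' => by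
    have h0 := (hν 0).ne'
    have h1 := (hν 1).ne'
    have e : ∀ i, weightedEigenvalue δ (ν 1 / ν 0 * μ i) =
        δ 0 ^ 2 * (1 + μ i * (ν 1 / ν 0)) + δ 1 ^ 2 * (1 + (μ i)⁻¹ * (ν 0 / ν 1)) := fun i => by
      rw [weightedEigenvalue, mul_inv, inv_div, mul_comm (ν 1 / ν 0), mul_comm (ν 0 / ν 1)]
    simp only [e]
    rcases hρ with hρ | hρ
    · exact ⟨im, iM, h₁ _ _ _ _ ((le_max_left _ _).trans hρ) (div_pos (hν 1) (hν 0))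
        (by field_simp) (hη' 0) (hδ.le_one 0) (hδ.1 1) (hδ.le_one 1)⟩
    · have := h₂ _ _ _ _ ((le_max_right _ _).trans hρ) (div_pos (hν 0) (hν 1))
        (by field_simp : ν 0 / ν 1 * (ν 1 / ν 0) = 1)
        (hη' 1) (hδ.le_one 1) (hδ.1 0) (hδ.le_one 0)
      exact ⟨iM, im, by linarith⟩
  have contra : ∀ ν δ : Fin 2 → ℝ, (∀ i, 0 < ν i) →
      (max ρ₁ ρ₂ ≤ ν 1 / ν 0 ∨ max ρ₁ ρ₂ ≤ ν 0 / ν 1) → IsWeight δ → (∀ i, η ≤ δ i) → ∀ θ : ℝ,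
      ¬ ∀ i, |1 - θ * weightedEigenvalue δ (ν 1 / ν 0 * μ i)| ≤ q :=
    fun ν δ hν hρ hδ hη' θ H => by
      obtain ⟨i, j, hij⟩ := key ν δ hν hρ hδ hη'
      exact absurd (quotient_le_of_rate hq1 (weightedEigenvalue_pos hδ
        (mul_pos (div_pos (hν 1) (hν 0)) (hμ i))) (H i) (H j)) (not_le.2 hij)
  refine ⟨max ρ₁ ρ₂, fun ν hν hρ δ hδ ⟨θ, hgood⟩ => ?_⟩
  by_contra! hne
  rcases hgood with h | h
  · exact contra ν δ hν hρ hδ hne θ ((convergenceRate_le_iff b (one_sub_smul_eigenbasis b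
      (nnOperator_apply_eigenbasis hν hμ hb δ) θ) hq0).1 h)
  · exact contra ν _ hν hρ hδ.rev (fun i => hne _) θ ((convergenceRate_le_iff (fluxBasis b hν)
      (one_sub_smul_eigenbasis _ (ddOperator_apply_fluxBasis hν hμ hb δ) θ) hq0).1 h)

/-! ### Degenerate weights -/

theorem nnError_zero_one (ν : Fin 2 → ℝ) (θ : ℝ) : M.nnError ν ![0, 1] θ = M.dnError ν 1 θ := by
  simp [nnError, nnOperator, scaling, dnError]

theorem nnError_one_zero (ν : Fin 2 → ℝ) (θ : ℝ) : M.nnError ν ![1, 0] θ = M.dnError ν 0 θ := by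
  simp [nnError, nnOperator, scaling, dnError]

/-- S₁(S₀⁻¹ + S₁⁻¹)S₀ = S₀ + S₁ = S₀S₀⁻¹(S₀ + S₁), a similarity written without an inverse on the
right. -/
theorem ddError_zero_one {ν : Fin 2 → ℝ} (hν : ∀ i, 0 < ν i) (θ : ℝ) :
    M.ddError ν ![0, 1] θ * M.S ν 0 = M.S ν 0 * M.dnError ν 0 θ := by
  refine LinearMap.ext fun g => ?_
  simp [ddError, ddOperator, scaling, dnError, M.SInv_S hν, M.S_SInv hν, add_comm]

theorem ddError_one_zero {ν : Fin 2 → ℝ} (hν : ∀ i, 0 < ν i) (θ : ℝ) :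
    M.ddError ν ![1, 0] θ * M.S ν 1 = M.S ν 1 * M.dnError ν 1 θ := by
  refine LinearMap.ext fun g => ?_
  simp [ddError, ddOperator, scaling, dnError, M.SInv_S hν, M.S_SInv hν, add_comm]

end Triangulation

end TwoDomain

theorem mainTheorem6 (D : Decomposition) (M : Triangulation D) :
    -- The operators are well defined, and `Sᵢ` is symmetric positive definite.
    (∀ i, (∃! H : M.V →ₗ[ℝ] M.WSub i, M.IsHarmonicExt i H)) ∧
    (∀ ν : Fin 2 → ℝ, (∀ i, 0 < ν i) → ∀ i,
      (∀ g : M.V, M.SolvesDirichlet ν 0 i g.1 (M.harmonicExt i g).1) ∧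
      (∃! T : Module.End ℝ M.V, M.IsSchur ν i T) ∧
      (∀ g h : M.V, pairing D (M.S ν i g).1 h.1 = pairing D g.1 (M.S ν i h).1) ∧
      (∀ g : M.V, g ≠ 0 → 0 < pairing D (M.S ν i g).1 g.1) ∧
      IsUnit (M.S ν i)) ∧
    -- They are the error operators of the iterations.
    (∀ ν : Fin 2 → ℝ, (∀ i, 0 < ν i) → ∀ f : Plane → ℝ, IntegrableOn f D.Ω →
      ∃ u : M.W, M.SolvesGlobal ν f u ∧ (∀ u' : M.W, M.SolvesGlobal ν f u' → u' = u) ∧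
      ∃ l : M.V, (∀ v ∈ M.WSub 0, pairing D l.1 v = form D ν 0 u.1 v - load D f 0 v) ∧
      ∀ (δ : Fin 2 → ℝ) (θ : ℝ) (g g' : M.V),
        (M.NNStep ν f δ θ g g' ↔ g' - M.trace u = M.nnError ν δ θ (g - M.trace u)) ∧
        (M.DDStep ν f δ θ g g' ↔ g' - l = M.ddError ν δ θ (g - l)) ∧
        (M.DNStep ν f θ 0 1 g g' ↔ g' - M.trace u = M.dnError ν 1 θ (g - M.trace u)) ∧
        (M.DNStep ν f θ 1 0 g g' ↔ g' - M.trace u = M.dnError ν 0 θ (g - M.trace u))) ∧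
    -- Norm-equivalence constants exist (and do not involve the coefficients).
    (∃ c C : Fin 2 → ℝ, M.NormEquiv c C) ∧
    (∀ c C : Fin 2 → ℝ, M.NormEquiv c C →
      -- Bounds for all weights.
      (∀ ν δ : Fin 2 → ℝ, (∀ i, 0 < ν i) → IsWeight δ →
        GovernedBy (M.nnOperator ν δ) (nnMin c C ν δ) (nnMax c C ν δ) ∧
        GovernedBy (M.ddOperator ν δ) (ddMin c C ν δ) (ddMax c C ν δ)) ∧
      -- With the square root weights, `κ` and the rate are bounded independently of `ν`.
      (∀ ν : Fin 2 → ℝ, (∀ i, 0 < ν i) →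
        IsWeight (sqrtWeight ν) ∧
        (nnKappa c C ν (sqrtWeight ν) ≤ kappaBound c C ∧
          condNumber (M.nnOperator ν (sqrtWeight ν)) ≤ kappaBound c C ∧
          ∃ θ : ℝ, 0 < θ ∧ convergenceRate (M.nnError ν (sqrtWeight ν) θ) ≤
            ENNReal.ofReal ((kappaBound c C - 1) / (kappaBound c C + 1))) ∧
        (ddKappa c C ν (sqrtWeight ν) ≤ C 0 * C 1 / (c 0 * c 1) ∧
          condNumber (M.ddOperator ν (sqrtWeight ν)) ≤ C 0 * C 1 / (c 0 * c 1) ∧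
          ∃ θ : ℝ, 0 < θ ∧ convergenceRate (M.ddError ν (sqrtWeight ν) θ) ≤
            ENNReal.ofReal ((C 0 * C 1 / (c 0 * c 1) - 1) / (C 0 * C 1 / (c 0 * c 1) + 1))) ∧
        -- For D-D, interchanging the two weights gives the N-N bound.
        (ddKappa c C ν (fun i => sqrtWeight ν i.rev) ≤ kappaBound c C ∧
          condNumber (M.ddOperator ν (fun i => sqrtWeight ν i.rev)) ≤ kappaBound c C ∧
          ∃ θ : ℝ, 0 < θ ∧ convergenceRate (M.ddError ν (fun i => sqrtWeight ν i.rev) θ) ≤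
            ENNReal.ofReal ((kappaBound c C - 1) / (kappaBound c C + 1)))) ∧
      -- As a function of the weight, `κ` can only be minimal at the degenerate weights.
      (∀ ν : Fin 2 → ℝ, (∀ i, 0 < ν i) →
        ConstOrStrict (fun t => nnKappa c C ν ![t, 1 - t]) ∧
        ConstOrStrict (fun t => ddKappa c C ν ![t, 1 - t])) ∧
      -- In the limit of high contrast, a smaller `κ` forces degenerate weights.
      (∀ q : ℝ, q < C 0 * C 1 / (c 0 * c 1) →
        ForcesDegenerate (fun ν δ => nnKappa c C ν δ ≤ q ∨ ddKappa c C ν δ ≤ q))) ∧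
    -- The same for the true rates, whatever the relaxation parameter: `k` is the condition number
    -- of `S₁⁻¹S₂`, which does not depend on the coefficients.
    (∃ k : ℝ, (∀ ν : Fin 2 → ℝ, (∀ i, 0 < ν i) → condNumber (M.SInv ν 0 * M.S ν 1) = k) ∧
      ∀ q : ℝ, 0 ≤ q → q < (k - 1) / (k + 1) →
        ForcesDegenerate (fun ν δ => ∃ θ : ℝ,
          convergenceRate (M.nnError ν δ θ) ≤ ENNReal.ofReal q ∨
          convergenceRate (M.ddError ν δ θ) ≤ ENNReal.ofReal q)) ∧
    -- For degenerate weights the methods are D-N (for D-D, up to similarity by `Sᵢ`).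
    (∀ ν : Fin 2 → ℝ, (∀ i, 0 < ν i) → ∀ θ : ℝ,
      M.nnError ν ![0, 1] θ = M.dnError ν 1 θ ∧
      M.nnError ν ![1, 0] θ = M.dnError ν 0 θ ∧
      M.ddError ν ![0, 1] θ * M.S ν 0 = M.S ν 0 * M.dnError ν 0 θ ∧
      M.ddError ν ![1, 0] θ * M.S ν 1 = M.S ν 1 * M.dnError ν 1 θ) := by
  refine ⟨M.existsUnique_isHarmonicExt, fun ν hν i => ⟨fun g => ?_, M.existsUnique_isSchur ν i,
    fun g h => ?_, fun g hg => ?_, M.isUnit_S hν i⟩, fun ν hν f hf => ?_, M.exists_normEquiv,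
    fun c C hcC => ?_, ⟨condNumber (M.SInv 1 0 * M.S 1 1), fun ν hν => M.condNumber_SInv_mul_S hν,
      fun q hq0 hq => M.forcesDegenerate_rate hq0 hq⟩, fun ν hν θ => ⟨M.nnError_zero_one ν θ,
      M.nnError_one_zero ν θ, M.ddError_zero_one hν θ, M.ddError_one_zero hν θ⟩⟩
  · exact (M.solvesDirichlet_zero_iff hν).2 rfl
  · rw [pairing_comm D g.1, ← M.pair_apply, ← M.pair_apply, M.pair_S, M.pair_S, M.schurForm_comm]
  · rw [← M.pair_apply, M.pair_S]
    exact mul_pos (hν i) (M.schurForm_pos i g hg)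
  · obtain ⟨u, hu, huniq⟩ := M.existsUnique_solvesGlobal hν hf
    obtain ⟨l, hl⟩ := M.exists_isReference hf hu
    refine ⟨u, hu, huniq, l, fun v hv => ?_, fun δ θ g g' => ⟨Triangulation.nnStep_iff hν hl δ θ g g',
      Triangulation.ddStep_iff hν hl δ θ g g', Triangulation.dnStep_iff hν hl θ (by decide) g g',
      Triangulation.dnStep_iff hν hl θ (by decide) g g'⟩⟩
    have h1 := hl.flux_zero ⟨v, hv⟩
    rw [← M.pairing_subTrace, ← M.form_eq_energy] at h1
    rw [← h1, form_congr D ν 0 (eqOn_restr_sub D 0 u.1).symm fun _ _ => rfl]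
    rfl
  · have hc : ∀ i, 0 < c i ∧ c i ≤ C i := fun i => ⟨(hcC i).1, (hcC i).2.1⟩
    refine ⟨fun ν δ hν hδ => ⟨M.nnOperator_governedBy hcC hν hδ, M.ddOperator_governedBy hcC hν hδ⟩,
      fun ν hν => ?_, fun ν hν => ?_, fun q hq => Triangulation.forcesDegenerate_kappa hc hq⟩
    · have hw := isWeight_sqrtWeight hν
      have hle : ∀ δ, ddMin c C ν δ ≤ ddMax c C ν δ := fun δ => by
        rw [ddMin_eq, ddMax_eq]
        exact nnMin_le_nnMax hc hν
      have hnn := nnKappa_sqrtWeight_le hc hν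
      have hdd : ddKappa c C ν (sqrtWeight ν) ≤ C 0 * C 1 / (c 0 * c 1) := by
        rw [ddKappa_eq]
        exact nnKappa_le hc hν hw.rev
      -- Reversing the reversed weights restores them, so the N-N bound applies verbatim.
      have hrev : ddKappa c C ν (fun i => sqrtWeight ν i.rev) ≤ kappaBound c C := by
        rw [ddKappa_eq]
        simpa only [Fin.rev_rev] using hnn
      exact ⟨hw, ⟨hnn, (M.nnOperator_governedBy hcC hν hw).rate_bound (nnMin_le_nnMax hc hν) hnn⟩,
        ⟨hdd, (M.ddOperator_governedBy hcC hν hw).rate_bound (hle _) hdd⟩,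
        ⟨hrev, (M.ddOperator_governedBy hcC hν hw.rev).rate_bound (hle _) hrev⟩⟩
    · have hC : ∀ i, 0 < C i := fun i => (hc i).1.trans_le (hc i).2
      have hpos : ∀ i j k l : Fin 2, 0 < 1 + c i / C j * (ν k / ν l) := fun i j k l =>
        add_pos one_pos (mul_pos (div_pos (hc i).1 (hC j)) (div_pos (hν k) (hν l)))
      -- With weights t and 1 - t each `κ` unfolds to a quotient of this form; only the
      -- denominator's coefficients must be positive.
      exact ⟨constOrStrict_div (hpos 0 1 1 0) (hpos 1 0 0 1),
        constOrStrict_div (hpos 1 0 0 1) (hpos 0 1 1 0)⟩
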